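/- **Notation.** $D_r=\{|\xi|<r\}$, $D=D_1$; $f'=\partial_\xi f$. For $E\subset\mathbb C$, $H(E)$ is the set of functions analytic in a neighbourhood of $E$, and $\omega(E)$ the set of $f\in H(E)$ that are locally univalent (injective near every point of $E$) with $f(0)=0$, $f'(0)>0$. The space $H(D_r)\cap C(\overline{D_r})$ carries the supremum norm. For $g$ on $\partial D$ put $P[g](\xi)=\frac1{2\pi i}\int_{\partial D}g(z)\frac{z+\xi}{z-\xi}\frac{dz}{z}$, $\xi\in D$. A *strong\* solution* on $[0,T]$ is a family $f(\cdot,t)\in\omega(\overline D)$, $0\le t\le T$, continuously differentiable in $t$, with $$f_t=\xi f'\,P\Big[\frac1{|f'|^2}\Big],\qquad \xi\in D,\ 0\le t\le T .\tag{1}$$ Put $\big|\sum_{i\ge0}a_i\xi^i\big|_{M(r)}=\sum_{i\ge0}|a_i|r^i$ and $\big\|\sum_{j}v_j\xi^j\big\|_{\rho,n}=\sum_{j\ge1}|v_j|\rho^jj^{\frac12+n}$. **Theorem.** There are constants $c(j,k)>0$ $(j,k\ge0)$, depending on $j$ and $k$ only, such that the following holds. Let $r>1$, $t_1>0$, $l<1$,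 and let $f_{k_0}\in C^1([0,t_1],H(\overline{D_r}))$, with $f_{k_0}(\cdot,t)\in\omega(\overline{D_r})$ for $0\le t\le t_1$, be a strong\* solution of (1) on $[0,t_1]$ such that $f_{k_0}(\cdot,t)$ is a polynomial of degree $k_0$ for every $t$. Put $m=\min_{\overline{D_r}\times[0,t_1]}|f_{k_0}'|$. Then there is a constant $C=C(f_{k_0},t_1,r,l)>0$ such that for every $\rho>r$ and every function $f_0$ analytic in $D_\rho$ with $f_0(0)=0$, $f_0'(0)\in\mathbb R$ and $$\|f_0-f_{k_0}(\cdot,0)\|_{\rho,1}\le\frac{l}{\sqrt{k_0}}\,m ,$$ with $t_0=\min\big\{\frac1{Ck_0}\ln\frac\rho r,\ t_1\big\}$ there is a strong\* solution $f$ of (1) on $[0,t_0]$ with $f(\cdot,0)=f_0$ on $\overline{D_r}$, $f\in C^1([0,t_0],H(D_r)\cap C(\overline{D_r}))$ and $f(\cdot,t)\in\omega(D_r)$ for $0\le t\le t_0$, which has the following properties. (a) $\max_{0\le t\le t_0}|f'-f_{k_0}'|_{M(r)}\le l\,m$. Moreover $f$ is a limit of polynomial solutions: writing $f_0-f_{k_0}(\cdot,0)=\sum_{i\ge1}b_i\xi^i$,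 there are, for $k\ge0$, polynomial strong\* solutions $g_k\in C^1([0,t_0],H(\overline{D_r}))$ of (1) on $[0,t_0]$ with $g_k(\cdot,t)\in\omega(\overline{D_r})$ and $g_k(\cdot,0)=f_{k_0}(\cdot,0)+\sum_{i=1}^kb_i\xi^i$, and $\sup_{0\le t\le t_0}|g_k'-f'|_{M(r)}\to0$ as $k\to\infty$. (b) If $j\ge0$ is an integer and $\delta>0$ are such that $\|f_0-f_{k_0}(\cdot,0)\|_{\rho,j}\le\delta$, then $\max_{0\le t\le t_0}|f^{(j)}-f_{k_0}^{(j)}|_{M(r)}\le c(j,k_0)\,\delta$. -/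

import Mathlib

open Set Metric Filter Topology Polynomial

noncomputable section

namespace HeleShaw

/-- `f` belongs to `ω(E)`: it is analytic in a neighbourhood of every point of `E`, locally
univalent (injective on a full neighbourhood in `ℂ` of every point of `E`), `f 0 = 0`, and
`f' 0` is a positive real number. -/
structure IsOmega (E : Set ℂ) (f : ℂ → ℂ) : Prop where
  analytic : AnalyticOnNhd ℂ f E
  locallyUnivalent : ∀ z ∈ E, ∃ U ∈ 𝓝 z, InjOn f U
  map_zero : f 0 = 0
  deriv_im : (deriv f 0).im = 0
  deriv_re : 0 < (deriv f 0).re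

/-- `P[g](ξ) = (1 / 2πi) ∫_{∂D} g(z) (z + ξ) / (z - ξ) dz / z`. -/
def poissonOp (g : ℂ → ℝ) (ξ : ℂ) : ℂ :=
  (2 * (Real.pi : ℂ) * Complex.I)⁻¹ *
    ∮ z in C(0, 1), (g z : ℂ) * ((z + ξ) / (z - ξ)) / z

/-- `f` is a strong* solution of `f_t = ξ f' P[1 / |f'|²]` for `0 ≤ t ≤ T` (one-sided time
derivatives at the ends of the interval). -/
structure IsStrongStar (T : ℝ) (f : ℝ → ℂ → ℂ) : Prop where
  mem_omega : ∀ t ∈ Icc 0 T, IsOmega (closedBall 0 1) (f t)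
  contDiff_time : ∀ ξ ∈ closedBall (0 : ℂ) 1, ContDiffOn ℝ 1 (fun t => f t ξ) (Icc 0 T)
  equation : ∀ t ∈ Icc 0 T, ∀ ξ ∈ ball (0 : ℂ) 1,
    HasDerivWithinAt (fun s => f s ξ)
      (ξ * deriv (f t) ξ * poissonOp (fun z => 1 / ‖deriv (f t) z‖ ^ 2) ξ) (Icc 0 T) t

/-- `t ↦ f(·, t)` is a `C¹` curve on `[0, T]` with values in the Banach space of continuous
functions on the closed disk of radius `R`, with the supremum norm. -/
def IsC1Curve (R T : ℝ) (f : ℝ → ℂ → ℂ) : Prop :=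
  ∃ F : ℝ → C(closedBall (0 : ℂ) R, ℂ),
    (∀ t ∈ Icc 0 T, ∀ z : closedBall (0 : ℂ) R, F t z = f t z) ∧ ContDiffOn ℝ 1 F (Icc 0 T)

/-- `f ∈ C¹([0, T], H(D_r) ∩ C(closure D_r))`. The space `H(D_r) ∩ C(closure D_r)` carries the
supremum norm, and is closed in `C(closure D_r)`. -/
def IsC1Open (r T : ℝ) (f : ℝ → ℂ → ℂ) : Prop :=
  (∀ t ∈ Icc 0 T, AnalyticOnNhd ℂ (f t) (ball 0 r)) ∧ IsC1Curve r T f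

/-- `f ∈ C¹([0, T], H(closure D_r))`, where `H(closure D_r)` consists of the functions analytic
in a neighbourhood of the closed disk: `f` is a `C¹` curve of analytic functions on some larger
closed disk. -/
def IsC1Closed (r T : ℝ) (f : ℝ → ℂ → ℂ) : Prop :=
  ∃ R > r, (∀ t ∈ Icc 0 T, AnalyticOnNhd ℂ (f t) (closedBall 0 R)) ∧ IsC1Curve R T f

/-- The coefficient of `ξ ^ i` in the Taylor series of `φ` at `0`. -/
def coeffAt (φ : ℂ → ℂ) (i : ℕ) : ℂ := iteratedDeriv i φ 0 / (i.factorial : ℂ)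

/-- `|Σ aᵢ ξ^i|_{M(r)} = Σ_{i ≥ 0} |aᵢ| r^i`, possibly infinite. -/
def mNorm (r : ℝ) (φ : ℂ → ℂ) : ENNReal :=
  ∑' i : ℕ, ENNReal.ofReal (‖coeffAt φ i‖ * r ^ i)

/-- `‖Σ vⱼ ξ^j‖_{ρ,n} = Σ_{j ≥ 1} |vⱼ| ρ^j j^{1/2 + n}`, possibly infinite. -/
def rhoNorm (ρ : ℝ) (n : ℕ) (v : ℂ → ℂ) : ENNReal :=
  ∑' j : ℕ, ENNReal.ofReal
    (‖coeffAt v (j + 1)‖ * ρ ^ (j + 1) * ((j : ℝ) + 1) ^ ((1 : ℝ) / 2 + (n : ℝ)))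

/-- The family of functions given by a time-dependent polynomial. -/
def polyFun (p : ℝ → ℂ[X]) (t : ℝ) (z : ℂ) : ℂ := (p t).eval z

/-- The minimum of `|f'(ξ, t)|` over `|ξ| ≤ r`, `0 ≤ t ≤ T`. -/
def minDeriv (r T : ℝ) (f : ℝ → ℂ → ℂ) : ℝ :=
  sInf ((fun q : ℂ × ℝ => ‖deriv (f q.2) q.1‖) '' (closedBall (0 : ℂ) r ×ˢ Icc (0 : ℝ) T))

end HeleShaw

end

noncomputable section

namespace HeleShaw

open scoped ComplexConjugate NNReal

/-- The polynomial `z ^ N * conj (p (1 / conj z))`, for `p` of degree at most `N`. -/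
def starReflect (N : ℕ) (p : ℂ[X]) : ℂ[X] := (p.map (starRingEnd ℂ)).reflect N

theorem starReflect_add (N : ℕ) (p q : ℂ[X]) :
    starReflect N (p + q) = starReflect N p + starReflect N q := by
  simp [starReflect]

theorem starReflect_starReflect (N : ℕ) (p : ℂ[X]) : starReflect N (starReflect N p) = p := by
  simp only [starReflect, ← Polynomial.reflect_map, reflect_reflect, Polynomial.map_map]
  ext n; simp

theorem natDegree_starReflect_le {N : ℕ} {p : ℂ[X]} (hp : p.natDegree ≤ N) :
    (starReflect N p).natDegree ≤ N := by
  refine natDegree_reflect_le.trans (max_le le_rfl ?_)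
  exact (natDegree_map_le).trans hp

theorem starReflect_mul {N M : ℕ} {p q : ℂ[X]} (hp : p.natDegree ≤ N) (hq : q.natDegree ≤ M) :
    starReflect (N + M) (p * q) = starReflect N p * starReflect M q := by
  rw [starReflect, Polynomial.map_mul]
  exact reflect_mul _ _ (natDegree_map_le.trans hp) (natDegree_map_le.trans hq)

theorem coeff_starReflect (N n : ℕ) (p : ℂ[X]) :
    (starReflect N p).coeff n = conj (p.coeff (revAt N n)) := by
  simp [starReflect, coeff_reflect]

theorem eval_starReflect {N : ℕ} {p : ℂ[X]} (hp : p.natDegree ≤ N) {z : ℂ} (hz : z ≠ 0) :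
    (starReflect N p).eval z = z ^ N * conj (p.eval (conj z)⁻¹) := by
  have hq : (starReflect N p).natDegree ≤ N := natDegree_starReflect_le hp
  let _ : Invertible z := invertibleOfNonzero hz
  have h := eval₂_reflect_mul_pow (RingHom.id ℂ) z N (starReflect N p) hq
  rw [starReflect, reflect_reflect] at h
  rw [starReflect]
  simp only [eval₂_id, invOf_eq_inv] at h
  rw [← h, mul_comm]
  congr 1
  rw [eval_map, ← eval₂_id (p := p), Polynomial.hom_eval₂]
  simp

/-- On a circle about 0, reflection in the unit circle coincides with a dilation. Hence `φ (1 / conj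
z)` may be replaced there by the analytic function `φ (z / r²)`, to which the mean value property
applies. -/
theorem inv_conj_of_norm_eq {r : ℝ} {z : ℂ} (hz : ‖z‖ = r) : (conj z)⁻¹ = z / (r : ℂ) ^ 2 := by
  have h1 : conj z * z = (r : ℂ) ^ 2 := by rw [mul_comm, Complex.mul_conj, Complex.normSq_eq_norm_sq, hz]; simp
  rcases eq_or_ne z 0 with rfl | h0
  · simp
  have h2 : conj z ≠ 0 := by simpa using h0
  have h3 : (r : ℂ) ^ 2 ≠ 0 := by rw [← h1]; exact mul_ne_zero h2 h0
  rw [eq_div_iff h3, ← h1, inv_mul_cancel_left₀ h2]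

/-! ### Circle averages, Parseval's identity and the reflection inequality. -/

theorem circleIntegrable_of_continuous {E : Type*} [NormedAddCommGroup E] {g : ℂ → E} (hg : Continuous g) (c : ℂ) (r : ℝ) :
    CircleIntegrable g c r := hg.continuousOn.circleIntegrable'

theorem circleAverage_differentiable {g : ℂ → ℂ} (hg : Differentiable ℂ g) (r : ℝ) :
    Real.circleAverage g 0 r = g 0 :=
  (hg.diffContOnCl (s := ball (0 : ℂ) |r|)).circleAverage

theorem circleAverage_conj {g : ℂ → ℂ} {c : ℂ} {r : ℝ} (hg : CircleIntegrable g c r) :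
    Real.circleAverage (fun z => conj (g z)) c r = conj (Real.circleAverage g c r) :=
  (Complex.conjCLE : ℂ →L[ℝ] ℂ).circleAverage_comp_comm hg

theorem circleAverage_ofReal {g : ℂ → ℝ} {c : ℂ} {r : ℝ} (hg : CircleIntegrable g c r) :
    Real.circleAverage (fun z => (g z : ℂ)) c r = (Real.circleAverage g c r : ℝ) :=
  Complex.ofRealCLM.circleAverage_comp_comm hg

theorem circleAverage_re {g : ℂ → ℂ} {c : ℂ} {r : ℝ} (hg : CircleIntegrable g c r) :
    Real.circleAverage (fun z => (g z).re) c r = (Real.circleAverage g c r).re :=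
  Complex.reCLM.circleAverage_comp_comm hg

/-- On the circle `conj z = r² / z`, so for m ≤ n the integrand agrees with an entire function and
the mean value property evaluates the average. -/
theorem circleAverage_pow_mul_conj_pow_of_le (r : ℝ) {n m : ℕ} (h : m ≤ n) :
    Real.circleAverage (fun z : ℂ => z ^ n * conj z ^ m) 0 r =
      if n = m then (r : ℂ) ^ (2 * n) else 0 := by
  have h1 : Real.circleAverage (fun z : ℂ => z ^ n * conj z ^ m) 0 r =
      Real.circleAverage (fun z : ℂ => (r : ℂ) ^ (2 * m) * z ^ (n - m)) 0 r := by
    refine Real.circleAverage_congr_sphere fun z hz => ?_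
    have hz : ‖z‖ ^ 2 = r ^ 2 := by rw [mem_sphere_zero_iff_norm.1 hz, sq_abs]
    have h2 : z * conj z = (r : ℂ) ^ 2 := by
      rw [Complex.mul_conj, Complex.normSq_eq_norm_sq, hz]; simp
    change z ^ n * conj z ^ m = _
    rw [pow_mul, ← h2, mul_pow]
    nth_rw 1 [← Nat.sub_add_cancel h]
    ring
  rw [h1, circleAverage_differentiable (by fun_prop)]
  split_ifs with h3
  · simp [h3]
  · simp [show n - m ≠ 0 by omega]

theorem circleAverage_pow_mul_conj_pow (r : ℝ) (n m : ℕ) :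
    Real.circleAverage (fun z : ℂ => z ^ n * conj z ^ m) 0 r =
      if n = m then (r : ℂ) ^ (2 * n) else 0 := by
  rcases le_total m n with h | h
  · exact circleAverage_pow_mul_conj_pow_of_le r h
  · have h1 : (fun z : ℂ => z ^ n * conj z ^ m) = fun z => conj (z ^ m * conj z ^ n) := by
      funext z; simp [mul_comm]
    rw [h1, circleAverage_conj (circleIntegrable_of_continuous (by fun_prop) _ _),
      circleAverage_pow_mul_conj_pow_of_le r h]
    by_cases h3 : n = m
    · simp [h3]
    · simp [h3, Ne.symm h3]

/-- Parseval's identity for polynomials on a circle about the origin. -/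
theorem circleAverage_norm_eval_sq {p : ℂ[X]} {N : ℕ} (hp : p.natDegree < N) (r : ℝ) :
    Real.circleAverage (fun z : ℂ => ‖p.eval z‖ ^ 2) 0 r =
      ∑ n ∈ Finset.range N, ‖p.coeff n‖ ^ 2 * r ^ (2 * n) := by
  have key : ((Real.circleAverage (fun z : ℂ => ‖p.eval z‖ ^ 2) 0 r : ℝ) : ℂ) =
      ∑ n ∈ Finset.range N, (‖p.coeff n‖ : ℂ) ^ 2 * r ^ (2 * n) := by
    have h0 : ((Real.circleAverage (fun z : ℂ => ‖p.eval z‖ ^ 2) 0 r : ℝ) : ℂ) =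
        Real.circleAverage (fun z : ℂ => ((‖p.eval z‖ ^ 2 : ℝ) : ℂ)) 0 r :=
      (circleAverage_ofReal (circleIntegrable_of_continuous (by fun_prop) _ _)).symm
    rw [h0]
    have h1 : (fun z : ℂ => ((‖p.eval z‖ ^ 2 : ℝ) : ℂ)) = fun z : ℂ =>
        ∑ n ∈ Finset.range N, ∑ m ∈ Finset.range N, (p.coeff n * conj (p.coeff m)) • (z ^ n * conj z ^ m) := by
      funext z
      have : ((‖p.eval z‖ ^ 2 : ℝ) : ℂ) = p.eval z * conj (p.eval z) := by
        rw [Complex.mul_conj, Complex.normSq_eq_norm_sq]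
      rw [this, eval_eq_sum_range' hp, map_sum, Finset.sum_mul_sum]
      refine Finset.sum_congr rfl fun n _ => Finset.sum_congr rfl fun m _ => ?_
      simp; ring
    rw [h1, Real.circleAverage_fun_sum (fun n _ => circleIntegrable_of_continuous (by fun_prop) _ _)]
    refine Finset.sum_congr rfl fun n hn => ?_
    rw [Real.circleAverage_fun_sum (fun n _ => circleIntegrable_of_continuous (by fun_prop) _ _)]
    simp_rw [Real.circleAverage_fun_smul, circleAverage_pow_mul_conj_pow]
    simp only [smul_eq_mul, mul_ite, mul_zero, Finset.sum_ite_eq, hn, if_true]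
    rw [Complex.mul_conj, Complex.normSq_eq_norm_sq]
    push_cast; ring
  exact_mod_cast key

theorem mem_closedBall_div_sq {r : ℝ} (hr : 1 ≤ r) {z : ℂ} (hz : z ∈ closedBall (0 : ℂ) r) :
    z / (r : ℂ) ^ 2 ∈ closedBall (0 : ℂ) r := by
  rw [mem_closedBall_zero_iff] at hz ⊢
  rw [norm_div, norm_pow, Complex.norm_real, Real.norm_of_nonneg (by linarith)]
  exact (div_le_self (norm_nonneg z) (one_le_pow₀ hr)).trans hz

theorem circleIntegrable_of_continuousOn_closedBall {E : Type*} [NormedAddCommGroup E]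
    {g : ℂ → E} {r : ℝ} (hr : 0 ≤ r) (hg : ContinuousOn g (closedBall 0 r)) :
    CircleIntegrable g 0 r :=
  (hg.mono sphere_subset_closedBall).circleIntegrable hr

/-- An analytic function is controlled, in mean square on a circle of radius `r ≥ 1`, by its sum
with its reflection in the unit circle. -/
theorem circleAverage_norm_sq_le_add_conj {φ : ℂ → ℂ} {r : ℝ} (hr : 1 ≤ r)
    (hφ : DifferentiableOn ℂ φ (closedBall 0 r)) :
    Real.circleAverage (fun z => ‖φ z‖ ^ 2) 0 r ≤
      Real.circleAverage (fun z => ‖φ z + conj (φ (z / (r : ℂ) ^ 2))‖ ^ 2) 0 r +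
        2 * (φ 0).im ^ 2 := by
  have hr0 : 0 ≤ r := by linarith
  have hmaps : MapsTo (fun z : ℂ => z / (r : ℂ) ^ 2) (closedBall 0 r) (closedBall 0 r) :=
    fun z hz => mem_closedBall_div_sq hr hz
  have hψ : DifferentiableOn ℂ (fun z => φ (z / (r : ℂ) ^ 2)) (closedBall 0 r) :=
    hφ.comp (by fun_prop) hmaps
  have hφc := hφ.continuousOn
  have hψc := hψ.continuousOn
  have hmul : DifferentiableOn ℂ (fun z => φ z * φ (z / (r : ℂ) ^ 2)) (closedBall 0 r) :=
    hφ.mul hψ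
  -- The cross term `φ(z) φ(z/r²)` is analytic, so its average is `φ(0)²`, whose real part is at
  -- least `-(Im φ(0))²`.
  have hmean : Real.circleAverage (fun z => φ z * φ (z / (r : ℂ) ^ 2)) 0 r = φ 0 * φ 0 := by
    have := (hmul.diffContOnCl_ball (c := 0) (R := |r|)
      (by rw [abs_of_nonneg hr0])).circleAverage
    simpa using this
  have hre := circleAverage_re (c := 0) (r := r)
    (circleIntegrable_of_continuousOn_closedBall hr0 hmul.continuousOn)
  rw [hmean] at hre
  have i1 : CircleIntegrable (fun z => ‖φ z‖ ^ 2) 0 r :=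
    circleIntegrable_of_continuousOn_closedBall hr0 (by fun_prop)
  have i2 : CircleIntegrable (fun z => (φ z * φ (z / (r : ℂ) ^ 2)).re) 0 r :=
    circleIntegrable_of_continuousOn_closedBall hr0
      (Complex.continuous_re.comp_continuousOn hmul.continuousOn)
  have i3 : CircleIntegrable (fun z => ‖φ z + conj (φ (z / (r : ℂ) ^ 2))‖ ^ 2) 0 r :=
    circleIntegrable_of_continuousOn_closedBall hr0
      ((hφc.add (Complex.continuous_conj.comp_continuousOn hψc)).norm.pow 2)
  have i2' : CircleIntegrable (fun z => (2 : ℝ) • (φ z * φ (z / (r : ℂ) ^ 2)).re) 0 r :=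
    i2.const_smul
  -- Expand the square `|a + conj b|² = |a|² + 2 Re (a b) + |b|²` and drop `|b|²`.
  have hle : Real.circleAverage
      (fun z => ‖φ z‖ ^ 2 + (2 : ℝ) • (φ z * φ (z / (r : ℂ) ^ 2)).re) 0 r ≤
      Real.circleAverage (fun z => ‖φ z + conj (φ (z / (r : ℂ) ^ 2))‖ ^ 2) 0 r := by
    refine Real.circleAverage_mono (i1.add i2') i3 fun z _ => ?_
    simp only [← Complex.normSq_eq_norm_sq, Complex.normSq_apply, Complex.mul_re, Complex.add_re,
      Complex.add_im, Complex.conj_re, Complex.conj_im, smul_eq_mul]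
    nlinarith [sq_nonneg (φ (z / (r : ℂ) ^ 2)).re, sq_nonneg (φ (z / (r : ℂ) ^ 2)).im]
  rw [Real.circleAverage_fun_add i1 i2', Real.circleAverage_fun_smul, hre] at hle
  simp only [Complex.mul_re, smul_eq_mul] at hle
  nlinarith [sq_nonneg (φ 0).re]

theorem eq_zero_of_eval_circle {p : ℂ[X]} (h : ∀ z : ℂ, ‖z‖ = 1 → p.eval z = 0) : p = 0 := by
  have h1 := circleAverage_norm_eval_sq (p := p) (Nat.lt_succ_self _) 1
  have h2 : Real.circleAverage (fun z : ℂ => ‖p.eval z‖ ^ 2) 0 1 = 0 := by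
    rw [Real.circleAverage_congr_sphere (f₂ := fun _ => (0 : ℝ)), Real.circleAverage_const]
    intro z hz
    simp [h z (by simpa using hz)]
  rw [h2] at h1
  have h3 := (Finset.sum_eq_zero_iff_of_nonneg (fun n _ => by positivity)).1 h1.symm
  ext n
  rcases lt_or_ge p.natDegree n with hn | hn
  · simp [coeff_eq_zero_of_natDegree_lt hn]
  · simpa using h3 n (by simp; omega)

/-! ### The velocity polynomial: uniqueness, reflection identity and existence. -/

/-- `q + q*` for the symmetrized product `q = s B*`, as a polynomial. -/
def symmProd (N : ℕ) (B s : ℂ[X]) : ℂ[X] := s * starReflect N B + starReflect N s * B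

theorem eval_symmProd {N : ℕ} {B s : ℂ[X]} (hB : B.natDegree ≤ N) (hs : s.natDegree ≤ N)
    {r : ℝ} (hr : 0 < r) {z : ℂ} (hz : ‖z‖ = r) :
    (symmProd N B s).eval z =
      z ^ N * (s.eval z * conj (B.eval (z / (r : ℂ) ^ 2)) +
        conj (s.eval (z / (r : ℂ) ^ 2)) * B.eval z) := by
  have hz0 : z ≠ 0 := by rintro rfl; simp at hz; linarith
  simp only [symmProd, eval_add, eval_mul, eval_starReflect hB hz0, eval_starReflect hs hz0,
    inv_conj_of_norm_eq hz]
  ring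

theorem starReflect_symmProd {N : ℕ} {B s : ℂ[X]} (hB : B.natDegree ≤ N) (hs : s.natDegree ≤ N) :
    starReflect (N + N) (symmProd N B s) = symmProd N B s := by
  rw [symmProd, starReflect_add, starReflect_mul hs (natDegree_starReflect_le hB),
    starReflect_mul (natDegree_starReflect_le hs) hB, starReflect_starReflect,
    starReflect_starReflect, add_comm]

theorem natDegree_symmProd_le {N : ℕ} {B s : ℂ[X]} (hB : B.natDegree ≤ N)
    (hs : s.natDegree ≤ N) : (symmProd N B s).natDegree ≤ N + N :=
  natDegree_add_le_of_degree_le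
    (natDegree_mul_le_of_le hs (natDegree_starReflect_le hB))
    (natDegree_mul_le_of_le (natDegree_starReflect_le hs) hB)

/-- The quotient `φ = s/B` is analytic, has zero real part on the unit circle and is real at 0. The
reflection inequality with r = 1 then has zero right-hand side, so s vanishes in mean square. -/
theorem eq_of_circle_of_im {B s : ℂ[X]} (hB : ∀ z : ℂ, ‖z‖ ≤ 1 → B.eval z ≠ 0)
    (h0 : (s.eval 0 / B.eval 0).im = 0)
    (h : ∀ z : ℂ, ‖z‖ = 1 → s.eval z * conj (B.eval z) + conj (s.eval z) * B.eval z = 0) :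
    s = 0 := by
  have hd : DifferentiableOn ℂ (fun z => s.eval z / B.eval z) (closedBall 0 1) :=
    DifferentiableOn.div (by fun_prop) (by fun_prop) fun z hz => hB z (by simpa using hz)
  have h1 := circleAverage_norm_sq_le_add_conj le_rfl hd
  have h2 : Real.circleAverage (fun z => ‖s.eval z / B.eval z +
      conj (s.eval (z / ((1 : ℝ) : ℂ) ^ 2) / B.eval (z / ((1 : ℝ) : ℂ) ^ 2))‖ ^ 2) 0 1 = 0 := by
    rw [Real.circleAverage_congr_sphere (f₂ := fun _ => (0 : ℝ)), Real.circleAverage_const]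
    intro z hz
    have hz : ‖z‖ = 1 := by simpa using hz
    have hBz := hB z hz.le
    have hBz' : conj (B.eval z) ≠ 0 := by simpa using hBz
    have : s.eval z / B.eval z + conj (s.eval z / B.eval z) = 0 := by
      rw [map_div₀, div_add_div _ _ hBz hBz', div_eq_zero_iff]
      left
      rw [← h z hz]; ring
    simp only [Complex.ofReal_one, one_pow, div_one]
    rw [this]; simp
  rw [h2, h0] at h1
  obtain ⟨M, hM⟩ := (isCompact_closedBall (0 : ℂ) 1).exists_bound_of_continuousOn
    (f := fun z => B.eval z) (by fun_prop)
  have h3 : Real.circleAverage (fun z : ℂ => ‖s.eval z‖ ^ 2) 0 1 ≤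
      Real.circleAverage (fun z : ℂ => M ^ 2 • ‖s.eval z / B.eval z‖ ^ 2) 0 1 := by
    refine Real.circleAverage_mono (circleIntegrable_of_continuous (by fun_prop) _ _)
      (circleIntegrable_of_continuousOn_closedBall zero_le_one
        (by have := hd.continuousOn; fun_prop)) fun z hz => ?_
    have hz : ‖z‖ = 1 := by simpa using hz
    have hBz := hB z hz.le
    have : s.eval z = (s.eval z / B.eval z) * B.eval z := by field_simp
    rw [smul_eq_mul, ← mul_pow]
    nth_rw 1 [this]
    rw [norm_mul, mul_comm]
    have := hM z (by simp [hz])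
    gcongr
  rw [Real.circleAverage_fun_smul, smul_eq_mul, circleAverage_norm_eval_sq (Nat.lt_succ_self _)] at h3
  have h4 : ∑ n ∈ Finset.range s.natDegree.succ, ‖s.coeff n‖ ^ 2 * (1 : ℝ) ^ (2 * n) ≤ 0 := by
    refine h3.trans (mul_nonpos_of_nonneg_of_nonpos (by positivity) ?_)
    simpa using h1
  have h5 := (Finset.sum_eq_zero_iff_of_nonneg (fun n _ => by positivity)).1
    (le_antisymm h4 (Finset.sum_nonneg fun n _ => by positivity))
  ext n
  rcases lt_or_ge s.natDegree n with hn | hn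
  · simp [coeff_eq_zero_of_natDegree_lt hn]
  · simpa using h5 n (by simp; omega)

/-- `s` is the polynomial with `s / B = P[1 / |B|²]` on the unit disk. -/
structure IsVelocity (B s : ℂ[X]) : Prop where
  im_eq : (s.eval 0 / B.eval 0).im = 0
  circle : ∀ z : ℂ, ‖z‖ = 1 → s.eval z * conj (B.eval z) + conj (s.eval z) * B.eval z = 2

/-- Multiplied by `z^N`, the identity on the unit circle is an equality of polynomials, hence holds
everywhere. On `|z| = r` it couples z with its reflected point. -/
theorem IsVelocity.reflect_identity {B s : ℂ[X]} (h : IsVelocity B s) {r : ℝ} (hr : 0 < r) {z : ℂ}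
    (hz : ‖z‖ = r) :
    s.eval z * conj (B.eval (z / (r : ℂ) ^ 2)) + conj (s.eval (z / (r : ℂ) ^ 2)) * B.eval z = 2 := by
  set N := max B.natDegree s.natDegree
  have hB : B.natDegree ≤ N := le_max_left _ _
  have hs : s.natDegree ≤ N := le_max_right _ _
  have h1 : symmProd N B s - C 2 * X ^ N = 0 := by
    refine eq_zero_of_eval_circle fun w hw => ?_
    have := h.circle w hw
    have e : w / ((1 : ℝ) : ℂ) ^ 2 = w := by simp
    rw [eval_sub, eval_symmProd hB hs one_pos hw, e, this]
    simp only [eval_mul, eval_C, eval_pow, eval_X]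
    ring
  have hz0 : z ≠ 0 := by rintro rfl; simp at hz; linarith
  have h2 := congrArg (eval z) h1
  rw [eval_sub, eval_symmProd hB hs hr hz] at h2
  simp only [eval_mul, eval_C, eval_pow, eval_X, eval_zero] at h2
  refine mul_left_cancel₀ (pow_ne_zero N hz0) ?_
  linear_combination h2

/-- The polynomial of degree less than `K` with given coefficients. -/
def ofCoeffs {K : ℕ} (x : Fin K → ℂ) : ℂ[X] := ∑ i : Fin K, monomial (i : ℕ) (x i)

theorem coeff_ofCoeffs {K : ℕ} (x : Fin K → ℂ) (n : ℕ) :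
    (ofCoeffs x).coeff n = if h : n < K then x ⟨n, h⟩ else 0 := by
  simp only [ofCoeffs, finsetSum_coeff, coeff_monomial]
  split_ifs with h
  · rw [Finset.sum_eq_single ⟨n, h⟩]
    · simp
    · intro b _ hb
      rw [if_neg]
      rintro rfl
      exact hb rfl
    · simp
  · refine Finset.sum_eq_zero fun i _ => if_neg ?_
    rintro rfl
    exact h i.2

@[simp]
theorem coeff_ofCoeffs_fin {K : ℕ} (x : Fin K → ℂ) (i : Fin K) : (ofCoeffs x).coeff i = x i := by
  simp [coeff_ofCoeffs]

theorem natDegree_ofCoeffs_lt {K : ℕ} (hK : 0 < K) (x : Fin K → ℂ) :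
    (ofCoeffs x).natDegree < K := by
  have h : (ofCoeffs x).natDegree ≤ K - 1 := by
    rw [natDegree_le_iff_coeff_eq_zero]
    intro n hn
    rw [coeff_ofCoeffs, dif_neg (by omega)]
  omega

theorem ofCoeffs_add {K : ℕ} (x y : Fin K → ℂ) : ofCoeffs (x + y) = ofCoeffs x + ofCoeffs y := by
  simp [ofCoeffs, Finset.sum_add_distrib]

theorem ofCoeffs_smul {K : ℕ} (a : ℝ) (x : Fin K → ℂ) :
    ofCoeffs (a • x) = C (a : ℂ) * ofCoeffs x := by
  ext n
  simp only [coeff_ofCoeffs, coeff_C_mul]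
  split_ifs <;> simp

/-- The real-linear system solved by the velocity. -/
def velocityMap (N : ℕ) (B : ℂ[X]) : (Fin (N + 1) → ℂ) →ₗ[ℝ] (Fin (N + 1) → ℂ) where
  -- A symmetrized product is its own reflection, so its coefficients N, ..., 2N determine it and
  -- the middle one is real. The vacant imaginary part of entry 0 can therefore store the
  -- normalization at the origin, which makes the system square over ℝ.
  toFun x i := (symmProd N B (ofCoeffs x)).coeff (N + i) +
    if (i : ℕ) = 0 then (((ofCoeffs x).eval 0 / B.eval 0).im : ℂ) * Complex.I else 0
  map_add' x y := by
    funext i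
    simp only [ofCoeffs_add, symmProd, starReflect_add, add_mul, coeff_add, eval_add, add_div,
      Complex.add_im, Pi.add_apply]
    split_ifs <;> push_cast <;> ring
  map_smul' a x := by
    funext i
    have h1 : starReflect N (C (a : ℂ) * ofCoeffs x) = C (a : ℂ) * starReflect N (ofCoeffs x) := by
      simp [starReflect, reflect_C_mul]
    simp only [ofCoeffs_smul, symmProd, h1, mul_assoc, ← mul_add, coeff_C_mul, eval_mul, eval_C,
      mul_div_assoc, Complex.im_ofReal_mul, RingHom.id_apply, Pi.smul_apply, Complex.real_smul]
    split_ifs <;> push_cast <;> ring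

theorem im_coeff_symmProd {N : ℕ} {B s : ℂ[X]} (hB : B.natDegree ≤ N) (hs : s.natDegree ≤ N) :
    ((symmProd N B s).coeff N).im = 0 := by
  have h := congrArg (fun p => coeff p N) (starReflect_symmProd hB hs)
  simp only [coeff_starReflect, revAt_le (Nat.le_add_left N N), Nat.add_sub_cancel] at h
  exact Complex.conj_eq_iff_im.1 h

/-- A symmetrized product is determined by its upper half. -/
theorem symmProd_eq {N : ℕ} {B s : ℂ[X]} (hB : B.natDegree ≤ N) (hs : s.natDegree ≤ N) {a : ℝ}
    (h0 : (symmProd N B s).coeff N = a)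
    (h1 : ∀ n, 0 < n → n ≤ N → (symmProd N B s).coeff (N + n) = 0) :
    symmProd N B s = C (a : ℂ) * X ^ N := by
  ext n
  rw [coeff_C_mul_X_pow]
  rcases lt_trichotomy n N with hn | hn | hn
  · rw [if_neg (by omega), ← starReflect_symmProd hB hs, coeff_starReflect,
      revAt_le (by omega), show N + N - n = N + (N - n) by omega, h1 _ (by omega) (by omega),
      map_zero]
  · rw [if_pos hn, hn, h0]
  · rw [if_neg (by omega)]
    rcases le_or_gt n (N + N) with h2 | h2
    · rw [show n = N + (n - N) by omega, h1 _ (by omega) (by omega)]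
    · exact coeff_eq_zero_of_natDegree_lt (lt_of_le_of_lt (natDegree_symmProd_le hB hs) h2)

theorem velocityMap_spec {N : ℕ} {B : ℂ[X]} (hB : B.natDegree ≤ N) {x : Fin (N + 1) → ℂ} {a : ℝ}
    (h : velocityMap N B x = fun i : Fin (N + 1) => if (i : ℕ) = 0 then (a : ℂ) else 0) :
    ((ofCoeffs x).eval 0 / B.eval 0).im = 0 ∧
      ∀ z : ℂ, ‖z‖ = 1 → (ofCoeffs x).eval z * conj (B.eval z) +
        conj ((ofCoeffs x).eval z) * B.eval z = a := by
  have hs : (ofCoeffs x).natDegree ≤ N := Nat.lt_succ_iff.1 (natDegree_ofCoeffs_lt N.succ_pos x)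
  have h0 := congrFun h ⟨0, N.succ_pos⟩
  simp only [velocityMap, LinearMap.coe_mk, AddHom.coe_mk, add_zero, if_true] at h0
  have him : ((ofCoeffs x).eval 0 / B.eval 0).im = 0 := by
    have := congrArg Complex.im h0
    simpa [im_coeff_symmProd hB hs] using this
  refine ⟨him, fun z hz => ?_⟩
  rw [him] at h0
  simp only [Complex.ofReal_zero, zero_mul, add_zero] at h0
  have h1 : ∀ n, 0 < n → n ≤ N → (symmProd N B (ofCoeffs x)).coeff (N + n) = 0 := by
    intro n hn hnN
    have := congrFun h ⟨n, Nat.lt_succ_iff.2 hnN⟩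
    simpa [velocityMap, hn.ne'] using this
  have h2 := congrArg (eval z) (symmProd_eq hB hs h0 h1)
  have e : z / ((1 : ℝ) : ℂ) ^ 2 = z := by simp
  rw [eval_symmProd hB hs one_pos hz, e] at h2
  simp only [eval_mul, eval_C, eval_pow, eval_X] at h2
  have hz0 : z ≠ 0 := by rintro rfl; simp at hz
  refine mul_left_cancel₀ (pow_ne_zero N hz0) ?_
  rw [h2]; ring

/-- The system `velocityMap` is an endomorphism of a finite-dimensional real space, so uniqueness of
the velocity gives existence. -/
theorem exists_isVelocity {N : ℕ} {B : ℂ[X]} (hB : B.natDegree ≤ N)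
    (hB0 : ∀ z : ℂ, ‖z‖ ≤ 1 → B.eval z ≠ 0) :
    ∃ s : ℂ[X], s.natDegree ≤ N ∧ IsVelocity B s := by
  have hinj : Function.Injective (velocityMap N B) := by
    refine (injective_iff_map_eq_zero _).2 fun x hx => ?_
    obtain ⟨h1, h2⟩ := velocityMap_spec (a := 0) hB (by rw [hx]; funext i; simp)
    have := eq_of_circle_of_im hB0 h1 (by simpa using h2)
    funext i
    rw [← coeff_ofCoeffs_fin x i, this]; simp
  obtain ⟨x, hx⟩ := LinearMap.surjective_of_injective hinj
    (fun i => if (i : ℕ) = 0 then ((2 : ℝ) : ℂ) else 0)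
  obtain ⟨h1, h2⟩ := velocityMap_spec hB hx
  exact ⟨ofCoeffs x, Nat.lt_succ_iff.1 (natDegree_ofCoeffs_lt N.succ_pos x), h1,
    fun z hz => (h2 z hz).trans (by norm_num)⟩

open Classical in
/-- The velocity polynomial of `B`. -/
def velocity (B : ℂ[X]) : ℂ[X] :=
  if h : ∃ s, s.natDegree ≤ B.natDegree ∧ IsVelocity B s then h.choose else 0

theorem velocity_spec {B : ℂ[X]} (hB0 : ∀ z : ℂ, ‖z‖ ≤ 1 → B.eval z ≠ 0) :
    (velocity B).natDegree ≤ B.natDegree ∧ IsVelocity B (velocity B) := by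
  have h := exists_isVelocity le_rfl hB0
  rw [velocity, dif_pos h]
  exact h.choose_spec

/-! ### The Schwarz formula and the identity `s/B = P[1/|B|²]`. -/

theorem poissonOp_eq_circleAverage (g : ℂ → ℝ) (ξ : ℂ) :
    poissonOp g ξ = Real.circleAverage (fun z => (g z : ℂ) * ((z + ξ) / (z - ξ))) 0 1 := by
  rw [Real.circleAverage_eq_circleIntegral one_ne_zero, poissonOp, smul_eq_mul]
  congr 1
  refine circleIntegral.integral_congr zero_le_one fun z hz => ?_
  simp [div_eq_inv_mul]

/-- The Schwarz formula. -/
theorem poissonOp_re {φ : ℂ → ℂ} (hφ : DifferentiableOn ℂ φ (closedBall 0 1))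
    (h0 : (φ 0).im = 0) {ξ : ℂ} (hξ : ‖ξ‖ < 1) : poissonOp (fun z => (φ z).re) ξ = φ ξ := by
  have hd : DiffContOnCl ℂ φ (ball 0 1) := hφ.diffContOnCl_ball le_rfl
  have hne : ∀ z ∈ sphere (0 : ℂ) 1, z - ξ ≠ 0 := by
    intro z hz h
    rw [sub_eq_zero] at h
    rw [h] at hz
    simp at hz; linarith
  have hK : ContinuousOn (fun z : ℂ => (z + ξ) / (z - ξ)) (sphere 0 1) :=
    ContinuousOn.div (by fun_prop) (by fun_prop) hne
  have hφc : ContinuousOn φ (sphere 0 1) := hφ.continuousOn.mono sphere_subset_closedBall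
  have hcc : ∀ {g : ℂ → ℂ}, ContinuousOn g (sphere 0 1) → ContinuousOn (fun z => conj (g z)) (sphere 0 1) :=
    fun hg => Complex.continuous_conj.comp_continuousOn hg
  have i1 : CircleIntegrable (fun z => φ z * ((z + ξ) / (z - ξ))) 0 1 :=
    (hφc.mul hK).circleIntegrable zero_le_one
  have i2 : CircleIntegrable (fun z => φ z * conj ((z + ξ) / (z - ξ))) 0 1 :=
    (hφc.mul (hcc hK)).circleIntegrable zero_le_one
  have i2' : CircleIntegrable (fun z => conj (φ z * conj ((z + ξ) / (z - ξ)))) 0 1 :=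
    (hcc (hφc.mul (hcc hK))).circleIntegrable zero_le_one
  have iφ : CircleIntegrable φ 0 1 := hφc.circleIntegrable zero_le_one
  have iq : CircleIntegrable (fun z => (z / (z - ξ)) * φ z) 0 1 :=
    ((ContinuousOn.div (by fun_prop) (by fun_prop) hne).mul hφc).circleIntegrable zero_le_one
  have hmean : Real.circleAverage φ 0 1 = φ 0 :=
    DiffContOnCl.circleAverage (by simpa using hd)
  -- The kernel is `2 z / (z - ξ) - 1`: Cauchy's formula for the first term, the mean value property
  -- for the second.
  have a1 : Real.circleAverage (fun z => φ z * ((z + ξ) / (z - ξ))) 0 1 = 2 * φ ξ - φ 0 := by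
    have h1 := DiffContOnCl.circleAverage_smul_div (R := 1) (c := 0) (w := ξ) (by simpa using hd)
      (by simpa using hξ)
    simp only [sub_zero, smul_eq_mul] at h1
    have : Real.circleAverage (fun z => φ z * ((z + ξ) / (z - ξ))) 0 1 =
        Real.circleAverage (fun z => (2 : ℂ) • ((z / (z - ξ)) * φ z) - φ z) 0 1 := by
      refine Real.circleAverage_congr_sphere fun z hz => ?_
      have := hne z (by simpa using hz)
      simp only [smul_eq_mul]
      field_simp
      ring
    have iq2 : CircleIntegrable (fun z => (2 : ℂ) • ((z / (z - ξ)) * φ z)) 0 1 := iq.const_smul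
    rw [this, Real.circleAverage_fun_sub iq2 iφ, Real.circleAverage_fun_smul, h1, hmean,
      smul_eq_mul]
  -- The conjugate kernel is twice the Poisson kernel minus the kernel itself, so the average is `2
  -- φ(ξ) - (2 φ(ξ) - φ(0))`.
  have a2 : Real.circleAverage (fun z => φ z * conj ((z + ξ) / (z - ξ))) 0 1 = φ 0 := by
    have h1 := hd.circleAverage_re_herglotzRieszKernel_smul' (w := ξ) (by simpa using hξ)
    simp only [sub_zero] at h1
    have : Real.circleAverage (fun z => φ z * conj ((z + ξ) / (z - ξ))) 0 1 =
        Real.circleAverage (fun z => (2 : ℝ) • (((z + ξ) / (z - ξ)).re • φ z) -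
          φ z * ((z + ξ) / (z - ξ))) 0 1 := by
      refine Real.circleAverage_congr_sphere fun z hz => ?_
      have := Complex.add_conj ((z + ξ) / (z - ξ))
      simp only [Complex.real_smul]
      push_cast at this ⊢
      linear_combination (φ z) * this
    have hre : ContinuousOn (fun z : ℂ => ((z + ξ) / (z - ξ)).re) (sphere 0 1) :=
      Complex.continuous_re.comp_continuousOn hK
    have ire : CircleIntegrable (fun z => (2 : ℝ) • (((z + ξ) / (z - ξ)).re • φ z)) 0 1 :=
      ContinuousOn.circleIntegrable zero_le_one (by fun_prop)
    rw [this, Real.circleAverage_fun_sub ire i1, Real.circleAverage_fun_smul, h1, a1,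
      Complex.real_smul]
    push_cast; ring
  rw [poissonOp_eq_circleAverage]
  have h3 : (fun z => ((φ z).re : ℂ) * ((z + ξ) / (z - ξ))) = fun z => (2⁻¹ : ℂ) •
      (φ z * ((z + ξ) / (z - ξ)) + conj (φ z * conj ((z + ξ) / (z - ξ)))) := by
    funext z
    have := Complex.add_conj (φ z)
    simp only [map_mul, Complex.conj_conj, smul_eq_mul]
    push_cast at this
    linear_combination (-(1 : ℂ) / 2 * ((z + ξ) / (z - ξ))) * this
  rw [h3, Real.circleAverage_fun_smul, Real.circleAverage_fun_add i1 i2', a1, circleAverage_conj i2,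
    a2, Complex.conj_eq_iff_im.2 h0, smul_eq_mul]
  ring

/-- Division of the circle identity by `|B|²` gives `Re (s/B) = 1/|B|²` on the unit circle. The
quotient is analytic and real at 0, so the Schwarz formula recovers it. -/
theorem IsVelocity.eval_div_eq_poissonOp {B s : ℂ[X]} (h : IsVelocity B s)
    (hB : ∀ z : ℂ, ‖z‖ ≤ 1 → B.eval z ≠ 0) {ξ : ℂ} (hξ : ‖ξ‖ < 1) :
    s.eval ξ / B.eval ξ = poissonOp (fun z => 1 / ‖B.eval z‖ ^ 2) ξ := by
  have hd : DifferentiableOn ℂ (fun z => s.eval z / B.eval z) (closedBall 0 1) :=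
    DifferentiableOn.div (by fun_prop) (by fun_prop) fun z hz => hB z (by simpa using hz)
  rw [← poissonOp_re hd h.im_eq hξ, poissonOp_eq_circleAverage, poissonOp_eq_circleAverage]
  refine Real.circleAverage_congr_sphere fun z hz => ?_
  have hz : ‖z‖ = 1 := by simpa using hz
  have hBz := hB z hz.le
  have hBz' : conj (B.eval z) ≠ 0 := by simpa using hBz
  have e : (s.eval z / B.eval z).re = 1 / ‖B.eval z‖ ^ 2 := by
    have h1 := Complex.add_conj (s.eval z / B.eval z)
    have h2 : s.eval z / B.eval z + conj (s.eval z / B.eval z) =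
        2 / (B.eval z * conj (B.eval z)) := by
      rw [map_div₀, ← h.circle z hz]
      field_simp
    rw [h2, Complex.mul_conj, Complex.normSq_eq_norm_sq] at h1
    have h3 : (2 : ℝ) / ‖B.eval z‖ ^ 2 = 2 * (s.eval z / B.eval z).re := by exact_mod_cast h1
    rw [show (1 : ℝ) / ‖B.eval z‖ ^ 2 = (2 / ‖B.eval z‖ ^ 2) / 2 by ring, h3]
    ring
  simp only [e]

theorem norm_kernel_le {z ξ : ℂ} (hz : ‖z‖ = 1) (hξ : ‖ξ‖ < 1) :
    ‖(z + ξ) / (z - ξ)‖ ≤ (1 + ‖ξ‖) / (1 - ‖ξ‖) := by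
  rw [norm_div]
  have h1 : ‖z + ξ‖ ≤ 1 + ‖ξ‖ := by rw [← hz]; exact norm_add_le _ _
  have h2 : 1 - ‖ξ‖ ≤ ‖z - ξ‖ := by rw [← hz]; exact norm_sub_norm_le _ _
  have h3 : 0 < 1 - ‖ξ‖ := by linarith
  gcongr

theorem norm_poissonOp_le {g : ℂ → ℝ} {A : ℝ} (hg : ∀ z : ℂ, ‖z‖ = 1 → |g z| ≤ A) {ξ : ℂ}
    (hξ : ‖ξ‖ < 1) : ‖poissonOp g ξ‖ ≤ A * ((1 + ‖ξ‖) / (1 - ‖ξ‖)) := by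
  have h := circleIntegral.norm_two_pi_i_inv_smul_integral_le_of_norm_le_const
    (f := fun z => (g z : ℂ) * ((z + ξ) / (z - ξ)) / z) (c := 0) (R := 1)
    (C := A * ((1 + ‖ξ‖) / (1 - ‖ξ‖))) zero_le_one ?_
  · simpa [poissonOp] using h
  · intro z hz
    have hz : ‖z‖ = 1 := by simpa using hz
    have hA : 0 ≤ A := (abs_nonneg _).trans (hg z hz)
    rw [norm_div, hz, div_one, norm_mul, Complex.norm_real, Real.norm_eq_abs]
    gcongr
    · exact hg z hz
    · exact norm_kernel_le hz hξ

theorem poissonOp_sub {g h : ℂ → ℝ} (hg : ContinuousOn g (sphere 0 1))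
    (hh : ContinuousOn h (sphere 0 1)) {ξ : ℂ} (hξ : ‖ξ‖ < 1) :
    poissonOp (fun z => g z - h z) ξ = poissonOp g ξ - poissonOp h ξ := by
  have hne : ∀ z ∈ sphere (0 : ℂ) 1, z - ξ ≠ 0 := by
    intro z hz h
    rw [sub_eq_zero] at h
    rw [h] at hz
    simp at hz; linarith
  have hK : ContinuousOn (fun z : ℂ => (z + ξ) / (z - ξ)) (sphere 0 1) :=
    ContinuousOn.div (by fun_prop) (by fun_prop) hne
  have hi : ∀ {g : ℂ → ℝ}, ContinuousOn g (sphere 0 1) →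
      CircleIntegrable (fun z => (g z : ℂ) * ((z + ξ) / (z - ξ))) 0 1 := fun hg =>
    ((Complex.continuous_ofReal.comp_continuousOn hg).mul hK).circleIntegrable zero_le_one
  simp only [poissonOp_eq_circleAverage]
  rw [← Real.circleAverage_fun_sub (hi hg) (hi hh)]
  congr 1
  funext z
  push_cast
  ring

/-! ### Bounds and Lipschitz estimate for the velocity, uniform in the degree. -/

/-- `μ ≤ |B| ≤ M` on the closed disk of radius `r`. -/
def Pinched (r μ M : ℝ) (B : ℂ[X]) : Prop :=
  ∀ z : ℂ, ‖z‖ ≤ r → μ ≤ ‖B.eval z‖ ∧ ‖B.eval z‖ ≤ M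

theorem Pinched.ne_zero {r μ M : ℝ} {B : ℂ[X]} (h : Pinched r μ M B) (hμ : 0 < μ) {z : ℂ}
    (hz : ‖z‖ ≤ r) : B.eval z ≠ 0 :=
  norm_pos_iff.1 (hμ.trans_le (h z hz).1)

/-- A bound for `P[1 / |B|²]` when `|B| ≥ μ`. -/
def phiBound (r μ : ℝ) : ℝ := 2 / μ ^ 2 + 1 / μ ^ 2 * ((r + 1) / (r - 1))

theorem phiBound_pos {r μ : ℝ} (hr : 1 < r) (hμ : 0 < μ) : 0 < phiBound r μ := by
  have : 0 < r - 1 := by linarith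
  unfold phiBound
  positivity

theorem norm_div_le_of_inner {r μ M : ℝ} (hr : 1 < r) (hμ : 0 < μ) {B s : ℂ[X]}
    (hB : Pinched r μ M B) (hs : IsVelocity B s) {ξ : ℂ} (hξ : ‖ξ‖ ≤ 1 / r) :
    ‖s.eval ξ / B.eval ξ‖ ≤ 1 / μ ^ 2 * ((r + 1) / (r - 1)) := by
  have hr0 : 0 < r := by linarith
  have hr1 : 1 / r < 1 := by rw [div_lt_one hr0]; exact hr
  rw [hs.eval_div_eq_poissonOp (fun z hz => hB.ne_zero hμ (hz.trans hr.le)) (hξ.trans_lt hr1)]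
  refine (norm_poissonOp_le (A := 1 / μ ^ 2) (fun z hz => ?_) (hξ.trans_lt hr1)).trans ?_
  · have := (hB z (by linarith)).1
    rw [abs_of_nonneg (by positivity)]
    gcongr
  · have h1 : (r + 1) / (r - 1) = (1 + 1 / r) / (1 - 1 / r) := by
      have : r - 1 ≠ 0 := by linarith
      field_simp
    have h2 : 0 < 1 - 1 / r := by linarith
    rw [h1]
    gcongr

theorem norm_div_sq_eq {r : ℝ} (hr : 0 < r) {z : ℂ} (hz : ‖z‖ = r) :
    ‖z / (r : ℂ) ^ 2‖ = 1 / r := by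
  rw [norm_div, norm_pow, Complex.norm_real, Real.norm_of_nonneg hr.le, hz]
  field_simp

/-- The Poisson integral bounds `s/B` only inside the unit disk. The reflection identity transports
the bound from `|w| = 1/r` to `|z| = r`, at the price of `2/μ²`. -/
theorem norm_div_le_of_outer {r μ M : ℝ} (hr : 1 < r) (hμ : 0 < μ) {B s : ℂ[X]}
    (hB : Pinched r μ M B) (hs : IsVelocity B s) {z : ℂ} (hz : ‖z‖ = r) :
    ‖s.eval z / B.eval z‖ ≤ phiBound r μ := by
  have hr0 : 0 < r := by linarith
  set w := z / (r : ℂ) ^ 2 with hw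
  have hwn : ‖w‖ = 1 / r := norm_div_sq_eq hr0 hz
  have hwr : ‖w‖ ≤ r := by
    rw [hwn, div_le_iff₀ hr0]; nlinarith
  have h1 := hs.reflect_identity hr0 hz
  have hBz := hB.ne_zero hμ hz.le
  have hBw := hB.ne_zero hμ hwr
  have hBw' : conj (B.eval w) ≠ 0 := by simpa using hBw
  have h2 : s.eval z / B.eval z = 2 / (B.eval z * conj (B.eval w)) -
      conj (s.eval w / B.eval w) := by
    rw [map_div₀, ← h1]
    field_simp
    ring
  rw [h2, phiBound]
  refine (norm_sub_le _ _).trans (add_le_add ?_ ?_)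
  · rw [norm_div, norm_mul, RCLike.norm_conj, Complex.norm_ofNat, sq]
    have := (hB z hz.le).1
    have := (hB w hwr).1
    gcongr
  · rw [RCLike.norm_conj]
    exact norm_div_le_of_inner hr hμ hB hs hwn.le

/-- The square of the mean square of `p` on the circle of radius `r`. -/
def l2sq (K : ℕ) (r : ℝ) (p : ℂ[X]) : ℝ := ∑ n ∈ Finset.range K, ‖p.coeff n‖ ^ 2 * r ^ (2 * n)

theorem l2sq_nonneg (K : ℕ) (r : ℝ) (p : ℂ[X]) : 0 ≤ l2sq K r p :=
  Finset.sum_nonneg fun n _ => by rw [pow_mul]; positivity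

/-- The Lipschitz constant of the velocity with respect to the mean square norm. -/
def lipConst (r μ M : ℝ) : ℝ :=
  M * phiBound r μ * (2 * M / μ ^ 2 + 2 / μ)

theorem circleAverage_norm_eval_sq_div {p : ℂ[X]} {K : ℕ} (hp : p.natDegree < K) {r : ℝ}
    (hr : 1 ≤ r) :
    Real.circleAverage (fun z : ℂ => ‖p.eval (z / (r : ℂ) ^ 2)‖ ^ 2) 0 r ≤ l2sq K r p := by
  set q := p.comp (C ((r : ℂ) ^ 2)⁻¹ * X) with hq
  have h1 : ∀ n, q.coeff n = p.coeff n * ((r : ℂ) ^ 2)⁻¹ ^ n := fun n => by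
    rw [hq, comp_C_mul_X_coeff]
  have hqd : q.natDegree < K := by
    refine lt_of_le_of_lt ?_ hp
    rw [natDegree_le_iff_coeff_eq_zero]
    intro n hn
    rw [h1, coeff_eq_zero_of_natDegree_lt hn, zero_mul]
  have h2 : (fun z : ℂ => ‖p.eval (z / (r : ℂ) ^ 2)‖ ^ 2) = fun z => ‖q.eval z‖ ^ 2 := by
    funext z
    rw [hq, eval_comp]
    simp [div_eq_inv_mul]
  rw [h2, circleAverage_norm_eval_sq hqd]
  refine Finset.sum_le_sum fun n _ => ?_
  rw [h1, norm_mul]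
  have h3 : ‖((r : ℂ) ^ 2)⁻¹ ^ n‖ ≤ 1 := by
    rw [norm_pow, norm_inv, norm_pow, Complex.norm_real, Real.norm_of_nonneg (by linarith)]
    exact pow_le_one₀ (by positivity) (inv_le_one_of_one_le₀ (one_le_pow₀ hr))
  have h4 : ‖p.coeff n‖ * ‖((r : ℂ) ^ 2)⁻¹ ^ n‖ ≤ ‖p.coeff n‖ :=
    mul_le_of_le_one_right (norm_nonneg _) h3
  gcongr

/-- The velocity depends on `B` in a Lipschitz way, in mean square on the circle of radius `r`. -/
theorem l2sq_velocity_sub_le {r μ M : ℝ} (hr : 1 < r) (hμ : 0 < μ) {K : ℕ} {B₁ B₂ s₁ s₂ : ℂ[X]}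
    (hB₁ : B₁.natDegree < K) (hB₂ : B₂.natDegree < K) (hs₁ : s₁.natDegree < K)
    (hs₂ : s₂.natDegree < K) (hp₁ : Pinched r μ M B₁) (hp₂ : Pinched r μ M B₂)
    (hv₁ : IsVelocity B₁ s₁) (hv₂ : IsVelocity B₂ s₂) :
    l2sq K r (s₁ - s₂) ≤ lipConst r μ M ^ 2 * l2sq K r (B₁ - B₂) := by
  have hr0 : 0 < r := by linarith
  have hr1 : 1 ≤ r := hr.le
  have hM : 0 < M := hμ.trans_le ((hp₁ 0 (by simpa using hr0.le)).1.trans (hp₁ 0 (by simpa using hr0.le)).2)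
  set Φ := phiBound r μ with hΦ
  have hΦ0 : 0 < Φ := phiBound_pos hr hμ
  set w := s₁ - s₂ with hw
  set a := B₁ - B₂ with ha
  have hwK : w.natDegree < K := lt_of_le_of_lt (natDegree_sub_le _ _) (max_lt hs₁ hs₂)
  have haK : a.natDegree < K := lt_of_le_of_lt (natDegree_sub_le _ _) (max_lt hB₁ hB₂)
  set A := l2sq K r a with hA
  have hA0 : 0 ≤ A := l2sq_nonneg _ _ _
  -- The reflection inequality is applied to `(s₁ - s₂)/B₁`. It remains to bound its imaginary part
  -- at 0 and its reflected sum by `B₁ - B₂`.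
  have hd : DifferentiableOn ℂ (fun z => w.eval z / B₁.eval z) (closedBall 0 r) :=
    DifferentiableOn.div (by fun_prop) (by fun_prop) fun z hz => hp₁.ne_zero hμ (by simpa using hz)
  have h1 := circleAverage_norm_sq_le_add_conj hr1 hd
  have hinner : ∀ ξ : ℂ, ‖ξ‖ ≤ 1 / r → ‖s₂.eval ξ / B₂.eval ξ‖ ≤ Φ := fun ξ hξ =>
    (norm_div_le_of_inner hr hμ hp₂ hv₂ hξ).trans (by rw [hΦ, phiBound]; linarith [show 0 < 2 / μ ^ 2 by positivity])
  have hs_le : ∀ ξ : ℂ, ‖ξ‖ ≤ r → ‖s₂.eval ξ / B₂.eval ξ‖ ≤ Φ → ‖s₂.eval ξ‖ ≤ M * Φ := by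
    intro ξ hξ h
    have hne := hp₂.ne_zero hμ hξ
    have : s₂.eval ξ = B₂.eval ξ * (s₂.eval ξ / B₂.eval ξ) := by field_simp
    rw [this, norm_mul]
    have := (hp₂ ξ hξ).2
    gcongr
  -- the value at the centre
  have hc : (w.eval 0 / B₁.eval 0).im ^ 2 ≤ (Φ / μ) ^ 2 * A := by
    -- Both `s₁/B₁` and `s₂/B₂` are real at 0, so only the discrepancy between `s₂/B₂` and `s₂/B₁`
    -- survives.
    have e : (w.eval 0 / B₁.eval 0).im =
        ((s₂.eval 0 / B₂.eval 0) * (a.eval 0 / B₁.eval 0)).im := by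
      have n1 := hp₁.ne_zero hμ (z := 0) (by simpa using hr0.le)
      have n2 := hp₂.ne_zero hμ (z := 0) (by simpa using hr0.le)
      have : (s₂.eval 0 / B₂.eval 0) * (a.eval 0 / B₁.eval 0) =
          s₂.eval 0 / B₂.eval 0 - s₂.eval 0 / B₁.eval 0 := by
        rw [ha, eval_sub]; field_simp
      rw [this, Complex.sub_im, hv₂.im_eq, hw, eval_sub, sub_div, Complex.sub_im, hv₁.im_eq]
    have h2 : |(w.eval 0 / B₁.eval 0).im| ≤ Φ / μ * ‖a.eval 0‖ := by
      rw [e]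
      refine (Complex.abs_im_le_norm _).trans ?_
      rw [norm_mul, norm_div (a.eval 0)]
      have b1 := hinner 0 (by simp; positivity)
      have b2 := (hp₁ 0 (by simpa using hr0.le)).1
      calc _ ≤ Φ * (‖a.eval 0‖ / μ) := by gcongr
        _ = _ := by ring
    have h3 : ‖a.eval 0‖ ^ 2 ≤ A := by
      have : 0 ∈ Finset.range K := by simp; omega
      refine le_trans (le_of_eq ?_) (Finset.single_le_sum
        (f := fun n => ‖a.coeff n‖ ^ 2 * r ^ (2 * n)) (fun n _ => by positivity) this)
      simp [coeff_zero_eq_eval_zero]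
    rw [← sq_abs]
    calc |(w.eval 0 / B₁.eval 0).im| ^ 2 ≤ (Φ / μ * ‖a.eval 0‖) ^ 2 := by gcongr
      _ = (Φ / μ) ^ 2 * ‖a.eval 0‖ ^ 2 := by ring
      _ ≤ _ := by gcongr
  -- the reflected sum
  have hsum : Real.circleAverage (fun z => ‖w.eval z / B₁.eval z +
      conj (w.eval (z / (r : ℂ) ^ 2) / B₁.eval (z / (r : ℂ) ^ 2))‖ ^ 2) 0 r ≤
      4 * (M * Φ / μ ^ 2) ^ 2 * A := by
    have hmaps : MapsTo (fun z : ℂ => z / (r : ℂ) ^ 2) (closedBall 0 r) (closedBall 0 r) :=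
      fun z hz => mem_closedBall_div_sq hr1 hz
    have hdc : ContinuousOn (fun z => w.eval z / B₁.eval z) (closedBall 0 r) := hd.continuousOn
    have hdc' : ContinuousOn (fun z => conj (w.eval (z / (r : ℂ) ^ 2) / B₁.eval (z / (r : ℂ) ^ 2)))
        (closedBall 0 r) :=
      Complex.continuous_conj.comp_continuousOn (hdc.comp (by fun_prop) hmaps)
    have i1 : CircleIntegrable (fun z => ‖a.eval z‖ ^ 2) 0 r :=
      circleIntegrable_of_continuous (by fun_prop) _ _
    have i2 : CircleIntegrable (fun z => ‖a.eval (z / (r : ℂ) ^ 2)‖ ^ 2) 0 r :=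
      circleIntegrable_of_continuous (by fun_prop) _ _
    have i3 : CircleIntegrable (fun z => ‖a.eval z‖ ^ 2 + ‖a.eval (z / (r : ℂ) ^ 2)‖ ^ 2) 0 r :=
      i1.add i2
    have h2 : Real.circleAverage (fun z => ‖w.eval z / B₁.eval z +
        conj (w.eval (z / (r : ℂ) ^ 2) / B₁.eval (z / (r : ℂ) ^ 2))‖ ^ 2) 0 r ≤
        Real.circleAverage (fun z => (2 * (M * Φ / μ ^ 2) ^ 2) •
          (‖a.eval z‖ ^ 2 + ‖a.eval (z / (r : ℂ) ^ 2)‖ ^ 2)) 0 r := by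
      refine Real.circleAverage_mono (circleIntegrable_of_continuousOn_closedBall hr0.le
        ((hdc.add hdc').norm.pow 2)) (circleIntegrable_of_continuous (by fun_prop) _ _)
        fun z hz => ?_
      have hz : ‖z‖ = r := by simpa [abs_of_pos hr0] using hz
      set y := z / (r : ℂ) ^ 2 with hy
      have hyn : ‖y‖ = 1 / r := norm_div_sq_eq hr0 hz
      have hyr : ‖y‖ ≤ r := by rw [hyn, div_le_iff₀ hr0]; nlinarith
      have n1 := hp₁.ne_zero hμ hz.le
      have n2 := hp₁.ne_zero hμ hyr
      have n2' : conj (B₁.eval y) ≠ 0 := by simpa using n2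
      -- Subtracting the two reflection identities cancels the constant 2. What remains is linear in
      -- `a = B₁ - B₂` with coefficients formed from `s₂`, already bounded by `M Φ`.
      have e : w.eval z / B₁.eval z + conj (w.eval y / B₁.eval y) =
          -(s₂.eval z * conj (a.eval y) + conj (s₂.eval y) * a.eval z) /
            (B₁.eval z * conj (B₁.eval y)) := by
        rw [map_div₀, div_add_div _ _ n1 n2']
        congr 1
        have e1 := hv₁.reflect_identity hr0 hz
        have e2 := hv₂.reflect_identity hr0 hz
        rw [← hy] at e1 e2
        simp only [hw, ha, eval_sub, map_sub]
        linear_combination e1 - e2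
      have hle : ‖w.eval z / B₁.eval z + conj (w.eval y / B₁.eval y)‖ ≤
          M * Φ / μ ^ 2 * (‖a.eval y‖ + ‖a.eval z‖) := by
        rw [e, norm_div, norm_neg, norm_mul, RCLike.norm_conj]
        have b1 := (hp₁ z hz.le).1
        have b2 := (hp₁ y hyr).1
        have b3 := hs_le z hz.le (norm_div_le_of_outer hr hμ hp₂ hv₂ hz)
        have b4 := hs_le y hyr (hinner y hyn.le)
        calc _ ≤ (M * Φ * ‖a.eval y‖ + M * Φ * ‖a.eval z‖) / (μ * μ) := by
              gcongr
              refine (norm_add_le _ _).trans ?_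
              rw [norm_mul, norm_mul, RCLike.norm_conj, RCLike.norm_conj]
              gcongr
          _ = _ := by rw [sq]; ring
      calc ‖w.eval z / B₁.eval z + conj (w.eval y / B₁.eval y)‖ ^ 2
          ≤ (M * Φ / μ ^ 2 * (‖a.eval y‖ + ‖a.eval z‖)) ^ 2 := by gcongr
        _ = (M * Φ / μ ^ 2) ^ 2 * (‖a.eval y‖ + ‖a.eval z‖) ^ 2 := by ring
        _ ≤ (M * Φ / μ ^ 2) ^ 2 * (2 * (‖a.eval z‖ ^ 2 + ‖a.eval y‖ ^ 2)) := by
            gcongr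
            nlinarith [sq_nonneg (‖a.eval z‖ - ‖a.eval y‖)]
        _ = _ := by rw [smul_eq_mul]; ring
    refine h2.trans ?_
    rw [Real.circleAverage_fun_smul, Real.circleAverage_fun_add i1 i2, smul_eq_mul,
      circleAverage_norm_eval_sq haK]
    have h3 := circleAverage_norm_eval_sq_div haK hr1
    have h4 : ∑ n ∈ Finset.range K, ‖a.coeff n‖ ^ 2 * r ^ (2 * n) = A := rfl
    rw [h4]
    calc _ ≤ 2 * (M * Φ / μ ^ 2) ^ 2 * (A + A) := by gcongr
      _ = _ := by ring
  have hfin : l2sq K r w ≤ M ^ 2 * Real.circleAverage (fun z => ‖w.eval z / B₁.eval z‖ ^ 2) 0 r := by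
    rw [l2sq, ← circleAverage_norm_eval_sq hwK, ← smul_eq_mul, ← Real.circleAverage_fun_smul]
    refine Real.circleAverage_mono (circleIntegrable_of_continuous (by fun_prop) _ _)
      (circleIntegrable_of_continuousOn_closedBall hr0.le
        (by have := hd.continuousOn; fun_prop)) fun z hz => ?_
    have hz : ‖z‖ = r := by simpa [abs_of_pos hr0] using hz
    have n1 := hp₁.ne_zero hμ hz.le
    have : w.eval z = B₁.eval z * (w.eval z / B₁.eval z) := by field_simp
    rw [smul_eq_mul, ← mul_pow]
    nth_rw 1 [this]
    rw [norm_mul]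
    have := (hp₁ z hz.le).2
    gcongr
  calc l2sq K r w ≤ M ^ 2 * (4 * (M * Φ / μ ^ 2) ^ 2 * A + 2 * ((Φ / μ) ^ 2 * A)) := by
        refine hfin.trans ?_
        gcongr
        linarith
    _ = (M ^ 2 * (4 * (M * Φ / μ ^ 2) ^ 2 + 2 * (Φ / μ) ^ 2)) * A := by ring
    _ ≤ lipConst r μ M ^ 2 * A := by
        refine mul_le_mul_of_nonneg_right ?_ hA0
        -- For x, y ≥ 0, `4 x² + 2 y² ≤ (2 x + 2 y)²`; this dictates the shape of `lipConst`.
        have e : lipConst r μ M ^ 2 = M ^ 2 * (2 * (M * Φ / μ ^ 2) + 2 * (Φ / μ)) ^ 2 := by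
          rw [lipConst, ← hΦ]; ring
        rw [e]
        gcongr
        have : 0 < M * Φ / μ ^ 2 := by positivity
        have : 0 < Φ / μ := by positivity
        nlinarith [mul_pos ‹0 < M * Φ / μ ^ 2› ‹0 < Φ / μ›]

/-- The coefficients of the velocity are bounded. -/
theorem norm_coeff_velocity_le {r μ M : ℝ} (hr : 1 < r) (hμ : 0 < μ) {B s : ℂ[X]}
    (hp : Pinched r μ M B) (hv : IsVelocity B s) (n : ℕ) :
    ‖s.coeff n‖ ≤ M * phiBound r μ := by
  have hr0 : 0 < r := by linarith
  have hΦ0 : 0 < phiBound r μ := phiBound_pos hr hμ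
  have hM : 0 < M :=
    hμ.trans_le ((hp 0 (by simpa using hr0.le)).1.trans (hp 0 (by simpa using hr0.le)).2)
  rcases lt_or_ge s.natDegree n with hn | hn
  · rw [coeff_eq_zero_of_natDegree_lt hn, norm_zero]; positivity
  have h1 : Real.circleAverage (fun z : ℂ => ‖s.eval z‖ ^ 2) 0 r ≤ (M * phiBound r μ) ^ 2 := by
    refine Real.circleAverage_mono_on_of_le_circle
      (circleIntegrable_of_continuous (by fun_prop) _ _) fun z hz => ?_
    have hz : ‖z‖ = r := by simpa [abs_of_pos hr0] using hz
    have n1 := hp.ne_zero hμ hz.le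
    have e : s.eval z = B.eval z * (s.eval z / B.eval z) := by field_simp
    rw [e, norm_mul]
    have := (hp z hz.le).2
    have := norm_div_le_of_outer hr hμ hp hv hz
    gcongr
  rw [circleAverage_norm_eval_sq (Nat.lt_succ_self _)] at h1
  have h2 := (Finset.single_le_sum (f := fun n => ‖s.coeff n‖ ^ 2 * r ^ (2 * n))
    (fun n _ => by positivity) (Finset.mem_range.2 (Nat.lt_succ_of_le hn))).trans h1
  have h3 : ‖s.coeff n‖ ^ 2 ≤ (M * phiBound r μ) ^ 2 :=
    le_trans (le_mul_of_one_le_right (by positivity) (one_le_pow₀ hr.le)) h2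
  exact le_of_sq_le_sq h3 (by positivity)

/-! ### Tools for ordinary differential equations: extension, continuous induction, Gronwall. -/

/-- A real Lipschitz function extends with the same constant, and truncation at `±|Q|` keeps the
constant. A globally bounded field admits solutions on the whole time interval. -/
theorem exists_bounded_lipschitz_extension {α : Type*} [PseudoMetricSpace α] {S : Set α}
    {h : α → ℝ} {L : ℝ≥0} {Q : ℝ} (hh : LipschitzOnWith L h S) (hQ : ∀ x ∈ S, |h x| ≤ Q) :
    ∃ g : α → ℝ, LipschitzWith L g ∧ (∀ x, |g x| ≤ |Q|) ∧ EqOn g h S := by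
  obtain ⟨e, he, hes⟩ := hh.extend_real
  refine ⟨fun x => max (-|Q|) (min |Q| (e x)), (he.const_min _).const_max _, fun x => ?_,
    fun x hx => ?_⟩
  · rw [abs_le]
    exact ⟨le_max_left _ _, max_le (by linarith [abs_nonneg Q]) (min_le_left _ _)⟩
  · have h1 := abs_le.1 ((hQ x hx).trans (le_abs_self Q))
    simp only
    rw [← hes hx, min_eq_right h1.2, max_eq_right h1.1]

/-- A bounded Lipschitz vector field on a set has a solution on any interval, as long as it stays
in the set. -/
theorem exists_solution_of_lipschitzOnWith {ι : Type*} [Fintype ι] {S : Set (ι → ℂ)}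
    {V : (ι → ℂ) → (ι → ℂ)} {L : ℝ≥0} {Q : ℝ} (hV : LipschitzOnWith L V S)
    (hQ : ∀ x ∈ S, ∀ i, ‖V x i‖ ≤ Q) (x₀ : ι → ℂ) {T : ℝ} (hT : 0 ≤ T) :
    ∃ x : ℝ → ι → ℂ, x 0 = x₀ ∧ ContinuousOn x (Icc 0 T) ∧
      ∀ t ∈ Icc 0 T, x t ∈ S → HasDerivWithinAt x (V (x t)) (Icc 0 T) t := by
  have hre : ∀ i, ∃ g : (ι → ℂ) → ℝ, LipschitzWith L g ∧ (∀ x, |g x| ≤ |Q|) ∧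
      EqOn g (fun x => (V x i).re) S := fun i =>
    exists_bounded_lipschitz_extension (LipschitzOnWith.of_dist_le_mul fun x hx y hy => by
      rw [Real.dist_eq, ← Complex.sub_re]
      refine (Complex.abs_re_le_norm _).trans ?_
      rw [← dist_eq_norm]
      exact (dist_le_pi_dist _ _ i).trans (hV.dist_le_mul x hx y hy))
      fun x hx => (Complex.abs_re_le_norm _).trans (hQ x hx i)
  have him : ∀ i, ∃ g : (ι → ℂ) → ℝ, LipschitzWith L g ∧ (∀ x, |g x| ≤ |Q|) ∧
      EqOn g (fun x => (V x i).im) S := fun i =>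
    exists_bounded_lipschitz_extension (LipschitzOnWith.of_dist_le_mul fun x hx y hy => by
      rw [Real.dist_eq, ← Complex.sub_im]
      refine (Complex.abs_im_le_norm _).trans ?_
      rw [← dist_eq_norm]
      exact (dist_le_pi_dist _ _ i).trans (hV.dist_le_mul x hx y hy))
      fun x hx => (Complex.abs_im_le_norm _).trans (hQ x hx i)
  choose g hgL hgQ hgS using hre
  choose h hhL hhQ hhS using him
  set W : (ι → ℂ) → (ι → ℂ) := fun x i => ⟨g i x, h i x⟩ with hW
  have hWS : ∀ x ∈ S, W x = V x := fun x hx => by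
    funext i
    exact Complex.ext (hgS i hx) (hhS i hx)
  have hWL : LipschitzWith (2 * L) W := LipschitzWith.of_dist_le_mul fun x y => by
    refine (dist_pi_le_iff (by positivity)).2 fun i => ?_
    rw [dist_eq_norm]
    refine (Complex.norm_le_abs_re_add_abs_im _).trans ?_
    have h1 := (hgL i).dist_le_mul x y
    have h2 := (hhL i).dist_le_mul x y
    rw [Real.dist_eq] at h1 h2
    simp only [Complex.sub_re, Complex.sub_im, hW]
    push_cast
    linarith
  have hWQ : ∀ x, ‖W x‖ ≤ ((2 * Real.nnabs Q : ℝ≥0) : ℝ) := fun x => by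
    refine (pi_norm_le_iff_of_nonneg (by positivity)).2 fun i => ?_
    refine (Complex.norm_le_abs_re_add_abs_im _).trans ?_
    have h1 := hgQ i x
    have h2 := hhQ i x
    simp only [hW]
    push_cast
    linarith
  -- Since the extended field is bounded everywhere, a ball of radius (bound) · T contains the
  -- trajectory, and the solution lives on all of `[0, T]`.
  have hpl : IsPicardLindelof (fun _ => W) (⟨0, left_mem_Icc.2 hT⟩ : Icc 0 T) x₀
      (2 * Real.nnabs Q * T.toNNReal) 0 (2 * Real.nnabs Q) (2 * L) := by
    refine ⟨fun t _ => hWL.lipschitzOnWith, fun x _ => continuousOn_const,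
      fun t _ x _ => hWQ x, ?_⟩
    simp [hT]
  obtain ⟨x, hx0, hx⟩ := hpl.exists_eq_forall_mem_Icc_hasDerivWithinAt₀
  refine ⟨x, hx0, fun t ht => (hx t ht).continuousWithinAt, fun t ht hS => ?_⟩
  rw [← hWS _ hS]
  exact hx t ht

/-- Continuous induction: a bound that improves itself persists. -/
theorem le_of_bootstrap {ψ : ℝ → ℝ} {T A A' : ℝ} (hψ : ContinuousOn ψ (Icc 0 T)) (hA : A < A')
    (h0 : ψ 0 ≤ A)
    (hstep : ∀ τ ∈ Icc 0 T, (∀ t ∈ Icc 0 τ, ψ t ≤ A') → ψ τ ≤ A) :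
    ∀ t ∈ Icc 0 T, ψ t ≤ A := by
  intro t ht
  have hT : 0 ≤ T := ht.1.trans ht.2
  by_contra hcon
  push Not at hcon
  have hex : ∃ t ∈ Icc 0 T, A' ≤ ψ t := by
    by_contra hno
    push Not at hno
    exact absurd (hstep t ht fun s hs => (hno s ⟨hs.1, hs.2.trans ht.2⟩).le) (not_le.2 hcon)
  set Z := {t ∈ Icc 0 T | A' ≤ ψ t} with hZ
  have hZc : IsClosed Z := by
    have : Z = Icc 0 T ∩ ψ ⁻¹' Ici A' := by ext; simp [hZ]
    rw [this]
    exact hψ.preimage_isClosed_of_isClosed isClosed_Icc isClosed_Ici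
  have hZb : BddBelow Z := ⟨0, fun s hs => hs.1.1⟩
  -- At the first time with `A' ≤ ψ`, the weak bound held strictly before, so the strong bound A
  -- held there too. By continuity it persists at that time, against `A < A'`.
  have hτ : sInf Z ∈ Z := hZc.csInf_mem hex hZb
  set τ := sInf Z
  have hlt : ∀ s ∈ Ico 0 τ, ψ s ≤ A := by
    intro s hs
    have hsT : s ≤ T := hs.2.le.trans hτ.1.2
    refine hstep s ⟨hs.1, hsT⟩ fun u hu => ?_
    by_contra hu'
    push Not at hu'
    have : u ∈ Z := ⟨⟨hu.1, hu.2.trans hsT⟩, hu'.le⟩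
    exact absurd (csInf_le hZb this) (not_le.2 (hu.2.trans_lt hs.2))
  have hτ0 : 0 < τ := by
    rcases hτ.1.1.eq_or_lt with h | h
    · have := hτ.2
      rw [← h] at this
      linarith
    · exact h
  have hle : ψ τ ≤ A := by
    have hcl : τ ∈ closure (Ico 0 τ) := by
      rw [closure_Ico hτ0.ne]; exact right_mem_Icc.2 hτ0.le
    have hcw : ContinuousWithinAt ψ (Ico 0 τ) τ :=
      (hψ τ hτ.1).mono fun s hs => ⟨hs.1, hs.2.le.trans hτ.1.2⟩
    exact ContinuousWithinAt.closure_le hcl hcw continuousWithinAt_const hlt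
  linarith [hτ.2]

/-- The solution stays below the weighted exponential, componentwise form of Gronwall. -/
theorem sum_norm_sq_le_of_deriv {K : ℕ} {y y' : ℝ → ℕ → ℂ} {T c : ℝ}
    (hy : ∀ t ∈ Icc 0 T, ∀ n < K, HasDerivWithinAt (fun t => y t n) (y' t n) (Icc 0 T) t)
    (hc : 0 ≤ c)
    (hle : ∀ t ∈ Icc 0 T, ∑ n ∈ Finset.range K, ‖y' t n‖ ^ 2 ≤
      c ^ 2 * ∑ n ∈ Finset.range K, ‖y t n‖ ^ 2) :
    ∀ t ∈ Icc 0 T, √(∑ n ∈ Finset.range K, ‖y t n‖ ^ 2) ≤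
      Real.exp (c * t) * √(∑ n ∈ Finset.range K, ‖y 0 n‖ ^ 2) := by
  -- The Euclidean norm, rather than the supremum norm of the product, is needed for Gronwall in
  -- mean square.
  set Y : ℝ → EuclideanSpace ℂ (Fin K) := fun t => WithLp.toLp 2 fun i => y t i with hY
  set Y' : ℝ → EuclideanSpace ℂ (Fin K) := fun t => WithLp.toLp 2 fun i => y' t i with hY'
  have hn : ∀ z : ℕ → ℂ, ‖(WithLp.toLp 2 fun i : Fin K => z i : EuclideanSpace ℂ (Fin K))‖ =
      √(∑ n ∈ Finset.range K, ‖z n‖ ^ 2) := fun z => by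
    rw [EuclideanSpace.norm_eq, Finset.sum_range]
  have hd : ∀ t ∈ Icc 0 T, HasDerivWithinAt Y (Y' t) (Icc 0 T) t := by
    intro t ht
    have h1 : HasDerivWithinAt (fun t => fun i : Fin K => y t i) (fun i : Fin K => y' t i)
        (Icc 0 T) t := hasDerivWithinAt_pi.2 fun i => hy t ht i i.2
    exact ((PiLp.continuousLinearEquiv 2 ℝ (fun _ : Fin K => ℂ)).symm :
      (Fin K → ℂ) →L[ℝ] EuclideanSpace ℂ (Fin K)).hasFDerivAt.comp_hasDerivWithinAt t h1
  intro t ht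
  have h := norm_le_gronwallBound_of_norm_deriv_right_le (f := Y) (f' := Y') (δ := ‖Y 0‖)
    (K := c) (ε := 0) (a := 0) (b := T) (fun t ht => (hd t ht).continuousWithinAt)
    (fun t ht => (hd t ⟨ht.1, ht.2.le⟩).mono_of_mem_nhdsWithin
      (Icc_mem_nhdsGE_of_mem ht)) le_rfl (fun t ht => ?_) t ht
  · rw [gronwallBound_ε0, hn, hn, sub_zero, mul_comm] at h
    exact h
  · rw [add_zero, hn, hn, ← Real.sqrt_sq hc, ← Real.sqrt_mul (sq_nonneg c)]
    exact Real.sqrt_le_sqrt (by simpa [Real.sqrt_sq hc] using hle t ⟨ht.1, ht.2.le⟩)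

/-! ### Polynomial solutions and the growth of their differences. -/

section

/-- The sum of the `|aₙ| r ^ n` over the coefficients of a polynomial. -/
def wnorm (r : ℝ) (p : ℂ[X]) : ℝ := p.sum fun n a => ‖a‖ * r ^ n

theorem wnorm_eq_sum {p : ℂ[X]} {K : ℕ} (hp : p.natDegree < K) (r : ℝ) :
    wnorm r p = ∑ n ∈ Finset.range K, ‖p.coeff n‖ * r ^ n :=
  p.sum_over_range' (fun n => by simp) K hp

theorem wnorm_nonneg {r : ℝ} (hr : 0 ≤ r) (p : ℂ[X]) : 0 ≤ wnorm r p :=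
  Finset.sum_nonneg fun n _ => by positivity

theorem wnorm_add_le {r : ℝ} (hr : 0 ≤ r) (p q : ℂ[X]) :
    wnorm r (p + q) ≤ wnorm r p + wnorm r q := by
  set K := max p.natDegree q.natDegree + 1
  have hp : p.natDegree < K := by omega
  have hq : q.natDegree < K := by omega
  rw [wnorm_eq_sum (lt_of_le_of_lt (natDegree_add_le p q) (Nat.lt_succ_self _)),
    wnorm_eq_sum hp, wnorm_eq_sum hq, ← Finset.sum_add_distrib]
  refine Finset.sum_le_sum fun n _ => ?_
  rw [coeff_add, ← add_mul]
  gcongr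
  exact norm_add_le _ _

theorem wnorm_sub_le {r : ℝ} (hr : 0 ≤ r) (p q s : ℂ[X]) :
    wnorm r (p - s) ≤ wnorm r (p - q) + wnorm r (q - s) := by
  rw [← sub_add_sub_cancel p q s]
  exact wnorm_add_le hr _ _

theorem norm_eval_le_wnorm {r : ℝ} (p : ℂ[X]) {z : ℂ} (hz : ‖z‖ ≤ r) :
    ‖p.eval z‖ ≤ wnorm r p := by
  rw [wnorm_eq_sum (Nat.lt_succ_self _), eval_eq_sum_range]
  refine norm_sum_le_of_le _ fun n _ => ?_
  rw [norm_mul, norm_pow]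
  gcongr

theorem sum_le_sqrt_mul_sqrt (K : ℕ) (a : ℕ → ℝ) :
    ∑ n ∈ Finset.range K, a n ≤ √K * √(∑ n ∈ Finset.range K, a n ^ 2) := by
  rw [← Real.sqrt_mul (by positivity)]
  refine Real.le_sqrt_of_sq_le ?_
  have := sq_sum_le_card_mul_sum_sq (s := Finset.range K) (f := a)
  simpa using this

/-- Cauchy–Schwarz over K coefficients. This loss of `√K` is the source of the exponent 1/2 in the
norm `‖·‖_{ρ,n}`. -/
theorem wnorm_le_l2sq {p : ℂ[X]} {K : ℕ} (hp : p.natDegree < K) (r : ℝ) :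
    wnorm r p ≤ √K * √(l2sq K r p) := by
  rw [wnorm_eq_sum hp]
  refine (sum_le_sqrt_mul_sqrt K _).trans (le_of_eq ?_)
  simp only [l2sq, mul_pow, ← pow_mul, mul_comm]

theorem natDegree_derivative_lt {p : ℂ[X]} {K : ℕ} (hK : 0 < K) (hp : p.natDegree ≤ K) :
    (derivative p).natDegree < K :=
  lt_of_le_of_lt (natDegree_derivative_le p) (by omega)

/-- A curve of polynomials of degree at most `K` driven by its velocity. -/
structure PolySol (K : ℕ) (T : ℝ) (g : ℝ → ℂ[X]) : Prop where
  natDegree_le : ∀ t ∈ Icc 0 T, (g t).natDegree ≤ K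
  coeff_zero : ∀ t ∈ Icc 0 T, (g t).coeff 0 = 0
  -- The equation is `g_t = ξ s`, hence the shift of the index by one.
  hasDeriv : ∀ t ∈ Icc 0 T, ∀ n, HasDerivWithinAt (fun t => (g t).coeff (n + 1))
    ((velocity (derivative (g t))).coeff n) (Icc 0 T) t

theorem PolySol.mono {K K' : ℕ} {T T' : ℝ} {g : ℝ → ℂ[X]} (h : PolySol K T g) (hT : T' ≤ T)
    (hK : K ≤ K') : PolySol K' T' g := by
  have hsub : Icc 0 T' ⊆ Icc 0 T := Icc_subset_Icc_right hT
  exact ⟨fun t ht => (h.natDegree_le t (hsub ht)).trans hK, fun t ht => h.coeff_zero t (hsub ht),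
    fun t ht n => (h.hasDeriv t (hsub ht) n).mono hsub⟩

theorem Pinched.velocity_spec {r μ M : ℝ} {B : ℂ[X]} (h : Pinched r μ M B) (hr : 1 < r)
    (hμ : 0 < μ) : (velocity B).natDegree ≤ B.natDegree ∧ IsVelocity B (velocity B) :=
  HeleShaw.velocity_spec fun _ hz => h.ne_zero hμ (hz.trans hr.le)

theorem lipConst_pos {r μ M : ℝ} (hr : 1 < r) (hμ : 0 < μ) (hM : 0 < M) : 0 < lipConst r μ M := by
  have := phiBound_pos hr hμ
  unfold lipConst
  positivity

theorem l2sq_velocity_le {r μ M : ℝ} (hr : 1 < r) (hμ : 0 < μ) {K : ℕ} {B₁ B₂ : ℂ[X]}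
    (hB₁ : B₁.natDegree < K) (hB₂ : B₂.natDegree < K) (hp₁ : Pinched r μ M B₁)
    (hp₂ : Pinched r μ M B₂) :
    l2sq K r (velocity B₁ - velocity B₂) ≤ lipConst r μ M ^ 2 * l2sq K r (B₁ - B₂) :=
  l2sq_velocity_sub_le hr hμ hB₁ hB₂ ((hp₁.velocity_spec hr hμ).1.trans_lt hB₁)
    ((hp₂.velocity_spec hr hμ).1.trans_lt hB₂) hp₁ hp₂ (hp₁.velocity_spec hr hμ).2
    (hp₂.velocity_spec hr hμ).2

/-- The mean square of the shifted polynomial `(p - p 0) / z`. -/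
def shiftSq (K : ℕ) (r : ℝ) (p : ℂ[X]) : ℝ :=
  ∑ n ∈ Finset.range K, ‖p.coeff (n + 1)‖ ^ 2 * r ^ (2 * n)

theorem l2sq_derivative (K : ℕ) (r : ℝ) (p : ℂ[X]) :
    l2sq K r (derivative p) =
      ∑ n ∈ Finset.range K, ((n : ℝ) + 1) ^ 2 * (‖p.coeff (n + 1)‖ ^ 2 * r ^ (2 * n)) := by
  refine Finset.sum_congr rfl fun n _ => ?_
  have : ‖((n : ℂ) + 1)‖ = (n : ℝ) + 1 := by
    rw [← Nat.cast_succ, Complex.norm_natCast]; push_cast; ring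
  rw [coeff_derivative, norm_mul, this]
  ring

theorem sum_succ_sq_mul_le {K : ℕ} {a : ℕ → ℝ} (ha : ∀ n, 0 ≤ a n) :
    ∑ n ∈ Finset.range K, ((n : ℝ) + 1) ^ 2 * a n ≤ (K : ℝ) ^ 2 * ∑ n ∈ Finset.range K, a n := by
  rw [Finset.mul_sum]
  refine Finset.sum_le_sum fun n hn => ?_
  have h1 : (n : ℝ) + 1 ≤ K := by exact_mod_cast Finset.mem_range.1 hn
  have := ha n
  gcongr

variable {K : ℕ} {T r μ M : ℝ} {g h : ℝ → ℂ[X]}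

/-- The velocities differ by at most `c` times the derivatives in mean square, and the derivative
costs at most K. Gronwall then gives the rate `c K`. This version controls the solutions themselves
and serves the estimates of all orders j. -/
theorem PolySol.sqrt_shiftSq_sub_le (hr : 1 < r) (hμ : 0 < μ) (hM : 0 < M) (hK : 0 < K)
    (hg : PolySol K T g) (hh : PolySol K T h)
    (hgp : ∀ t ∈ Icc 0 T, Pinched r μ M (derivative (g t)))
    (hhp : ∀ t ∈ Icc 0 T, Pinched r μ M (derivative (h t))) :
    ∀ t ∈ Icc 0 T, √(shiftSq K r (g t - h t)) ≤
      Real.exp (lipConst r μ M * K * t) * √(shiftSq K r (g 0 - h 0)) := by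
  have hr0 : 0 < r := by linarith
  have hL := lipConst_pos hr hμ hM
  have hn : ∀ (p : ℂ[X]) (n : ℕ), ‖(r : ℂ) ^ n * p.coeff n‖ ^ 2 =
      ‖p.coeff n‖ ^ 2 * r ^ (2 * n) := fun p n => by
    rw [norm_mul, norm_pow, Complex.norm_real, Real.norm_of_nonneg hr0.le]; ring
  have hn' : ∀ (p : ℂ[X]) (n : ℕ), ‖(r : ℂ) ^ n * p.coeff (n + 1)‖ ^ 2 =
      ‖p.coeff (n + 1)‖ ^ 2 * r ^ (2 * n) := fun p n => by
    rw [norm_mul, norm_pow, Complex.norm_real, Real.norm_of_nonneg hr0.le]; ring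
  have := sum_norm_sq_le_of_deriv (K := K) (T := T) (c := lipConst r μ M * K)
    (y := fun t n => (r : ℂ) ^ n * (g t - h t).coeff (n + 1))
    (y' := fun t n => (r : ℂ) ^ n *
      (velocity (derivative (g t)) - velocity (derivative (h t))).coeff n)
    (fun t ht n _ => by
      simp only [coeff_sub]
      exact ((hg.hasDeriv t ht n).sub (hh.hasDeriv t ht n)).const_mul _) (by positivity)
    (fun t ht => by
      simp only [hn, hn']
      have h1 := l2sq_velocity_le hr hμ (natDegree_derivative_lt hK (hg.natDegree_le t ht))
        (natDegree_derivative_lt hK (hh.natDegree_le t ht)) (hgp t ht) (hhp t ht)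
      rw [← derivative_sub, l2sq_derivative] at h1
      have h2 := sum_succ_sq_mul_le (K := K)
        (a := fun n => ‖(g t - h t).coeff (n + 1)‖ ^ 2 * r ^ (2 * n)) fun n => by positivity
      refine h1.trans ?_
      rw [mul_pow, mul_assoc]
      gcongr)
  simpa only [hn', shiftSq] using this

/-- Here the factor K arises from differentiating the velocity. This version controls the first
derivatives directly, as needed to keep them away from zero. -/
theorem PolySol.sqrt_l2sq_derivative_sub_le (hr : 1 < r) (hμ : 0 < μ) (hM : 0 < M) (hK : 0 < K)
    (hg : PolySol K T g) (hh : PolySol K T h)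
    (hgp : ∀ t ∈ Icc 0 T, Pinched r μ M (derivative (g t)))
    (hhp : ∀ t ∈ Icc 0 T, Pinched r μ M (derivative (h t))) :
    ∀ t ∈ Icc 0 T, √(l2sq K r (derivative (g t) - derivative (h t))) ≤
      Real.exp (lipConst r μ M * K * t) * √(l2sq K r (derivative (g 0) - derivative (h 0))) := by
  have hr0 : 0 < r := by linarith
  have hL := lipConst_pos hr hμ hM
  have hc : ∀ n : ℕ, ‖((n : ℂ) + 1)‖ = (n : ℝ) + 1 := fun n => by
    rw [← Nat.cast_succ, Complex.norm_natCast]; push_cast; ring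
  have hn : ∀ (p : ℂ[X]) (n : ℕ), ‖((n : ℂ) + 1) * (r : ℂ) ^ n * p.coeff n‖ ^ 2 =
      ((n : ℝ) + 1) ^ 2 * (‖p.coeff n‖ ^ 2 * r ^ (2 * n)) := fun p n => by
    rw [norm_mul, norm_mul, norm_pow, Complex.norm_real, Real.norm_of_nonneg hr0.le, hc]; ring
  have hn' : ∀ (p : ℂ[X]) (n : ℕ), ‖((n : ℂ) + 1) * (r : ℂ) ^ n * p.coeff (n + 1)‖ ^ 2 =
      ((n : ℝ) + 1) ^ 2 * (‖p.coeff (n + 1)‖ ^ 2 * r ^ (2 * n)) := fun p n => by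
    rw [norm_mul, norm_mul, norm_pow, Complex.norm_real, Real.norm_of_nonneg hr0.le, hc]; ring
  have := sum_norm_sq_le_of_deriv (K := K) (T := T) (c := lipConst r μ M * K)
    (y := fun t n => ((n : ℂ) + 1) * (r : ℂ) ^ n * (g t - h t).coeff (n + 1))
    (y' := fun t n => ((n : ℂ) + 1) * (r : ℂ) ^ n *
      (velocity (derivative (g t)) - velocity (derivative (h t))).coeff n)
    (fun t ht n _ => by
      simp only [coeff_sub]
      exact ((hg.hasDeriv t ht n).sub (hh.hasDeriv t ht n)).const_mul _) (by positivity)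
    (fun t ht => by
      simp only [hn, hn', ← l2sq_derivative]
      have h1 := l2sq_velocity_le hr hμ (natDegree_derivative_lt hK (hg.natDegree_le t ht))
        (natDegree_derivative_lt hK (hh.natDegree_le t ht)) (hgp t ht) (hhp t ht)
      rw [← derivative_sub] at h1
      have h2 := sum_succ_sq_mul_le (K := K)
        (a := fun n => ‖(velocity (derivative (g t)) - velocity (derivative (h t))).coeff n‖ ^ 2
          * r ^ (2 * n)) fun n => by positivity
      refine h2.trans ?_
      rw [mul_pow, mul_comm (lipConst r μ M ^ 2), mul_assoc]
      gcongr
      exact h1)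
  simpa only [hn', ← l2sq_derivative, derivative_sub] using this

/-- The polynomial with zero constant term and given further coefficients. -/
def toPoly (x : Fin K → ℂ) : ℂ[X] := X * ofCoeffs x

theorem coeff_toPoly_succ (x : Fin K → ℂ) (n : ℕ) :
    (toPoly x).coeff (n + 1) = (ofCoeffs x).coeff n := by
  simp [toPoly]

theorem coeff_toPoly_zero (x : Fin K → ℂ) : (toPoly x).coeff 0 = 0 := by
  simp [toPoly]

theorem natDegree_toPoly_le (hK : 0 < K) (x : Fin K → ℂ) : (toPoly x).natDegree ≤ K := by
  refine natDegree_mul_le.trans ?_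
  have := natDegree_ofCoeffs_lt hK x
  rw [natDegree_X]
  omega

theorem toPoly_coeff {p : ℂ[X]} (hp : p.natDegree ≤ K) (h0 : p.coeff 0 = 0) :
    toPoly (fun i : Fin K => p.coeff (i + 1)) = p := by
  ext n
  cases n with
  | zero => rw [coeff_toPoly_zero, h0]
  | succ n =>
    rw [coeff_toPoly_succ, coeff_ofCoeffs]
    split_ifs with h
    · rfl
    · rw [coeff_eq_zero_of_natDegree_lt (by omega)]

/-- The vector field on coefficient vectors. -/
def velocityField (x : Fin K → ℂ) : Fin K → ℂ :=
  fun i => (velocity (derivative (toPoly x))).coeff i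

/-- Needed only for existence and continuity; the constant may depend on K, unlike `lipConst`. -/
theorem lipschitzOnWith_velocityField (hr : 1 < r) (hμ : 0 < μ) (hM : 0 < M) (hK : 0 < K) :
    ∃ L : ℝ≥0, LipschitzOnWith L (velocityField (K := K))
      {x | Pinched r μ M (derivative (toPoly x))} := by
  have hr0 : 0 < r := by linarith
  have hL := lipConst_pos hr hμ hM
  set D : ℝ := ∑ n ∈ Finset.range K, ((n : ℝ) + 1) ^ 2 * r ^ (2 * n) with hD
  have hD0 : 0 ≤ D := Finset.sum_nonneg fun n _ => by positivity
  refine ⟨Real.toNNReal (lipConst r μ M * √D), LipschitzOnWith.of_dist_le_mul fun x hx y hy => ?_⟩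
  rw [Real.coe_toNNReal _ (by positivity)]
  refine (dist_pi_le_iff (by positivity)).2 fun i => ?_
  have h1 := l2sq_velocity_le hr hμ (natDegree_derivative_lt hK (natDegree_toPoly_le hK x))
    (natDegree_derivative_lt hK (natDegree_toPoly_le hK y)) hx hy
  rw [← derivative_sub, l2sq_derivative] at h1
  have h2 : ∑ n ∈ Finset.range K, ((n : ℝ) + 1) ^ 2 *
      (‖(toPoly x - toPoly y).coeff (n + 1)‖ ^ 2 * r ^ (2 * n)) ≤ D * dist x y ^ 2 := by
    rw [hD, Finset.sum_mul]
    refine Finset.sum_le_sum fun n hn => ?_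
    have hnK := Finset.mem_range.1 hn
    rw [coeff_sub, coeff_toPoly_succ, coeff_toPoly_succ, coeff_ofCoeffs, coeff_ofCoeffs,
      dif_pos hnK, dif_pos hnK, ← dist_eq_norm]
    have := dist_le_pi_dist x y ⟨n, hnK⟩
    calc ((n : ℝ) + 1) ^ 2 * (dist (x ⟨n, hnK⟩) (y ⟨n, hnK⟩) ^ 2 * r ^ (2 * n))
        ≤ ((n : ℝ) + 1) ^ 2 * (dist x y ^ 2 * r ^ (2 * n)) := by gcongr
      _ = _ := by ring
  have h3 : dist (velocityField x i) (velocityField y i) ^ 2 ≤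
      l2sq K r (velocity (derivative (toPoly x)) - velocity (derivative (toPoly y))) := by
    refine le_trans ?_ (Finset.single_le_sum (f := fun n => ‖(velocity (derivative (toPoly x)) -
      velocity (derivative (toPoly y))).coeff n‖ ^ 2 * r ^ (2 * n)) (fun n _ => by positivity)
      (Finset.mem_range.2 i.2))
    rw [dist_eq_norm, coeff_sub]
    exact le_mul_of_one_le_right (by positivity) (one_le_pow₀ hr.le)
  refine le_of_sq_le_sq ?_ (by positivity)
  rw [mul_pow, mul_pow, Real.sq_sqrt hD0, mul_assoc]
  exact h3.trans (h1.trans (by gcongr))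

end

/-! ### Adding one monomial to the initial datum. -/

section

theorem Pinched.of_wnorm_sub_le {r m M A : ℝ} {B Q : ℂ[X]} (hQ : Pinched r m M Q)
    (h : wnorm r (B - Q) ≤ A) : Pinched r (m - A) (M + A) B := by
  intro z hz
  have h1 := hQ z hz
  have h2 : ‖B.eval z - Q.eval z‖ ≤ A := by
    rw [← eval_sub]; exact (norm_eval_le_wnorm _ hz).trans h
  have h3 := norm_sub_norm_le (Q.eval z) (B.eval z)
  have h4 := norm_sub_norm_le (B.eval z) (Q.eval z)
  rw [norm_sub_rev] at h3
  constructor <;> linarith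

theorem coeff_derivative_C_mul_X_pow (b : ℂ) (k n : ℕ) :
    (derivative (C b * X ^ k)).coeff n = if n + 1 = k then b * k else 0 := by
  rw [coeff_derivative, coeff_C_mul_X_pow]
  split_ifs with h
  · rw [← h]; push_cast; ring
  · simp

theorem sqrt_l2sq_derivative_C_mul_X_pow {K k : ℕ} (hk : 0 < k) (hkK : k ≤ K) {r : ℝ}
    (hr : 0 ≤ r) (b : ℂ) :
    √(l2sq K r (derivative (C b * X ^ k))) = k * ‖b‖ * r ^ (k - 1) := by
  have : l2sq K r (derivative (C b * X ^ k)) = (k * ‖b‖ * r ^ (k - 1)) ^ 2 := by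
    rw [l2sq, Finset.sum_eq_single (k - 1)]
    · rw [coeff_derivative_C_mul_X_pow, if_pos (by omega), norm_mul, Complex.norm_natCast]; ring
    · intro n _ hn
      rw [coeff_derivative_C_mul_X_pow, if_neg (by omega)]; simp
    · intro hn
      exact absurd (Finset.mem_range.2 (by omega)) hn
  rw [this, Real.sqrt_sq (by positivity)]

theorem sqrt_shiftSq_C_mul_X_pow {K k : ℕ} (hk : 0 < k) (hkK : k ≤ K) {r : ℝ}
    (hr : 0 ≤ r) (b : ℂ) : √(shiftSq K r (C b * X ^ k)) = ‖b‖ * r ^ (k - 1) := by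
  have : shiftSq K r (C b * X ^ k) = (‖b‖ * r ^ (k - 1)) ^ 2 := by
    rw [shiftSq, Finset.sum_eq_single (k - 1)]
    · rw [coeff_C_mul_X_pow, if_pos (by omega)]; ring
    · intro n _ hn
      rw [coeff_C_mul_X_pow, if_neg (by omega)]; simp
    · intro hn
      exact absurd (Finset.mem_range.2 (by omega)) hn
  rw [this, Real.sqrt_sq (by positivity)]

theorem wnorm_derivative_C_mul_X_pow_le {K k : ℕ} (hk : 0 < k) (hkK : k ≤ K) {r : ℝ}
    (hr : 0 ≤ r) (b : ℂ) :
    wnorm r (derivative (C b * X ^ k)) ≤ √K * (k * ‖b‖ * r ^ (k - 1)) := by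
  rw [← sqrt_l2sq_derivative_C_mul_X_pow hk hkK hr b]
  exact wnorm_le_l2sq (natDegree_derivative_lt (by omega)
    ((natDegree_C_mul_X_pow_le b k).trans hkK)) r

variable {K : ℕ} {T r m M A A' : ℝ}

/-- The extended field always has a solution, but it solves the true equation only while the
derivative stays pinched. The allowance `A'`, strictly between `A + ε` and m, makes this
self-improving: pinching with `μ = m - A'` yields the Gronwall bound, which yields distance at most
`A + ε < A'`. -/
theorem exists_polySol_step (hr : 1 < r) (hA' : A' < m) (hM : 0 < M + A') {P h : ℝ → ℂ[X]}
    (hPdeg : ∀ t ∈ Icc 0 T, (P t).natDegree ≤ K)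
    (hPc : ∀ n, ContinuousOn (fun t => (P t).coeff n) (Icc 0 T))
    (hPp : ∀ t ∈ Icc 0 T, Pinched r m M (derivative (P t)))
    (hT : 0 ≤ T) (hh : PolySol K T h) {b : ℂ} {k : ℕ} (hk : 0 < k) (hkK : k ≤ K) {ε : ℝ}
    (hhA : ∀ t ∈ Icc 0 T, wnorm r (derivative (h t) - derivative (P t)) ≤ A) (hAε : A + ε < A')
    (hε : √K * (Real.exp (lipConst r (m - A') (M + A') * K * T) * (k * ‖b‖ * r ^ (k - 1))) ≤ ε) :
    ∃ g : ℝ → ℂ[X], PolySol K T g ∧ g 0 = h 0 + C b * X ^ k ∧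
      ∀ t ∈ Icc 0 T, wnorm r (derivative (g t) - derivative (P t)) ≤ A + ε := by
  have hr0 : 0 < r := by linarith
  have hK : 0 < K := by omega
  set μ := m - A' with hμdef
  have hμ : 0 < μ := by linarith
  set c := lipConst r μ (M + A') with hc
  have hc0 : 0 < c := lipConst_pos hr hμ hM
  have h0 : (0 : ℝ) ∈ Icc 0 T := left_mem_Icc.2 hT
  have hsmall : ∀ τ ∈ Icc 0 T,
      √K * (Real.exp (c * K * τ) * (k * ‖b‖ * r ^ (k - 1))) ≤ ε := by
    intro τ hτ
    refine le_trans ?_ hε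
    have := hτ.2
    gcongr
  have hε0 : 0 ≤ ε := le_trans (by positivity) (hsmall 0 h0)
  obtain ⟨L, hL⟩ := lipschitzOnWith_velocityField (K := K) hr hμ hM hK
  have hbd : ∀ x ∈ {x : Fin K → ℂ | Pinched r μ (M + A') (derivative (toPoly x))}, ∀ i,
      ‖velocityField x i‖ ≤ (M + A') * phiBound r μ := fun x hx i =>
    norm_coeff_velocity_le hr hμ hx (Pinched.velocity_spec hx hr hμ).2 i
  set g₀ := h 0 + C b * X ^ k with hg₀
  have hg₀d : g₀.natDegree ≤ K := natDegree_add_le_of_degree_le (hh.natDegree_le 0 h0)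
    ((natDegree_C_mul_X_pow_le b k).trans hkK)
  have hg₀0 : g₀.coeff 0 = 0 := by
    rw [hg₀, coeff_add, hh.coeff_zero 0 h0, coeff_C_mul_X_pow, if_neg hk.ne, add_zero]
  obtain ⟨x, hx0, hxc, hx⟩ := exists_solution_of_lipschitzOnWith hL hbd
    (fun i : Fin K => g₀.coeff (i + 1)) hT
  set g : ℝ → ℂ[X] := fun t => toPoly (x t) with hg
  have hg0 : g 0 = g₀ := by
    simp only [hg, hx0]
    exact toPoly_coeff hg₀d hg₀0
  -- the solution property on an initial interval where the curve is pinched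
  have hsol : ∀ τ ∈ Icc 0 T, (∀ t ∈ Icc 0 τ, wnorm r (derivative (g t) - derivative (P t)) ≤ A') →
      PolySol K τ g := by
    intro τ hτ hA
    refine ⟨fun t _ => natDegree_toPoly_le hK _, fun t _ => coeff_toPoly_zero _, fun t ht n => ?_⟩
    have htT : t ∈ Icc 0 T := ⟨ht.1, ht.2.trans hτ.2⟩
    have hp : Pinched r μ (M + A') (derivative (toPoly (x t))) :=
      (hPp t htT).of_wnorm_sub_le (hA t ht)
    have hd := (hx t htT hp).mono (Icc_subset_Icc_right hτ.2)
    rw [hasDerivWithinAt_pi] at hd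
    simp only [hg, coeff_toPoly_succ, coeff_ofCoeffs]
    split_ifs with hn
    · exact hd ⟨n, hn⟩
    · have h1 : (velocity (derivative (toPoly (x t)))).natDegree < K :=
        (hp.velocity_spec hr hμ).1.trans_lt
          (natDegree_derivative_lt hK (natDegree_toPoly_le hK _))
      rw [coeff_eq_zero_of_natDegree_lt (by omega)]
      exact hasDerivWithinAt_const _ _ _
  have hdiff0 : g 0 - h 0 = C b * X ^ k := by rw [hg0, hg₀]; ring
  have hmain : ∀ t ∈ Icc 0 T, wnorm r (derivative (g t) - derivative (P t)) ≤ A + ε := by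
    refine le_of_bootstrap (A' := A') ?_ hAε ?_ fun τ hτ hbound => ?_
    · have hcont : ∀ n, ContinuousOn (fun t => (derivative (g t) - derivative (P t)).coeff n)
          (Icc 0 T) := by
        intro n
        simp only [← derivative_sub, coeff_derivative, coeff_sub, hg, coeff_toPoly_succ,
          coeff_ofCoeffs]
        refine ContinuousOn.mul (ContinuousOn.sub ?_ (hPc _)) continuousOn_const
        split_ifs with hn
        · exact (continuous_apply _).comp_continuousOn hxc
        · exact continuousOn_const
      have heq : EqOn (fun t => wnorm r (derivative (g t) - derivative (P t)))
          (fun t => ∑ n ∈ Finset.range K,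
            ‖(derivative (g t) - derivative (P t)).coeff n‖ * r ^ n) (Icc 0 T) := by
        intro t ht
        refine wnorm_eq_sum ?_ r
        rw [← derivative_sub]
        exact natDegree_derivative_lt hK ((natDegree_sub_le _ _).trans
          (max_le (natDegree_toPoly_le hK _) (hPdeg t ht)))
      refine ContinuousOn.congr ?_ heq
      exact continuousOn_finsetSum _ fun n _ => (hcont n).norm.mul continuousOn_const
    · refine (wnorm_sub_le hr0.le _ (derivative (h 0)) _).trans ?_
      rw [← derivative_sub (f := g 0), hdiff0, add_comm]
      refine add_le_add (hhA 0 h0) ((wnorm_derivative_C_mul_X_pow_le hk hkK hr0.le b).trans ?_)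
      simpa using hsmall 0 h0
    · have hgs := hsol τ hτ hbound
      have hhs := hh.mono hτ.2 le_rfl
      have hsub : ∀ t ∈ Icc 0 τ, t ∈ Icc 0 T := fun t ht => ⟨ht.1, ht.2.trans hτ.2⟩
      have h1 := PolySol.sqrt_l2sq_derivative_sub_le hr hμ hM hK hgs hhs
        (fun t ht => (hPp t (hsub t ht)).of_wnorm_sub_le (hbound t ht))
        (fun t ht => (hPp t (hsub t ht)).of_wnorm_sub_le
          ((hhA t (hsub t ht)).trans (by linarith))) τ (right_mem_Icc.2 hτ.1)
      rw [← derivative_sub (f := g 0), hdiff0,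
        sqrt_l2sq_derivative_C_mul_X_pow hk hkK hr0.le] at h1
      refine (wnorm_sub_le hr0.le _ (derivative (h τ)) _).trans ?_
      rw [add_comm]
      refine add_le_add (hhA τ hτ) ?_
      have hdeg : (derivative (g τ) - derivative (h τ)).natDegree < K := by
        rw [← derivative_sub]
        exact natDegree_derivative_lt hK ((natDegree_sub_le _ _).trans
          (max_le (natDegree_toPoly_le hK _) (hh.natDegree_le τ hτ)))
      refine (wnorm_le_l2sq hdeg r).trans (le_trans ?_ (hsmall τ hτ))
      gcongr
  exact ⟨g, hsol T (right_mem_Icc.2 hT) fun t ht => (hmain t ht).trans hAε.le, hg0, hmain⟩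

end

/-! ### The time horizon, the cost of one coefficient and the approximating sequence. -/

section

theorem wnorm_derivative_le {r : ℝ} (hr : 1 ≤ r) {K : ℕ} {p : ℂ[X]} (hp : p.natDegree ≤ K) :
    wnorm r (derivative p) ≤ K * wnorm r p := by
  have h1 : (derivative p).natDegree < K + 1 :=
    Nat.lt_succ_of_le ((natDegree_derivative_le p).trans (by omega))
  have hr0 : 0 ≤ r := by linarith
  rw [wnorm_eq_sum h1, wnorm_eq_sum (K := K + 1 + 1) (by omega), Finset.sum_range_succ' _ (K + 1),
    mul_add, Finset.mul_sum]
  refine le_add_of_le_of_nonneg (Finset.sum_le_sum fun n _ => ?_) (by positivity)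
  have hc : ‖((n : ℂ) + 1)‖ = (n : ℝ) + 1 := by
    rw [← Nat.cast_succ, Complex.norm_natCast]; push_cast; ring
  rw [coeff_derivative, norm_mul, hc]
  rcases lt_or_ge n K with hn | hn
  · have h2 : (n : ℝ) + 1 ≤ K := by exact_mod_cast hn
    have h3 : r ^ n ≤ r ^ (n + 1) := pow_le_pow_right₀ hr (Nat.le_succ n)
    calc ‖p.coeff (n + 1)‖ * (n + 1) * r ^ n ≤ ‖p.coeff (n + 1)‖ * K * r ^ (n + 1) := by gcongr
      _ = _ := by ring
  · rw [coeff_eq_zero_of_natDegree_lt (by omega)]; simp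

theorem wnorm_iterate_derivative_le {r : ℝ} (hr : 1 ≤ r) {K : ℕ} {p : ℂ[X]}
    (hp : p.natDegree ≤ K) (j : ℕ) : wnorm r (derivative^[j] p) ≤ (K : ℝ) ^ j * wnorm r p := by
  induction j with
  | zero => simp
  | succ j ih =>
    rw [Function.iterate_succ_apply', pow_succ']
    have : (derivative^[j] p).natDegree ≤ K :=
      (natDegree_iterate_derivative p j).trans ((Nat.sub_le _ _).trans hp)
    refine (wnorm_derivative_le hr this).trans ?_
    rw [mul_assoc]
    gcongr

theorem wnorm_le_shiftSq {r : ℝ} (hr : 0 ≤ r) {K : ℕ} {p : ℂ[X]} (hp : p.natDegree ≤ K)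
    (h0 : p.coeff 0 = 0) : wnorm r p ≤ r * (√K * √(shiftSq K r p)) := by
  rw [wnorm_eq_sum (Nat.lt_succ_of_le hp), Finset.sum_range_succ', h0]
  have h1 := sum_le_sqrt_mul_sqrt K fun n => ‖p.coeff (n + 1)‖ * r ^ n
  have h2 : ∑ n ∈ Finset.range K, (‖p.coeff (n + 1)‖ * r ^ n) ^ 2 = shiftSq K r p :=
    Finset.sum_congr rfl fun n _ => by ring
  rw [h2] at h1
  calc _ = r * ∑ n ∈ Finset.range K, ‖p.coeff (n + 1)‖ * r ^ n := by
        simp only [norm_zero, zero_mul, add_zero, Finset.mul_sum]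
        exact Finset.sum_congr rfl fun n _ => by ring
    _ ≤ _ := by gcongr

theorem max_le_mul {k k₀ : ℕ} (hk : 0 < k) (hk₀ : 0 < k₀) : max k k₀ ≤ k₀ * k := by
  refine max_le ?_ ?_
  · exact Nat.le_mul_of_pos_left k hk₀
  · exact Nat.le_mul_of_pos_right k₀ hk

/-- This is what fixes the life span `ln (ρ/r) / (c k₀)`: with `max k k₀ ≤ k₀ k`, the growth of the
k-th increment is absorbed by enlarging the radius from r to ρ. -/
theorem exp_mul_le_pow {c r ρ T t : ℝ} (hc : 0 < c) (hr : 0 < r) (hρ : r < ρ) {k k₀ : ℕ}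
    (hk : 0 < k) (hk₀ : 0 < k₀) (hT : T ≤ 1 / (c * k₀) * Real.log (ρ / r)) (ht : t ≤ T) :
    Real.exp (c * (max k k₀ : ℕ) * t) ≤ (ρ / r) ^ k := by
  have h1 : 1 < ρ / r := by rw [one_lt_div hr]; exact hρ
  have h2 : 0 < Real.log (ρ / r) := Real.log_pos h1
  have hk₀' : (0 : ℝ) < k₀ := by exact_mod_cast hk₀
  have h3 : ((max k k₀ : ℕ) : ℝ) ≤ k₀ * k := by exact_mod_cast max_le_mul hk hk₀
  have h4 : c * (max k k₀ : ℕ) * t ≤ k * Real.log (ρ / r) := by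
    calc c * (max k k₀ : ℕ) * t ≤ c * (max k k₀ : ℕ) * (1 / (c * k₀) * Real.log (ρ / r)) := by
          gcongr; exact ht.trans hT
      _ ≤ c * (k₀ * k) * (1 / (c * k₀) * Real.log (ρ / r)) := by gcongr
      _ = _ := by field_simp
  calc Real.exp (c * (max k k₀ : ℕ) * t) ≤ Real.exp (k * Real.log (ρ / r)) :=
        Real.exp_le_exp.2 h4
    _ = _ := by rw [Real.exp_nat_mul, Real.exp_log (by linarith)]

theorem pow_pred_mul_div_pow {r ρ : ℝ} (hr : 0 < r) {k : ℕ} (hk : 0 < k) :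
    r * ((ρ / r) ^ k * r ^ (k - 1)) = ρ ^ k := by
  obtain ⟨n, rfl⟩ := Nat.exists_eq_succ_of_ne_zero hk.ne'
  rw [div_pow]
  simp only [Nat.succ_eq_add_one, Nat.add_sub_cancel]
  field_simp
  ring

/-- The contribution of the coefficient `b` of `ξ ^ k` to the derivative of order `j`. -/
def stepBound (k₀ : ℕ) (ρ : ℝ) (j k : ℕ) (b : ℂ) : ℝ :=
  √k₀ * (k₀ : ℝ) ^ j * (‖b‖ * ρ ^ k * (√k * (k : ℝ) ^ j))

theorem stepBound_nonneg {k₀ : ℕ} {ρ : ℝ} (hρ : 0 ≤ ρ) (j k : ℕ) (b : ℂ) :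
    0 ≤ stepBound k₀ ρ j k b := by
  unfold stepBound; positivity

/-- The contribution of the coefficient `b` of `ξ ^ k` to the first derivative. -/
def stepBound' (k₀ : ℕ) (ρ : ℝ) (k : ℕ) (b : ℂ) : ℝ :=
  √k₀ * (‖b‖ * ρ ^ k * (√k * (k : ℝ)))

theorem stepBound'_nonneg {k₀ : ℕ} {ρ : ℝ} (hρ : 0 ≤ ρ) (k : ℕ) (b : ℂ) :
    0 ≤ stepBound' k₀ ρ k b := by
  unfold stepBound'; positivity

theorem sqrt_max_le {k k₀ : ℕ} (hk : 0 < k) (hk₀ : 0 < k₀) : √((max k k₀ : ℕ) : ℝ) ≤ √k₀ * √k := by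
  rw [← Real.sqrt_mul (by positivity)]
  exact Real.sqrt_le_sqrt (by exact_mod_cast max_le_mul hk hk₀)

theorem sqrt_mul_exp_mul_le_stepBound' {c r ρ T t : ℝ} (hc : 0 < c) (hr : 1 < r) (hρ : r < ρ)
    {k k₀ : ℕ} (hk : 0 < k) (hk₀ : 0 < k₀) (hT : T ≤ 1 / (c * k₀) * Real.log (ρ / r))
    (ht : t ≤ T) (b : ℂ) :
    √((max k k₀ : ℕ) : ℝ) * (Real.exp (c * (max k k₀ : ℕ) * t) * (k * ‖b‖ * r ^ (k - 1))) ≤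
      stepBound' k₀ ρ k b := by
  have hr0 : 0 < r := by linarith
  have h1 := exp_mul_le_pow hc hr0 hρ hk hk₀ hT ht
  have h2 : (ρ / r) ^ k * r ^ (k - 1) ≤ ρ ^ k := by
    have hρ0 : 0 < ρ := by linarith
    rw [← pow_pred_mul_div_pow (ρ := ρ) hr0 hk]
    exact le_mul_of_one_le_left (by positivity) hr.le
  have h3 := sqrt_max_le hk hk₀
  calc _ ≤ (√k₀ * √k) * ((ρ / r) ^ k * (k * ‖b‖ * r ^ (k - 1))) := by gcongr
    _ = (√k₀ * √k) * (k * ‖b‖ * ((ρ / r) ^ k * r ^ (k - 1))) := by ring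
    _ ≤ (√k₀ * √k) * (k * ‖b‖ * ρ ^ k) := by gcongr
    _ = _ := by unfold stepBound'; ring

theorem pow_mul_sqrt_mul_exp_mul_le_stepBound {c r ρ T t : ℝ} (hc : 0 < c) (hr : 1 < r)
    (hρ : r < ρ) {k k₀ : ℕ} (hk : 0 < k) (hk₀ : 0 < k₀)
    (hT : T ≤ 1 / (c * k₀) * Real.log (ρ / r)) (ht : t ≤ T) (b : ℂ) (j : ℕ) :
    ((max k k₀ : ℕ) : ℝ) ^ j * (r * (√((max k k₀ : ℕ) : ℝ) *
      (Real.exp (c * (max k k₀ : ℕ) * t) * (‖b‖ * r ^ (k - 1))))) ≤ stepBound k₀ ρ j k b := by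
  have hr0 : 0 < r := by linarith
  have h1 := exp_mul_le_pow hc hr0 hρ hk hk₀ hT ht
  have h3 := sqrt_max_le hk hk₀
  have h4 : ((max k k₀ : ℕ) : ℝ) ≤ k₀ * k := by exact_mod_cast max_le_mul hk hk₀
  calc _ ≤ ((k₀ : ℝ) * k) ^ j * (r * ((√k₀ * √k) * ((ρ / r) ^ k * (‖b‖ * r ^ (k - 1))))) := by
        gcongr
    _ = ((k₀ : ℝ) * k) ^ j * ((√k₀ * √k) * (‖b‖ * (r * ((ρ / r) ^ k * r ^ (k - 1))))) := by ring
    _ = _ := by rw [pow_pred_mul_div_pow hr0 hk]; unfold stepBound; ring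

variable {k₀ : ℕ} {T r ρ m M A A' : ℝ} {p : ℝ → ℂ[X]} {b : ℕ → ℂ}

/-- The induction closes because the constant c depends only on the final allowance `A'`, and the
partial sums of the costs never exceed A. -/
theorem exists_polySol_seq (hr : 1 < r) (hρ : r < ρ) (hA' : A' < m) (hAA' : A < A')
    (hM : 0 < M + A') (hk₀ : 0 < k₀) (hT : 0 ≤ T)
    (hTle : T ≤ 1 / (lipConst r (m - A') (M + A') * k₀) * Real.log (ρ / r))
    (hp : PolySol k₀ T p) (hpp : ∀ t ∈ Icc 0 T, Pinched r m M (derivative (p t)))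
    (hsum : ∀ k, ∑ i ∈ Finset.Icc 1 k, stepBound' k₀ ρ i (b i) ≤ A) :
    ∃ g : ℕ → ℝ → ℂ[X], g 0 = p ∧ ∀ k, PolySol (max k k₀) T (g k) ∧
      g k 0 = p 0 + ∑ i ∈ Finset.Icc 1 k, C (b i) * X ^ i ∧
      ∀ t ∈ Icc 0 T, wnorm r (derivative (g k t) - derivative (p t)) ≤
        ∑ i ∈ Finset.Icc 1 k, stepBound' k₀ ρ i (b i) := by
  have hpc : ∀ n, ContinuousOn (fun t => (p t).coeff n) (Icc 0 T) := by
    intro n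
    cases n with
    | zero => exact continuousOn_const.congr fun t ht => hp.coeff_zero t ht
    | succ n => exact fun t ht => (hp.hasDeriv t ht n).continuousWithinAt
  have hc := lipConst_pos (r := r) hr (sub_pos.2 hA') hM
  suffices H : ∀ k, ∃ g : ℝ → ℂ[X], PolySol (max k k₀) T g ∧
      g 0 = p 0 + ∑ i ∈ Finset.Icc 1 k, C (b i) * X ^ i ∧
      ∀ t ∈ Icc 0 T, wnorm r (derivative (g t) - derivative (p t)) ≤
        ∑ i ∈ Finset.Icc 1 k, stepBound' k₀ ρ i (b i) by
    choose g hg using H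
    -- Taking p itself as the initial member makes the telescoping sums end exactly at the reference
    -- solution.
    refine ⟨fun k => if k = 0 then p else g k, if_pos rfl, fun k => ?_⟩
    by_cases hk : k = 0
    · subst hk
      simp only [if_true]
      refine ⟨hp.mono le_rfl (le_max_right _ _), by simp, fun t ht => ?_⟩
      simp [wnorm]
    · simp only [if_neg hk]
      exact hg k
  intro k
  induction k with
  | zero =>
    refine ⟨p, hp.mono le_rfl (le_max_right _ _), by simp, fun t ht => ?_⟩
    simp [wnorm]
  | succ k ih =>
    obtain ⟨h, hh, hh0, hhw⟩ := ih
    have hs : ∑ i ∈ Finset.Icc 1 (k + 1), stepBound' k₀ ρ i (b i) =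
        ∑ i ∈ Finset.Icc 1 k, stepBound' k₀ ρ i (b i) + stepBound' k₀ ρ (k + 1) (b (k + 1)) :=
      Finset.sum_Icc_succ_top (by omega) _
    obtain ⟨g, hg, hg0, hgw⟩ := exists_polySol_step (K := max (k + 1) k₀) hr hA' hM
      (fun t ht => (hp.natDegree_le t ht).trans (le_max_right _ _)) hpc hpp hT
      (hh.mono le_rfl (max_le_max (Nat.le_succ k) le_rfl)) (b := b (k + 1)) (Nat.succ_pos k)
      (le_max_left _ _) hhw (ε := stepBound' k₀ ρ (k + 1) (b (k + 1)))
      (by rw [← hs]; exact (hsum _).trans_lt hAA')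
      (sqrt_mul_exp_mul_le_stepBound' hc hr hρ (Nat.succ_pos k) hk₀ hTle le_rfl _)
    refine ⟨g, hg, ?_, fun t ht => ?_⟩
    · rw [hg0, hh0, Finset.sum_Icc_succ_top (by omega), add_assoc]
    · rw [hs]; exact hgw t ht

/-- Consecutive approximations differ by the contribution of one coefficient. -/
theorem wnorm_step_le {μ M' : ℝ} (hr : 1 < r) (hρ : r < ρ) (hμ : 0 < μ) (hM : 0 < M')
    (hk₀ : 0 < k₀)
    (hTle : T ≤ 1 / (lipConst r μ M' * k₀) * Real.log (ρ / r)) {g h : ℝ → ℂ[X]} {k : ℕ}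
    (hk : 0 < k) (hg : PolySol (max k k₀) T g) (hh : PolySol (max k k₀) T h)
    (hgp : ∀ t ∈ Icc 0 T, Pinched r μ M' (derivative (g t)))
    (hhp : ∀ t ∈ Icc 0 T, Pinched r μ M' (derivative (h t))) {b : ℂ}
    (h0 : g 0 - h 0 = C b * X ^ k) {t : ℝ} (ht : t ∈ Icc 0 T) :
    wnorm r (derivative (g t) - derivative (h t)) ≤ stepBound' k₀ ρ k b ∧
    wnorm r (velocity (derivative (g t)) - velocity (derivative (h t))) ≤
      lipConst r μ M' * stepBound' k₀ ρ k b ∧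
    ∀ j, wnorm r (derivative^[j] (g t - h t)) ≤ stepBound k₀ ρ j k b := by
  have hr0 : 0 < r := by linarith
  have hc := lipConst_pos hr hμ hM
  set K := max k k₀ with hKdef
  have hkK : k ≤ K := le_max_left _ _
  have hK : 0 < K := hk.trans_le hkK
  have e1 := PolySol.sqrt_l2sq_derivative_sub_le hr hμ hM hK hg hh hgp hhp t ht
  have e2 := PolySol.sqrt_shiftSq_sub_le hr hμ hM hK hg hh hgp hhp t ht
  rw [← derivative_sub (f := g 0), h0, sqrt_l2sq_derivative_C_mul_X_pow hk hkK hr0.le] at e1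
  rw [h0, sqrt_shiftSq_C_mul_X_pow hk hkK hr0.le] at e2
  have hdg := natDegree_derivative_lt hK (hg.natDegree_le t ht)
  have hdh := natDegree_derivative_lt hK (hh.natDegree_le t ht)
  have hb1 := sqrt_mul_exp_mul_le_stepBound' hc hr hρ hk hk₀ hTle ht.2 b
  rw [← hKdef] at hb1
  refine ⟨?_, ?_, fun j => ?_⟩
  · refine (wnorm_le_l2sq (lt_of_le_of_lt (natDegree_sub_le _ _) (max_lt hdg hdh)) r).trans
      (le_trans ?_ hb1)
    gcongr
  -- The velocities inherit the derivative estimate with the extra factor c; this makes the time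
  -- derivatives of the approximations converge too.
  · have hvg := ((hgp t ht).velocity_spec hr hμ).1.trans_lt hdg
    have hvh := ((hhp t ht).velocity_spec hr hμ).1.trans_lt hdh
    have hl := l2sq_velocity_le hr hμ hdg hdh (hgp t ht) (hhp t ht)
    have hl' := Real.sqrt_le_sqrt hl
    rw [Real.sqrt_mul (sq_nonneg _), Real.sqrt_sq hc.le] at hl'
    refine (wnorm_le_l2sq (lt_of_le_of_lt (natDegree_sub_le _ _) (max_lt hvg hvh)) r).trans ?_
    calc _ ≤ √(K : ℝ) * (lipConst r μ M' * (Real.exp (lipConst r μ M' * K * t) *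
          (k * ‖b‖ * r ^ (k - 1)))) := by
          gcongr
          exact hl'.trans (by gcongr)
      _ = lipConst r μ M' * (√(K : ℝ) * (Real.exp (lipConst r μ M' * K * t) *
          (k * ‖b‖ * r ^ (k - 1)))) := by ring
      _ ≤ _ := by gcongr
  · have hd : (g t - h t).natDegree ≤ K :=
      (natDegree_sub_le _ _).trans (max_le (hg.natDegree_le t ht) (hh.natDegree_le t ht))
    have h00 : (g t - h t).coeff 0 = 0 := by
      rw [coeff_sub, hg.coeff_zero t ht, hh.coeff_zero t ht, sub_zero]
    have hb := pow_mul_sqrt_mul_exp_mul_le_stepBound hc hr hρ hk hk₀ hTle ht.2 b j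
    rw [← hKdef] at hb
    refine (wnorm_iterate_derivative_le hr.le hd j).trans (le_trans ?_ hb)
    gcongr
    refine (wnorm_le_shiftSq hr0.le hd h00).trans ?_
    gcongr

end

/-! ### Local univalence and nonvanishing derivative. -/

/-- A locally injective analytic function has no critical points. -/
theorem deriv_ne_zero_of_injOn {f : ℂ → ℂ} {z₀ : ℂ} (hf : AnalyticAt ℂ f z₀) {U : Set ℂ}
    (hU : U ∈ 𝓝 z₀) (hinj : InjOn f U) : deriv f z₀ ≠ 0 := by
  intro hd
  have hsub : AnalyticAt ℂ (fun z => f z - f z₀) z₀ := hf.sub analyticAt_const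
  have htop : analyticOrderAt (fun z => f z - f z₀) z₀ ≠ ⊤ := by
    intro h
    rw [analyticOrderAt_eq_top] at h
    obtain ⟨z, ⟨hz1, hz2⟩, hz3⟩ : ∃ z, (f z - f z₀ = 0 ∧ z ∈ U) ∧ z ≠ z₀ := by
      have h1 : ∀ᶠ z in 𝓝[≠] z₀, (f z - f z₀ = 0 ∧ z ∈ U) ∧ z ≠ z₀ :=
        ((h.and hU).filter_mono nhdsWithin_le_nhds).and self_mem_nhdsWithin
      exact h1.exists
    exact hz3 (hinj hz2 (mem_of_mem_nhds hU) (sub_eq_zero.1 hz1))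
  obtain ⟨n, hn⟩ := ENat.ne_top_iff_exists.1 htop
  obtain ⟨h, hh, hh0, hev⟩ := (hsub.analyticOrderAt_eq_natCast).1 hn.symm
  have hfz : f z₀ - f z₀ = (z₀ - z₀) ^ n • h z₀ := hev.self_of_nhds
  have hn0 : n ≠ 0 := by
    rintro rfl
    simp at hfz
    exact hh0 hfz.symm
  have hn1 : n ≠ 1 := by
    rintro rfl
    have h1 : deriv (fun z => f z - f z₀) z₀ = deriv (fun z => (z - z₀) ^ 1 • h z) z₀ :=
      Filter.EventuallyEq.deriv_eq hev
    have h2 : HasDerivAt (fun z => (z - z₀) ^ 1 • h z) (h z₀) z₀ := by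
      have := ((hasDerivAt_id z₀).sub_const z₀).fun_mul hh.differentiableAt.hasDerivAt
      simpa using this
    rw [h2.deriv, deriv_sub_const, hd] at h1
    exact hh0 h1.symm
  have hslit : h z₀ / h z₀ ∈ Complex.slitPlane := by
    rw [div_self hh0]; exact Complex.one_mem_slitPlane
  -- With n the order of the zero, an n-th root of `h / h z₀` puts f in the normal form `f z₀ + h z₀
  -- · ψ^n`, where ψ is a local coordinate.
  have hu : AnalyticAt ℂ (fun z => (h z / h z₀) ^ ((n : ℂ)⁻¹)) z₀ :=
    (hh.div analyticAt_const hh0).cpow analyticAt_const hslit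
  set u : ℂ → ℂ := fun z => (h z / h z₀) ^ ((n : ℂ)⁻¹) with hudef
  have hu0 : u z₀ = 1 := by simp [hudef, div_self hh0]
  have hψ : HasStrictDerivAt (fun z => (z - z₀) * u z) 1 z₀ := by
    have h1 : HasStrictDerivAt (fun z => z - z₀) 1 z₀ := (hasStrictDerivAt_id z₀).sub_const z₀
    have := h1.fun_mul hu.hasStrictDerivAt
    simpa [hu0] using this
  set ψ : ℂ → ℂ := fun z => (z - z₀) * u z with hψdef
  have hψ0 : ψ z₀ = 0 := by simp [hψdef]
  have hmap : map ψ (𝓝 z₀) = 𝓝 0 := by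
    rw [← hψ0]; exact hψ.map_nhds_eq one_ne_zero
  set V := {z | z ∈ U ∧ f z - f z₀ = (z - z₀) ^ n • h z} with hV
  have hVn : V ∈ 𝓝 z₀ := hev.mono (fun z hz => hz) |>.and hU |>.mono fun z hz => ⟨hz.2, hz.1⟩
  have hVf : ∀ z ∈ V, f z = f z₀ + h z₀ * ψ z ^ n := by
    intro z hz
    have h1 : u z ^ n = h z / h z₀ := Complex.cpow_nat_inv_pow _ hn0
    have h2 := hz.2
    rw [smul_eq_mul] at h2
    simp only [hψdef]
    rw [mul_pow, h1]
    field_simp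
    linear_combination h2
  have himg : ψ '' V ∈ 𝓝 (0 : ℂ) := by rw [← hmap]; exact image_mem_map hVn
  have hζ := Complex.isPrimitiveRoot_exp n hn0
  set ζ := Complex.exp (2 * Real.pi * Complex.I / n)
  have hζ1 : ζ ≠ 1 := hζ.ne_one (by omega)
  have himg2 : (fun w => ζ * w) ⁻¹' (ψ '' V) ∈ 𝓝 (0 : ℂ) := by
    refine (continuous_const_mul ζ).continuousAt ?_
    simpa using himg
  -- Points whose coordinates differ by a primitive n-th root of unity, n ≥ 2, have equal images
  -- under f, against injectivity.
  obtain ⟨w, ⟨⟨z₁, hz₁, hw1⟩, ⟨z₂, hz₂, hw2⟩⟩, hw0⟩ :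
      ∃ w, (w ∈ ψ '' V ∧ ζ * w ∈ ψ '' V) ∧ w ≠ 0 := by
    have h1 : ∀ᶠ w in 𝓝[≠] (0 : ℂ), (w ∈ ψ '' V ∧ ζ * w ∈ ψ '' V) ∧ w ≠ 0 :=
      ((Filter.Eventually.and himg himg2).filter_mono nhdsWithin_le_nhds).and self_mem_nhdsWithin
    exact h1.exists
  have heq : f z₁ = f z₂ := by
    rw [hVf z₁ hz₁, hVf z₂ hz₂, hw1, hw2, mul_pow, hζ.pow_eq_one, one_mul]
  have hz : z₁ = z₂ := hinj hz₁.1 hz₂.1 heq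
  rw [hz, hw2] at hw1
  exact hζ1 (mul_right_cancel₀ hw0 (by rw [hw1, one_mul]))

theorem IsOmega.deriv_ne_zero {E : Set ℂ} {f : ℂ → ℂ} (h : IsOmega E f) {z : ℂ} (hz : z ∈ E) :
    deriv f z ≠ 0 := by
  obtain ⟨U, hU, hinj⟩ := h.locallyUnivalent z hz
  exact deriv_ne_zero_of_injOn (h.analytic z hz) hU hinj

theorem isOmega_of_deriv_ne_zero {E : Set ℂ} {f : ℂ → ℂ} (hf : AnalyticOnNhd ℂ f E)
    (hd : ∀ z ∈ E, deriv f z ≠ 0) (h0 : f 0 = 0) (him : (deriv f 0).im = 0)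
    (hre : 0 < (deriv f 0).re) : IsOmega E f := by
  refine ⟨hf, fun z hz => ?_, h0, him, hre⟩
  have hs := (hf z hz).hasStrictDerivAt
  have := hs.hasStrictFDerivAt_equiv (hd z hz)
  exact ⟨_, this.toOpenPartialHomeomorph f |>.open_source.mem_nhds
    this.mem_toOpenPartialHomeomorph_source, (this.toOpenPartialHomeomorph f).injOn⟩

/-! ### From strong* polynomial solutions to the equation for the coefficients. -/

theorem deriv_polyFun (g : ℝ → ℂ[X]) (t : ℝ) (z : ℂ) :
    deriv (polyFun g t) z = (derivative (g t)).eval z := by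
  unfold polyFun
  exact Polynomial.deriv _

theorem analyticOnNhd_polyFun (g : ℝ → ℂ[X]) (t : ℝ) (E : Set ℂ) :
    AnalyticOnNhd ℂ (polyFun g t) E := fun z _ =>
  (Polynomial.differentiable (g t)).analyticAt z

theorem exists_finset_ball (n : ℕ) : ∃ s : Finset ℂ, s.card = n ∧ ∀ x ∈ s, ‖x‖ < 1 := by
  have hinf : (ball (0 : ℂ) 1).Infinite := by
    refine infinite_of_mem_nhds 0 (ball_mem_nhds _ one_pos)
  obtain ⟨s, hs, hc⟩ := hinf.exists_subset_card_eq n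
  exact ⟨s, hc, fun x hx => by simpa using hs hx⟩

/-- Coefficients of polynomials of bounded degree are linear in the values on a finite set. -/
theorem coeff_eq_sum_eval {s : Finset ℂ} {p : ℂ[X]} (hp : p.natDegree < s.card) (n : ℕ) :
    p.coeff n = ∑ x ∈ s, p.eval x * (Lagrange.basis s id x).coeff n := by
  have h1 := Lagrange.eq_interpolate (s := s) (v := id) (f := p) (fun _ _ _ _ h => h)
    (lt_of_le_of_lt degree_le_natDegree (by exact_mod_cast hp))
  conv_lhs => rw [h1, Lagrange.interpolate_apply, finsetSum_coeff]
  simp [coeff_C_mul]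

/-- The equation is given pointwise in the open disk. By Lagrange interpolation the coefficients are
fixed linear combinations of the values at `k₀ + 1` points there, so they inherit time derivatives.
-/
theorem polySol_of_isStrongStar {k₀ : ℕ} {T : ℝ} {p : ℝ → ℂ[X]} (hk₀ : 0 < k₀)
    (hdeg : ∀ t ∈ Icc 0 T, (p t).natDegree ≤ k₀) (hp : IsStrongStar T (polyFun p)) :
    PolySol k₀ T p := by
  have hne : ∀ t ∈ Icc 0 T, ∀ z : ℂ, ‖z‖ ≤ 1 → (derivative (p t)).eval z ≠ 0 := by
    intro t ht z hz
    rw [← deriv_polyFun]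
    exact (hp.mem_omega t ht).deriv_ne_zero (by simpa using hz)
  refine ⟨hdeg, fun t ht => ?_, fun t ht n => ?_⟩
  · rw [coeff_zero_eq_eval_zero]; exact (hp.mem_omega t ht).map_zero
  obtain ⟨s, hs, hs1⟩ := exists_finset_ball (k₀ + 1)
  obtain ⟨hvd, hv⟩ := velocity_spec (hne t ht)
  have hd : HasDerivWithinAt (fun t => ∑ x ∈ s, (p t).eval x * (Lagrange.basis s id x).coeff (n + 1))
      (∑ x ∈ s, (X * velocity (derivative (p t))).eval x * (Lagrange.basis s id x).coeff (n + 1))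
      (Icc 0 T) t := by
    refine HasDerivWithinAt.fun_sum fun x hx => ?_
    have h1 := hp.equation t ht x (by simpa using hs1 x hx)
    have h2 := hv.eval_div_eq_poissonOp (hne t ht) (hs1 x hx)
    simp only [deriv_polyFun] at h1
    rw [← h2, mul_assoc, mul_div_cancel₀ _ (hne t ht x (hs1 x hx).le)] at h1
    rw [eval_mul, eval_X]
    exact h1.mul_const _
  have hvK : (X * velocity (derivative (p t))).natDegree < s.card := by
    rw [hs]
    refine Nat.lt_succ_of_le (natDegree_mul_le.trans ?_)
    have := natDegree_derivative_lt hk₀ (hdeg t ht)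
    rw [natDegree_X]
    omega
  rw [← coeff_eq_sum_eval hvK, coeff_X_mul] at hd
  refine hd.congr_of_mem (fun t ht => coeff_eq_sum_eval ?_ _) ht
  rw [hs]
  exact Nat.lt_succ_of_le (hdeg t ht)

/-! ### Polynomial solutions as `C¹` curves and as strong* solutions. -/

section

theorem contDiffOn_one_of_hasDerivWithinAt {E : Type*} [NormedAddCommGroup E] [NormedSpace ℝ E]
    {F F' : ℝ → E} {T : ℝ} (hT : 0 < T)
    (hF : ∀ t ∈ Icc 0 T, HasDerivWithinAt F (F' t) (Icc 0 T) t)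
    (hF' : ContinuousOn F' (Icc 0 T)) : ContDiffOn ℝ 1 F (Icc 0 T) := by
  have hu := uniqueDiffOn_Icc hT
  rw [contDiffOn_one_iff_derivWithin hu]
  exact ⟨fun t ht => (hF t ht).differentiableWithinAt,
    hF'.congr fun t ht => (hF t ht).derivWithin (hu t ht)⟩

/-- A polynomial as a continuous function on a closed disk. -/
def polyCM (R : ℝ) (q : ℂ[X]) : C(closedBall (0 : ℂ) R, ℂ) := q.toContinuousMapOn _

@[simp]
theorem polyCM_apply (R : ℝ) (q : ℂ[X]) (z : closedBall (0 : ℂ) R) :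
    polyCM R q z = q.eval (z : ℂ) := rfl

theorem polyCM_sub (R : ℝ) (p q : ℂ[X]) : polyCM R (p - q) = polyCM R p - polyCM R q := by
  ext z; simp

theorem norm_polyCM_le {R : ℝ} (hR : 0 ≤ R) (q : ℂ[X]) : ‖polyCM R q‖ ≤ wnorm R q :=
  (ContinuousMap.norm_le _ (wnorm_nonneg hR q)).2 fun z =>
    norm_eval_le_wnorm q (mem_closedBall_zero_iff.1 z.2)

theorem polyCM_eq_sum {q : ℂ[X]} {K : ℕ} (hq : q.natDegree < K) (R : ℝ) :
    polyCM R q = ∑ n ∈ Finset.range K, q.coeff n • polyCM R (X ^ n) := by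
  ext z
  simp [eval_eq_sum_range' hq]

variable {K : ℕ} {T r μ M : ℝ} {g : ℝ → ℂ[X]}

theorem continuousOn_polyCM {q : ℝ → ℂ[X]} (hq : ∀ t ∈ Icc 0 T, (q t).natDegree < K)
    (hc : ∀ n, ContinuousOn (fun t => (q t).coeff n) (Icc 0 T)) (R : ℝ) :
    ContinuousOn (fun t => polyCM R (q t)) (Icc 0 T) := by
  refine ContinuousOn.congr (f := fun t => ∑ n ∈ Finset.range K,
    (q t).coeff n • polyCM R (X ^ n)) ?_ fun t ht => polyCM_eq_sum (hq t ht) R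
  exact continuousOn_finsetSum _ fun n _ => (hc n).smul continuousOn_const

theorem PolySol.continuousOn_coeff (hg : PolySol K T g) (n : ℕ) :
    ContinuousOn (fun t => (g t).coeff n) (Icc 0 T) := by
  cases n with
  | zero => exact continuousOn_const.congr fun t ht => hg.coeff_zero t ht
  | succ n => exact fun t ht => (hg.hasDeriv t ht n).continuousWithinAt

/-- The time derivative of a polynomial solution. -/
def rate (g : ℝ → ℂ[X]) (t : ℝ) : ℂ[X] := X * velocity (derivative (g t))

theorem natDegree_rate_le (hr : 1 < r) (hμ : 0 < μ) (hK : 0 < K) (hg : PolySol K T g)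
    (hp : ∀ t ∈ Icc 0 T, Pinched r μ M (derivative (g t))) {t : ℝ} (ht : t ∈ Icc 0 T) :
    (rate g t).natDegree ≤ K := by
  refine natDegree_mul_le.trans ?_
  have h1 := natDegree_derivative_lt hK (hg.natDegree_le t ht)
  have h2 := ((hp t ht).velocity_spec hr hμ).1
  rw [natDegree_X]
  omega

theorem PolySol.hasDerivWithinAt_polyCM (hr : 1 < r) (hμ : 0 < μ) (hK : 0 < K)
    (hg : PolySol K T g) (hp : ∀ t ∈ Icc 0 T, Pinched r μ M (derivative (g t))) (R : ℝ) {t : ℝ}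
    (ht : t ∈ Icc 0 T) :
    HasDerivWithinAt (fun t => polyCM R (g t)) (polyCM R (rate g t)) (Icc 0 T) t := by
  have h1 : HasDerivWithinAt (fun t => ∑ n ∈ Finset.range (K + 1),
      (g t).coeff n • polyCM R (X ^ n)) (∑ n ∈ Finset.range (K + 1),
      (rate g t).coeff n • polyCM R (X ^ n)) (Icc 0 T) t := by
    refine HasDerivWithinAt.fun_sum fun n _ => ?_
    refine HasDerivWithinAt.smul_const ?_ _
    cases n with
    | zero =>
      rw [rate, coeff_X_mul_zero]
      exact (hasDerivWithinAt_const t _ 0).congr_of_mem (fun s hs => hg.coeff_zero s hs) ht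
    | succ n =>
      rw [rate, coeff_X_mul]
      exact hg.hasDeriv t ht n
  rw [polyCM_eq_sum (Nat.lt_succ_of_le (natDegree_rate_le hr hμ hK hg hp ht))]
  exact h1.congr_of_mem
    (fun s hs => polyCM_eq_sum (Nat.lt_succ_of_le (hg.natDegree_le s hs)) R) ht

theorem PolySol.continuousOn_polyCM_rate (hr : 1 < r) (hμ : 0 < μ) (hM : 0 < M) (hK : 0 < K)
    (hg : PolySol K T g) (hp : ∀ t ∈ Icc 0 T, Pinched r μ M (derivative (g t))) (R : ℝ) :
    ContinuousOn (fun t => polyCM R (rate g t)) (Icc 0 T) := by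
  refine continuousOn_polyCM
    (fun t ht => Nat.lt_succ_of_le (natDegree_rate_le hr hμ hK hg hp ht)) (fun n => ?_) R
  cases n with
  | zero => simp only [rate, coeff_X_mul_zero]; exact continuousOn_const
  | succ n =>
    simp only [rate, coeff_X_mul]
    rcases lt_or_ge n K with hn | hn
    · obtain ⟨L, hL⟩ := lipschitzOnWith_velocityField (K := K) hr hμ hM hK
      have hx : ContinuousOn (fun t => fun i : Fin K => (g t).coeff (i + 1)) (Icc 0 T) :=
        continuousOn_pi.2 fun i => hg.continuousOn_coeff _
      have he : ∀ t ∈ Icc 0 T, toPoly (fun i : Fin K => (g t).coeff (i + 1)) = g t := fun t ht =>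
        toPoly_coeff (hg.natDegree_le t ht) (hg.coeff_zero t ht)
      have h1 := hL.continuousOn.comp hx fun t ht => by
        simp only [mem_ofPred_eq, he t ht]; exact hp t ht
      refine ((continuous_apply (⟨n, hn⟩ : Fin K)).comp_continuousOn h1).congr fun t ht => ?_
      simp [velocityField, he t ht]
    · refine (continuousOn_const (c := (0 : ℂ))).congr fun t ht => ?_
      have h1 := natDegree_derivative_lt hK (hg.natDegree_le t ht)
      have h2 := ((hp t ht).velocity_spec hr hμ).1
      exact coeff_eq_zero_of_natDegree_lt (by omega)

theorem PolySol.isC1Curve (hT : 0 < T) (hr : 1 < r) (hμ : 0 < μ) (hM : 0 < M) (hK : 0 < K)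
    (hg : PolySol K T g) (hp : ∀ t ∈ Icc 0 T, Pinched r μ M (derivative (g t))) (R : ℝ) :
    IsC1Curve R T (polyFun g) :=
  ⟨fun t => polyCM R (g t), fun _ _ _ => rfl, contDiffOn_one_of_hasDerivWithinAt hT
    (fun _ ht => hg.hasDerivWithinAt_polyCM hr hμ hK hp R ht)
    (hg.continuousOn_polyCM_rate hr hμ hM hK hp R)⟩

theorem PolySol.isC1Closed (hT : 0 < T) (hr : 1 < r) (hμ : 0 < μ) (hM : 0 < M) (hK : 0 < K)
    (hg : PolySol K T g) (hp : ∀ t ∈ Icc 0 T, Pinched r μ M (derivative (g t))) :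
    IsC1Closed r T (polyFun g) :=
  ⟨r + 1, by linarith, fun t _ => analyticOnNhd_polyFun g t _,
    hg.isC1Curve hT hr hμ hM hK hp (r + 1)⟩

theorem coeff_zero_derivative (p : ℂ[X]) : (derivative p).coeff 0 = p.coeff 1 := by
  simp [coeff_derivative]

theorem PolySol.isOmega (hμ : 0 < μ) (hg : PolySol K T g)
    (hp : ∀ t ∈ Icc 0 T, Pinched r μ M (derivative (g t)))
    (him : ∀ t ∈ Icc 0 T, ((g t).coeff 1).im = 0) (hre : ∀ t ∈ Icc 0 T, 0 < ((g t).coeff 1).re)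
    {t : ℝ} (ht : t ∈ Icc 0 T) : IsOmega (closedBall 0 r) (polyFun g t) := by
  have hd : deriv (polyFun g t) 0 = (g t).coeff 1 := by
    rw [deriv_polyFun, ← coeff_zero_eq_eval_zero, coeff_zero_derivative]
  refine isOmega_of_deriv_ne_zero (analyticOnNhd_polyFun g t _) (fun z hz => ?_) ?_ ?_ ?_
  · rw [deriv_polyFun]
    exact (hp t ht).ne_zero hμ (by simpa using hz)
  · rw [polyFun, ← coeff_zero_eq_eval_zero]; exact hg.coeff_zero t ht
  · rw [hd]; exact him t ht
  · rw [hd]; exact hre t ht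

theorem IsOmega.mono {E E' : Set ℂ} {f : ℂ → ℂ} (h : IsOmega E f) (hE : E' ⊆ E) : IsOmega E' f :=
  ⟨fun z hz => h.analytic z (hE hz), fun z hz => h.locallyUnivalent z (hE hz), h.map_zero,
    h.deriv_im, h.deriv_re⟩

theorem rate_eval (hr : 1 < r) (hμ : 0 < μ) {t : ℝ} (hp : Pinched r μ M (derivative (g t)))
    {ξ : ℂ} (hξ : ‖ξ‖ < 1) :
    (rate g t).eval ξ = ξ * deriv (polyFun g t) ξ *
      poissonOp (fun z => 1 / ‖deriv (polyFun g t) z‖ ^ 2) ξ := by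
  simp only [deriv_polyFun]
  rw [← (hp.velocity_spec hr hμ).2.eval_div_eq_poissonOp
    (fun z hz => hp.ne_zero hμ (hz.trans hr.le)) hξ, mul_assoc,
    mul_div_cancel₀ _ (hp.ne_zero hμ (hξ.le.trans hr.le)), rate, eval_mul, eval_X]

/-- Evaluation at a point of a closed disk, as a real-linear map. -/
def evalCLM (R : ℝ) (z : closedBall (0 : ℂ) R) : C(closedBall (0 : ℂ) R, ℂ) →L[ℝ] ℂ :=
  (ContinuousMap.evalCLM ℂ z).restrictScalars ℝ

theorem PolySol.isStrongStar (hT : 0 < T) (hr : 1 < r) (hμ : 0 < μ) (hM : 0 < M) (hK : 0 < K)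
    (hg : PolySol K T g) (hp : ∀ t ∈ Icc 0 T, Pinched r μ M (derivative (g t)))
    (him : ∀ t ∈ Icc 0 T, ((g t).coeff 1).im = 0) (hre : ∀ t ∈ Icc 0 T, 0 < ((g t).coeff 1).re) :
    IsStrongStar T (polyFun g) := by
  have hd : ∀ t ∈ Icc 0 T, ∀ ξ ∈ closedBall (0 : ℂ) 1,
      HasDerivWithinAt (fun t => polyFun g t ξ) ((rate g t).eval ξ) (Icc 0 T) t :=
    fun t ht ξ hξ => (evalCLM 1 ⟨ξ, hξ⟩).hasFDerivAt.comp_hasDerivWithinAt t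
      (hg.hasDerivWithinAt_polyCM hr hμ hK hp 1 ht)
  refine ⟨fun t ht => (hg.isOmega hμ hp him hre ht).mono (closedBall_subset_closedBall hr.le),
    fun ξ hξ => contDiffOn_one_of_hasDerivWithinAt hT (fun t ht => hd t ht ξ hξ) ?_,
    fun t ht ξ hξ => ?_⟩
  · exact (evalCLM 1 ⟨ξ, hξ⟩).continuous.comp_continuousOn
      (hg.continuousOn_polyCM_rate hr hμ hM hK hp 1)
  · rw [← rate_eval hr hμ (hp t ht) (by simpa using hξ)]
    exact hd t ht ξ (ball_subset_closedBall hξ)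

/-- A real first coefficient stays real. -/
theorem PolySol.im_coeff_one (hr : 1 < r) (hμ : 0 < μ)
    (hg : PolySol K T g) (hp : ∀ t ∈ Icc 0 T, Pinched r μ M (derivative (g t)))
    (h0 : ((g 0).coeff 1).im = 0) : ∀ t ∈ Icc 0 T, ((g t).coeff 1).im = 0 := by
  have hd : ∀ t ∈ Icc 0 T, HasDerivWithinAt (fun t => ((g t).coeff 1).im)
      ((velocity (derivative (g t))).coeff 0).im (Icc 0 T) t := fun t ht =>
    Complex.imCLM.hasFDerivAt.comp_hasDerivWithinAt t (hg.hasDeriv t ht 0)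
  -- The coefficient `a₁` satisfies `a₁' = φ a₁`, where `φ = (s/B)(0)` is real and bounded. Its
  -- imaginary part obeys the same linear equation and starts at 0.
  refine eq_zero_of_abs_deriv_le_mul_abs_self_of_eq_zero_right (K := phiBound r μ)
    (fun t ht => (hd t ht).continuousWithinAt)
    (fun t ht => (hd t ⟨ht.1, ht.2.le⟩).mono_of_mem_nhdsWithin (Icc_mem_nhdsGE_of_mem ht)) h0
    fun t ht => ?_
  have ht' : t ∈ Icc 0 T := ⟨ht.1, ht.2.le⟩
  have hr0 : 0 < r := by linarith
  have hv := ((hp t ht').velocity_spec hr hμ).2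
  have hne := (hp t ht').ne_zero hμ (z := 0) (by simpa using hr0.le)
  set φ := (velocity (derivative (g t))).eval 0 / (derivative (g t)).eval 0 with hφ
  have hφn : ‖φ‖ ≤ phiBound r μ := by
    refine (norm_div_le_of_inner hr hμ (hp t ht') hv (ξ := 0) (by simp; positivity)).trans ?_
    rw [phiBound]
    linarith [show 0 < 2 / μ ^ 2 by positivity]
  have he : (velocity (derivative (g t))).coeff 0 = φ * (g t).coeff 1 := by
    rw [← coeff_zero_derivative, coeff_zero_eq_eval_zero, coeff_zero_eq_eval_zero, hφ]
    field_simp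
  have him : φ.im = 0 := hv.im_eq
  rw [he, Complex.mul_im, him, zero_mul, add_zero, norm_mul]
  gcongr
  exact (Complex.abs_re_le_norm φ).trans hφn

/-- The derivative of the reference solution is bounded above and away from zero. -/
theorem PolySol.exists_pinched_minDeriv (hT : 0 ≤ T) (hr : 0 ≤ r) (hK : 0 < K)
    (hg : PolySol K T g) (ho : ∀ t ∈ Icc 0 T, IsOmega (closedBall 0 r) (polyFun g t)) :
    0 < minDeriv r T (polyFun g) ∧ ∃ M, 0 < M ∧
      ∀ t ∈ Icc 0 T, Pinched r (minDeriv r T (polyFun g)) M (derivative (g t)) := by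
  set S := closedBall (0 : ℂ) r ×ˢ Icc (0 : ℝ) T with hS
  have hcomp : IsCompact S := (isCompact_closedBall 0 r).prod isCompact_Icc
  have hcont : ContinuousOn (fun q : ℂ × ℝ => ‖deriv (polyFun g q.2) q.1‖) S := by
    have h1 : ContinuousOn (fun q : ℂ × ℝ => ∑ n ∈ Finset.range K,
        (derivative (g q.2)).coeff n * q.1 ^ n) S := by
      refine continuousOn_finsetSum _ fun n _ => ContinuousOn.mul ?_ (by fun_prop)
      simp only [coeff_derivative]
      refine ContinuousOn.mul ?_ continuousOn_const
      exact (hg.continuousOn_coeff (n + 1)).comp continuousOn_snd fun q hq => hq.2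
    refine (h1.congr fun q hq => ?_).norm
    rw [deriv_polyFun, eval_eq_sum_range' (natDegree_derivative_lt hK (hg.natDegree_le _ hq.2))]
  have hne : S.Nonempty := ⟨(0, 0), by simp [hS, hr, hT]⟩
  obtain ⟨q, hq, hmin⟩ := hcomp.exists_isMinOn hne hcont
  obtain ⟨q', hq', hmax⟩ := hcomp.exists_isMaxOn hne hcont
  have hpos : ∀ q ∈ S, 0 < ‖deriv (polyFun g q.2) q.1‖ := fun q hq =>
    norm_pos_iff.2 ((ho _ hq.2).deriv_ne_zero hq.1)
  have hbdd : BddBelow ((fun q : ℂ × ℝ => ‖deriv (polyFun g q.2) q.1‖) '' S) :=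
    ⟨0, by rintro _ ⟨q, _, rfl⟩; exact norm_nonneg _⟩
  refine ⟨lt_of_lt_of_le (hpos q hq) (le_csInf (hne.image _) ?_), _, hpos q' hq',
    fun t ht z hz => ?_⟩
  · rintro _ ⟨y, hy, rfl⟩
    exact hmin hy
  · have hm : (z, t) ∈ S := ⟨by simpa using hz, ht⟩
    rw [← deriv_polyFun]
    exact ⟨csInf_le hbdd ⟨_, hm, rfl⟩, hmax hm⟩

end

/-! ### Passage to the limit in curves, majorant norms and Poisson integrals. -/

/-- A sequence of curves with summable increments of the derivatives has a `C¹` limit. -/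
theorem exists_limit_curve {E : Type*} [NormedAddCommGroup E] [NormedSpace ℝ E] [CompleteSpace E]
    {G H : ℕ → ℝ → E} {T : ℝ} (hT : 0 ≤ T) {u : ℕ → ℝ} (hu : Summable u)
    (hG : ∀ k, ∀ t ∈ Icc 0 T, HasDerivWithinAt (G k) (H k t) (Icc 0 T) t)
    (hH : ∀ k, ContinuousOn (H k) (Icc 0 T))
    (hHu : ∀ k, ∀ t ∈ Icc 0 T, ‖H (k + 1) t - H k t‖ ≤ u k)
    (h0 : CauchySeq fun k => G k 0) :
    ∃ F F' : ℝ → E, (∀ t ∈ Icc 0 T, HasDerivWithinAt F (F' t) (Icc 0 T) t) ∧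
      ContinuousOn F' (Icc 0 T) ∧ (∀ t ∈ Icc 0 T, Tendsto (fun k => G k t) atTop (𝓝 (F t))) ∧
      ∀ t ∈ Icc 0 T, Tendsto (fun k => H k t) atTop (𝓝 (F' t)) := by
  have hdist : ∀ t ∈ Icc 0 T, ∀ k, dist (H k t) (H (k + 1) t) ≤ u k := fun t ht k => by
    rw [dist_comm, dist_eq_norm]; exact hHu k t ht
  have hlim : ∀ t, ∃ y, t ∈ Icc 0 T → Tendsto (fun k => H k t) atTop (𝓝 y) := by
    intro t
    by_cases ht : t ∈ Icc 0 T
    · obtain ⟨y, hy⟩ := cauchySeq_tendsto_of_complete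
        (cauchySeq_of_dist_le_of_summable u (hdist t ht) hu)
      exact ⟨y, fun _ => hy⟩
    · exact ⟨0, fun h => absurd h ht⟩
  choose F' hF' using hlim
  obtain ⟨a, ha⟩ := cauchySeq_tendsto_of_complete h0
  have htail : Tendsto (fun k => ∑' i, u (k + i)) atTop (𝓝 0) := by
    simpa only [add_comm] using tendsto_sum_nat_add u
  have hbound : ∀ k, ∀ t ∈ Icc 0 T, ‖H k t - F' t‖ ≤ ∑' i, u (k + i) := fun k t ht => by
    rw [← dist_eq_norm]
    exact dist_le_tsum_of_dist_le_of_tendsto u (hdist t ht) hu (hF' t ht) k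
  have hunif : TendstoUniformlyOn H F' atTop (Icc 0 T) := by
    rw [Metric.tendstoUniformlyOn_iff]
    intro ε hε
    filter_upwards [htail.eventually (gt_mem_nhds hε)] with k hk t ht
    rw [dist_comm, dist_eq_norm]
    exact (hbound k t ht).trans_lt hk
  have hc : ContinuousOn F' (Icc 0 T) := hunif.continuousOn (Frequently.of_forall hH)
  -- The time derivatives converge uniformly, so the limit curve is the integral of their limit; the
  -- mean value inequality identifies it with the limit of the `G k`.
  set F : ℝ → E := fun t => a + ∫ τ in (0 : ℝ)..t, F' τ with hF
  have hFd : ∀ t ∈ Icc 0 T, HasDerivWithinAt F (F' t) (Icc 0 T) t := fun t ht =>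
    ODE.hasDerivWithinAt_picard_Icc (f := fun τ (_ : E) => F' τ) (α := fun _ => (0 : E))
      (u := univ) (left_mem_Icc.2 hT) (hc.comp continuousOn_fst fun q hq => hq.1)
      continuousOn_const (fun _ _ => mem_univ _) a ht
  have hF0 : F 0 = a := by simp [hF]
  refine ⟨F, F', hFd, hc, fun t ht => ?_, fun t ht => hF' t ht⟩
  have hmv : ∀ k, ‖(G k t - F t) - (G k 0 - F 0)‖ ≤ (∑' i, u (k + i)) * ‖t - 0‖ := fun k =>
    Convex.norm_image_sub_le_of_norm_hasDerivWithin_le (f := fun t => G k t - F t)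
      (f' := fun t => H k t - F' t)
      (fun s hs => (hG k s hs).fun_sub (hFd s hs)) (fun s hs => hbound k s hs)
      (convex_Icc 0 T) (left_mem_Icc.2 hT) ht
  have h1 : Tendsto (fun k => (G k t - F t) - (G k 0 - F 0)) atTop (𝓝 0) :=
    squeeze_zero_norm hmv (by simpa using htail.mul_const ‖t - 0‖)
  have h2 := (h1.add (ha.sub_const (F 0))).add_const (F t)
  simpa [hF0] using h2

theorem wnorm_sub_le_sum_Ico {r : ℝ} (hr : 0 ≤ r) {q : ℕ → ℂ[X]} {e : ℕ → ℝ}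
    (h : ∀ k, wnorm r (q (k + 1) - q k) ≤ e k) {k n : ℕ} (hkn : k ≤ n) :
    wnorm r (q n - q k) ≤ ∑ i ∈ Finset.Ico k n, e i := by
  induction n, hkn using Nat.le_induction with
  | base => simp [wnorm]
  | succ n hn ih =>
    rw [Finset.sum_Ico_succ_top hn]
    linarith [wnorm_sub_le hr (q (n + 1)) (q n) (q k), h n]

theorem wnorm_sub_le_tsum {r : ℝ} (hr : 0 ≤ r) {q : ℕ → ℂ[X]} {e : ℕ → ℝ} (he : Summable e)
    (he0 : ∀ k, 0 ≤ e k) (h : ∀ k, wnorm r (q (k + 1) - q k) ≤ e k) {k n : ℕ} (hkn : k ≤ n) :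
    wnorm r (q n - q k) ≤ ∑' i, e (k + i) := by
  refine (wnorm_sub_le_sum_Ico hr h hkn).trans ?_
  rw [Finset.sum_Ico_eq_sum_range]
  exact ((summable_nat_add_iff k).2 he |>.congr fun i => by rw [add_comm]).sum_le_tsum _
    fun i _ => he0 _

theorem iteratedDeriv_polyFun (g : ℝ → ℂ[X]) (t : ℝ) (j : ℕ) :
    iteratedDeriv j (polyFun g t) = fun z => (derivative^[j] (g t)).eval z := by
  induction j with
  | zero => simp; rfl
  | succ j ih =>
    rw [iteratedDeriv_succ, ih, Function.iterate_succ_apply']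
    funext z
    exact Polynomial.deriv _

theorem coeffAt_eval (p : ℂ[X]) (i : ℕ) : coeffAt (fun z => p.eval z) i = p.coeff i := by
  have h := congrFun (iteratedDeriv_polyFun (fun _ => p) 0 i) 0
  have hf : (i.factorial : ℂ) ≠ 0 := by exact_mod_cast i.factorial_ne_zero
  rw [← coeff_zero_eq_eval_zero, coeff_iterate_derivative, zero_add, Nat.descFactorial_self,
    nsmul_eq_mul] at h
  rw [coeffAt, eq_comm, eq_div_iff hf, mul_comm, ← h]
  rfl

theorem mNorm_eval {r : ℝ} (hr : 0 ≤ r) (p : ℂ[X]) :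
    mNorm r (fun z => p.eval z) = ENNReal.ofReal (wnorm r p) := by
  rw [mNorm, wnorm_eq_sum (Nat.lt_succ_self _), ENNReal.ofReal_sum_of_nonneg
    (fun n _ => by positivity)]
  simp only [coeffAt_eval]
  refine tsum_eq_sum fun n hn => ?_
  rw [coeff_eq_zero_of_natDegree_lt (by simpa using hn)]
  simp

/-- Lower semicontinuity: each finite partial sum passes to the limit. -/
theorem mNorm_le_of_tendsto {r : ℝ} {φ : ℕ → ℂ → ℂ} {ψ : ℂ → ℂ} {B : ENNReal}
    (h : ∀ i, Tendsto (fun k => coeffAt (φ k) i) atTop (𝓝 (coeffAt ψ i)))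
    (hB : ∀ᶠ k in atTop, mNorm r (φ k) ≤ B) : mNorm r ψ ≤ B := by
  rw [mNorm, ENNReal.tsum_eq_iSup_sum]
  refine iSup_le fun s => ?_
  have h1 : Tendsto (fun k => ∑ i ∈ s, ENNReal.ofReal (‖coeffAt (φ k) i‖ * r ^ i)) atTop
      (𝓝 (∑ i ∈ s, ENNReal.ofReal (‖coeffAt ψ i‖ * r ^ i))) :=
    tendsto_finsetSum _ fun i _ => ENNReal.tendsto_ofReal ((h i).norm.mul_const _)
  exact le_of_tendsto h1 (hB.mono fun k hk => (ENNReal.sum_le_tsum s).trans hk)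

theorem tendstoLocallyUniformlyOn_iteratedDeriv {φ : ℕ → ℂ → ℂ} {ψ : ℂ → ℂ} {U : Set ℂ}
    (hU : IsOpen U) (h : TendstoLocallyUniformlyOn φ ψ atTop U)
    (hφ : ∀ k, Differentiable ℂ (φ k)) (j : ℕ) :
    TendstoLocallyUniformlyOn (fun k => iteratedDeriv j (φ k)) (iteratedDeriv j ψ) atTop U := by
  induction j with
  | zero => simpa using h
  | succ j ih =>
    simp only [iteratedDeriv_succ]
    refine ih.deriv (Eventually.of_forall fun k => ?_) hU
    have : ContDiff ℂ (j + 1) (φ k) := (hφ k).contDiff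
    exact (this.differentiable_iteratedDeriv j (by exact_mod_cast Nat.lt_succ_self j)).differentiableOn

theorem tendsto_coeffAt {φ : ℕ → ℂ → ℂ} {ψ : ℂ → ℂ} {r : ℝ} (hr : 0 < r)
    (h : TendstoLocallyUniformlyOn φ ψ atTop (ball 0 r)) (hφ : ∀ k, Differentiable ℂ (φ k))
    (i : ℕ) : Tendsto (fun k => coeffAt (φ k) i) atTop (𝓝 (coeffAt ψ i)) :=
  ((tendstoLocallyUniformlyOn_iteratedDeriv isOpen_ball h hφ i).tendsto_at
    (mem_ball_self hr)).div_const _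

/-- `ENNReal.ofReal` truncates a negative bound to 0, hence the maximum. -/
theorem summable_of_tsum_ofReal_le {a : ℕ → ℝ} {B : ℝ} (ha : ∀ j, 0 ≤ a j)
    (h : ∑' j, ENNReal.ofReal (a j) ≤ ENNReal.ofReal B) :
    Summable a ∧ ∑' j, a j ≤ max B 0 := by
  have hs : Summable a := by
    have h1 : ∑' j, ENNReal.ofReal (a j) ≠ ⊤ := ne_top_of_le_ne_top ENNReal.ofReal_ne_top h
    have := ENNReal.summable_toReal h1
    simpa only [ENNReal.toReal_ofReal (ha _)] using this
  refine ⟨hs, ?_⟩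
  rw [← ENNReal.ofReal_tsum_of_nonneg ha hs] at h
  have h2 := ENNReal.toReal_mono ENNReal.ofReal_ne_top h
  rw [ENNReal.toReal_ofReal (tsum_nonneg ha)] at h2
  refine h2.trans ?_
  rw [ENNReal.toReal_ofReal']

theorem tendsto_poissonOp {h : ℕ → ℂ → ℝ} {h' : ℂ → ℝ} (hc : ∀ k, ContinuousOn (h k) (sphere 0 1))
    (hu : TendstoUniformlyOn h h' atTop (sphere 0 1)) {ξ : ℂ} (hξ : ‖ξ‖ < 1) :
    Tendsto (fun k => poissonOp (h k) ξ) atTop (𝓝 (poissonOp h' ξ)) := by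
  have hc' : ContinuousOn h' (sphere 0 1) := hu.continuousOn (Frequently.of_forall hc)
  rw [Metric.tendsto_nhds]
  intro ε hε
  set q := (1 + ‖ξ‖) / (1 - ‖ξ‖) with hq
  have hq0 : 0 < q := div_pos (by positivity) (by linarith)
  filter_upwards [Metric.tendstoUniformlyOn_iff.1 hu (ε / (2 * q)) (by positivity)] with k hk
  rw [dist_eq_norm, ← poissonOp_sub (hc k) hc' hξ]
  refine (norm_poissonOp_le (A := ε / (2 * q)) (fun z hz => ?_) hξ).trans_lt ?_
  · have := hk z (by simpa using hz)
    rw [dist_comm, Real.dist_eq] at this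
    exact this.le
  · rw [← hq]
    have : ε / (2 * q) * q = ε / 2 := by field_simp
    rw [this]; linarith

/-! ### Construction of the perturbed solution. -/

section

theorem stepBound_zero_le {k₀ : ℕ} {ρ : ℝ} (hρ : 0 ≤ ρ) {k : ℕ} (hk : 0 < k) (b : ℂ) :
    stepBound k₀ ρ 0 k b ≤ stepBound' k₀ ρ k b := by
  have : (1 : ℝ) ≤ k := by exact_mod_cast hk
  rw [stepBound, stepBound', pow_zero, pow_zero, mul_one]
  gcongr

theorem wnorm_X_mul_le (r : ℝ) (p : ℂ[X]) : wnorm r (X * p) ≤ r * wnorm r p := by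
  have h : (X * p).natDegree < p.natDegree + 1 + 1 := by
    have := natDegree_mul_le (p := (X : ℂ[X])) (q := p)
    rw [natDegree_X] at this
    omega
  rw [wnorm_eq_sum h, wnorm_eq_sum (Nat.lt_succ_self _), Finset.sum_range_succ', Finset.mul_sum]
  simp only [coeff_X_mul, coeff_X_mul_zero, norm_zero, zero_mul, add_zero]
  exact (Finset.sum_congr rfl fun n _ => by ring).le

theorem norm_coeff_zero_le_wnorm {r : ℝ} (hr : 0 ≤ r) (p : ℂ[X]) : ‖p.coeff 0‖ ≤ wnorm r p := by
  rw [coeff_zero_eq_eval_zero]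
  exact norm_eval_le_wnorm p (by simpa using hr)

/-- Extension by zero of a function on a closed disk. -/
def extendZero (r : ℝ) (F : C(closedBall (0 : ℂ) r, ℂ)) (z : ℂ) : ℂ :=
  open Classical in if h : z ∈ closedBall (0 : ℂ) r then F ⟨z, h⟩ else 0

theorem extendZero_of_mem {r : ℝ} (F : C(closedBall (0 : ℂ) r, ℂ)) {z : ℂ}
    (h : z ∈ closedBall (0 : ℂ) r) : extendZero r F z = F ⟨z, h⟩ := dif_pos h

theorem tendstoUniformlyOn_extendZero {r : ℝ} {q : ℕ → ℂ[X]} {F : C(closedBall (0 : ℂ) r, ℂ)}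
    (h : Tendsto (fun k => polyCM r (q k)) atTop (𝓝 F)) :
    TendstoUniformlyOn (fun k z => (q k).eval z) (extendZero r F) atTop (closedBall 0 r) := by
  rw [Metric.tendstoUniformlyOn_iff]
  intro ε hε
  filter_upwards [Metric.tendsto_nhds.1 h ε hε] with k hk z hz
  rw [extendZero_of_mem F hz, dist_comm]
  exact (ContinuousMap.dist_apply_le_dist (f := polyCM r (q k)) (g := F) ⟨z, hz⟩).trans_lt hk

/-- Used to turn uniform convergence of the derivatives on the unit circle into uniform convergence
of the Poisson data. -/
theorem abs_inv_sq_sub_le {μ M a b : ℝ} (hμ : 0 < μ) (ha : μ ≤ a) (hb : μ ≤ b) (ha' : a ≤ M)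
    (hb' : b ≤ M) : |1 / a ^ 2 - 1 / b ^ 2| ≤ 2 * M / μ ^ 4 * |a - b| := by
  have ha0 : 0 < a := hμ.trans_le ha
  have hb0 : 0 < b := hμ.trans_le hb
  have h1 : 1 / a ^ 2 - 1 / b ^ 2 = -((a + b) / (a ^ 2 * b ^ 2)) * (a - b) := by
    field_simp; ring
  have h2 : (a + b) / (a ^ 2 * b ^ 2) ≤ 2 * M / μ ^ 4 := by
    have : μ ^ 4 ≤ a ^ 2 * b ^ 2 := by
      calc μ ^ 4 = μ ^ 2 * μ ^ 2 := by ring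
        _ ≤ _ := by gcongr
    have h3 : a + b ≤ 2 * M := by linarith
    have h4 : 0 ≤ 2 * M := by linarith
    gcongr
  rw [h1, abs_mul, abs_neg, abs_of_nonneg (by positivity : 0 ≤ (a + b) / (a ^ 2 * b ^ 2))]
  gcongr

variable {k₀ : ℕ} {T r ρ m M A A' : ℝ} {p : ℝ → ℂ[X]} {b : ℕ → ℂ}

/-- Summability of the costs `stepBound'` does everything: it keeps all approximations pinched with
the same constants, makes them converge in `C¹`, and bounds the distance to the reference solution
by the total cost. -/
theorem exists_perturbed_solution (hr : 1 < r) (hρ : r < ρ) (hA' : A' < m) (hAA' : A < A')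
    (hM : 0 < M) (hk₀ : 0 < k₀) (hT : 0 < T)
    (hTle : T ≤ 1 / (lipConst r (m - A') (M + A') * k₀) * Real.log (ρ / r))
    (hp : PolySol k₀ T p) (hpp : ∀ t ∈ Icc 0 T, Pinched r m M (derivative (p t)))
    (hpim : ∀ t ∈ Icc 0 T, ((p t).coeff 1).im = 0) (hpre : ∀ t ∈ Icc 0 T, 0 < ((p t).coeff 1).re)
    (hbs : Summable fun i => stepBound' k₀ ρ (i + 1) (b (i + 1)))
    (hbA : ∑' i, stepBound' k₀ ρ (i + 1) (b (i + 1)) ≤ A) (hb1 : (b 1).im = 0) {f₀ : ℂ → ℂ}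
    (hf₀ : ∀ z ∈ closedBall (0 : ℂ) r, Tendsto
      (fun k => (p 0 + ∑ i ∈ Finset.Icc 1 k, C (b i) * X ^ i).eval z) atTop (𝓝 (f₀ z))) :
    ∃ f : ℝ → ℂ → ℂ,
      (∀ z ∈ closedBall (0 : ℂ) r, f 0 z = f₀ z) ∧
      IsStrongStar T f ∧ IsC1Open r T f ∧ (∀ t ∈ Icc 0 T, IsOmega (ball 0 r) (f t)) ∧
      (∀ t ∈ Icc 0 T, mNorm r (fun z => deriv (f t) z - deriv (polyFun p t) z) ≤
        ENNReal.ofReal A) ∧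
      (∃ g : ℕ → ℝ → ℂ[X],
        (∀ k, g k 0 = p 0 + ∑ i ∈ Finset.Icc 1 k, C (b i) * X ^ i) ∧
        (∀ k, IsStrongStar T (polyFun (g k))) ∧ (∀ k, IsC1Closed r T (polyFun (g k))) ∧
        (∀ k, ∀ t ∈ Icc 0 T, IsOmega (closedBall 0 r) (polyFun (g k) t)) ∧
        Tendsto (fun k => ⨆ t ∈ Icc 0 T,
            mNorm r (fun z => deriv (polyFun (g k) t) z - deriv (f t) z)) atTop (𝓝 0)) ∧
      (∀ j, Summable (fun i => stepBound k₀ ρ j (i + 1) (b (i + 1))) → ∀ t ∈ Icc 0 T,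
        mNorm r (fun z => iteratedDeriv j (f t) z - iteratedDeriv j (polyFun p t) z) ≤
          ENNReal.ofReal (∑' i, stepBound k₀ ρ j (i + 1) (b (i + 1)))) := by
  have hr0 : 0 < r := by linarith
  have hρ0 : 0 < ρ := by linarith
  set e : ℕ → ℝ := fun i => stepBound' k₀ ρ (i + 1) (b (i + 1)) with he
  have he0 : ∀ i, 0 ≤ e i := fun i => stepBound'_nonneg hρ0.le _ _
  have hA0 : 0 ≤ A := (tsum_nonneg he0).trans hbA
  have hsumA : ∀ k, ∑ i ∈ Finset.Icc 1 k, stepBound' k₀ ρ i (b i) ≤ A := by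
    intro k
    have h1 : ∑ i ∈ Finset.Icc 1 k, stepBound' k₀ ρ i (b i) = ∑ i ∈ Finset.range k, e i := by
      rw [Finset.range_eq_Ico, Finset.sum_Ico_add' (fun i => stepBound' k₀ ρ i (b i)) 0 k 1]
      rfl
    rw [h1]
    exact (hbs.sum_le_tsum _ fun i _ => he0 i).trans hbA
  set μ := m - A' with hμdef
  have hμ : 0 < μ := by linarith
  have hM' : 0 < M + A' := by linarith
  set c := lipConst r μ (M + A') with hcdef
  have hc : 0 < c := lipConst_pos hr hμ hM'
  obtain ⟨g, hg0, hg⟩ := exists_polySol_seq hr hρ hA' hAA' hM' hk₀ hT.le hTle hp hpp hsumA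
  have hgA : ∀ k, ∀ t ∈ Icc 0 T, wnorm r (derivative (g k t) - derivative (p t)) ≤ A :=
    fun k t ht => ((hg k).2.2 t ht).trans (hsumA k)
  have hgp : ∀ k, ∀ t ∈ Icc 0 T, Pinched r μ (M + A') (derivative (g k t)) := fun k t ht =>
    (hpp t ht).of_wnorm_sub_le ((hgA k t ht).trans hAA'.le)
  have hKpos : ∀ k, 0 < max k k₀ := fun k => hk₀.trans_le (le_max_right _ _)
  have hgs : ∀ k, PolySol (max k k₀) T (g k) := fun k => (hg k).1
  have h0T : (0 : ℝ) ∈ Icc 0 T := left_mem_Icc.2 hT.le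
  -- the first coefficient
  have hgim : ∀ k, ∀ t ∈ Icc 0 T, ((g k t).coeff 1).im = 0 := by
    intro k
    refine (hgs k).im_coeff_one hr hμ (hgp k) ?_
    rw [(hg k).2.1, coeff_add, Complex.add_im, hpim 0 h0T, zero_add, finsetSum_coeff,
      Complex.im_sum]
    refine Finset.sum_eq_zero fun i _ => ?_
    rw [coeff_C_mul_X_pow]
    split_ifs with h
    · rw [← h, hb1]
    · rfl
  have hp1 : ∀ t ∈ Icc 0 T, m ≤ ((p t).coeff 1).re := by
    intro t ht
    have h1 := (hpp t ht 0 (by simpa using hr0.le)).1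
    rw [← coeff_zero_eq_eval_zero, coeff_zero_derivative] at h1
    have h2 : (p t).coeff 1 = (((p t).coeff 1).re : ℂ) :=
      Complex.ext (by simp) (by simpa using hpim t ht)
    rw [h2, Complex.norm_real, Real.norm_of_nonneg (hpre t ht).le] at h1
    exact h1
  -- The reference coefficient is positive real, so it equals its modulus and is at least m. The
  -- margin `m - A > 0` is uniform in k, so strict positivity survives in the limit.
  have hgre' : ∀ k, ∀ t ∈ Icc 0 T, m - A ≤ ((g k t).coeff 1).re := by
    intro k t ht
    have h1 := (norm_coeff_zero_le_wnorm hr0.le _).trans (hgA k t ht)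
    rw [coeff_sub, coeff_zero_derivative, coeff_zero_derivative] at h1
    have h2 := (abs_le.1 ((Complex.abs_re_le_norm _).trans h1)).1
    rw [Complex.sub_re] at h2
    linarith [hp1 t ht]
  have hgre : ∀ k, ∀ t ∈ Icc 0 T, 0 < ((g k t).coeff 1).re := fun k t ht =>
    lt_of_lt_of_le (by linarith) (hgre' k t ht)
  -- increments
  have hstep := fun (k : ℕ) (t : ℝ) (ht : t ∈ Icc 0 T) =>
    wnorm_step_le (b := b (k + 1)) hr hρ hμ hM' hk₀ hTle (Nat.succ_pos k) (hgs (k + 1))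
      ((hgs k).mono le_rfl (max_le_max (Nat.le_succ k) le_rfl)) (hgp (k + 1)) (hgp k)
      (by rw [(hg (k + 1)).2.1, (hg k).2.1, Finset.sum_Icc_succ_top (by omega),
        add_sub_add_left_eq_sub, add_sub_cancel_left]) ht
  have hstep0 : ∀ k, ∀ t ∈ Icc 0 T, wnorm r (g (k + 1) t - g k t) ≤ e k := fun k t ht => by
    have := (hstep k t ht).2.2 0
    exact this.trans (stepBound_zero_le hρ0.le (Nat.succ_pos k) _)
  have hstep1 : ∀ t ∈ Icc 0 T, ∀ k, wnorm r (derivative (g (k + 1) t) - derivative (g k t)) ≤ e k :=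
    fun t ht k => (hstep k t ht).1
  have hrate : ∀ k, ∀ t ∈ Icc 0 T,
      ‖polyCM r (rate (g (k + 1)) t) - polyCM r (rate (g k) t)‖ ≤ r * (c * e k) := by
    intro k t ht
    rw [← polyCM_sub, rate, rate, ← mul_sub]
    refine (norm_polyCM_le hr0.le _).trans ((wnorm_X_mul_le r _).trans ?_)
    have := (hstep k t ht).2.1
    gcongr
  obtain ⟨F, F', hF, hF'c, hFlim, hF'lim⟩ := exists_limit_curve
    (G := fun k t => polyCM r (g k t)) (H := fun k t => polyCM r (rate (g k) t)) hT.le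
    ((hbs.mul_left c).mul_left r)
    (fun k t ht => (hgs k).hasDerivWithinAt_polyCM hr hμ (hKpos k) (hgp k) r ht)
    (fun k => (hgs k).continuousOn_polyCM_rate hr hμ hM' (hKpos k) (hgp k) r) hrate
    (cauchySeq_of_dist_le_of_summable e (fun k => by
      rw [dist_comm, dist_eq_norm, ← polyCM_sub]
      exact (norm_polyCM_le hr0.le _).trans (hstep0 k 0 h0T)) hbs)
  set f : ℝ → ℂ → ℂ := fun t => extendZero r (F t) with hf
  have hunif : ∀ t ∈ Icc 0 T, TendstoUniformlyOn (fun k => polyFun (g k) t) (f t) atTop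
      (closedBall 0 r) := fun t ht => tendstoUniformlyOn_extendZero (hFlim t ht)
  have hloc : ∀ t ∈ Icc 0 T, TendstoLocallyUniformlyOn (fun k => polyFun (g k) t) (f t) atTop
      (ball 0 r) := fun t ht =>
    ((hunif t ht).mono ball_subset_closedBall).tendstoLocallyUniformlyOn
  have hdiffp : ∀ (q : ℝ → ℂ[X]) (t : ℝ), Differentiable ℂ (polyFun q t) := fun q t =>
    (q t).differentiable
  have hfdiff : ∀ t ∈ Icc 0 T, DifferentiableOn ℂ (f t) (ball 0 r) := fun t ht =>
    (hloc t ht).differentiableOn (Eventually.of_forall fun k => (hdiffp _ _).differentiableOn)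
      isOpen_ball
  have hfan : ∀ t ∈ Icc 0 T, AnalyticOnNhd ℂ (f t) (ball 0 r) := fun t ht =>
    (hfdiff t ht).analyticOnNhd isOpen_ball
  have hlocd : ∀ t ∈ Icc 0 T, TendstoLocallyUniformlyOn (fun k => deriv (polyFun (g k) t))
      (deriv (f t)) atTop (ball 0 r) := fun t ht =>
    (hloc t ht).deriv (Eventually.of_forall fun k => (hdiffp _ _).differentiableOn) isOpen_ball
  have hdlim : ∀ t ∈ Icc 0 T, ∀ z ∈ ball (0 : ℂ) r,
      Tendsto (fun k => (derivative (g k t)).eval z) atTop (𝓝 (deriv (f t) z)) :=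
    fun t ht z hz => by simpa only [deriv_polyFun] using (hlocd t ht).tendsto_at hz
  -- the limit is pinched
  have hfp : ∀ t ∈ Icc 0 T, ∀ z ∈ ball (0 : ℂ) r,
      μ ≤ ‖deriv (f t) z‖ ∧ ‖deriv (f t) z‖ ≤ M + A' := fun t ht z hz => by
    have hz' : ‖z‖ ≤ r := by simpa using (ball_subset_closedBall hz)
    exact ⟨ge_of_tendsto (hdlim t ht z hz).norm (Eventually.of_forall fun k => (hgp k t ht z hz').1),
      le_of_tendsto (hdlim t ht z hz).norm (Eventually.of_forall fun k => (hgp k t ht z hz').2)⟩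
  have hf0 : ∀ t ∈ Icc 0 T, f t 0 = 0 := by
    intro t ht
    refine tendsto_nhds_unique ((hloc t ht).tendsto_at (mem_ball_self hr0)) ?_
    refine tendsto_const_nhds.congr fun k => ?_
    rw [polyFun, ← coeff_zero_eq_eval_zero, (hgs k).coeff_zero t ht]
  have hd0 : ∀ t ∈ Icc 0 T, Tendsto (fun k => (g k t).coeff 1) atTop (𝓝 (deriv (f t) 0)) := by
    intro t ht
    have := hdlim t ht 0 (mem_ball_self hr0)
    simpa only [← coeff_zero_eq_eval_zero, coeff_zero_derivative] using this
  have hfo : ∀ t ∈ Icc 0 T, IsOmega (ball 0 r) (f t) := by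
    intro t ht
    refine isOmega_of_deriv_ne_zero (hfan t ht)
      (fun z hz => norm_pos_iff.1 (hμ.trans_le (hfp t ht z hz).1)) (hf0 t ht) ?_ ?_
    · refine tendsto_nhds_unique ((Complex.continuous_im.tendsto _).comp (hd0 t ht)) ?_
      exact tendsto_const_nhds.congr fun k => (hgim k t ht).symm
    · refine lt_of_lt_of_le (by linarith : 0 < m - A)
        (ge_of_tendsto ((Complex.continuous_re.tendsto _).comp (hd0 t ht))
          (Eventually.of_forall fun k => hgre' k t ht))
  have hsub1 : closedBall (0 : ℂ) 1 ⊆ ball 0 r := closedBall_subset_ball hr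
  have hmemr : ∀ ξ ∈ closedBall (0 : ℂ) 1, ξ ∈ closedBall (0 : ℂ) r := fun ξ hξ =>
    ball_subset_closedBall (hsub1 hξ)
  have hfderiv : ∀ t ∈ Icc 0 T, ∀ ξ (hξ : ξ ∈ closedBall (0 : ℂ) 1),
      HasDerivWithinAt (fun t => f t ξ) (F' t ⟨ξ, hmemr ξ hξ⟩) (Icc 0 T) t := by
    intro t ht ξ hξ
    have h1 := (evalCLM r ⟨ξ, hmemr ξ hξ⟩).hasFDerivAt.comp_hasDerivWithinAt t (hF t ht)
    exact h1.congr_of_mem (fun s _ => extendZero_of_mem _ _) ht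
  -- the equation
  have heq : ∀ t ∈ Icc 0 T, ∀ ξ (hξ : ξ ∈ ball (0 : ℂ) 1),
      F' t ⟨ξ, hmemr ξ (ball_subset_closedBall hξ)⟩ =
        ξ * deriv (f t) ξ * poissonOp (fun z => 1 / ‖deriv (f t) z‖ ^ 2) ξ := by
    intro t ht ξ hξ
    have hξ1 : ‖ξ‖ < 1 := by simpa using hξ
    have hξr : ξ ∈ ball (0 : ℂ) r := hsub1 (ball_subset_closedBall hξ)
    have l1 : Tendsto (fun k => (rate (g k) t).eval ξ) atTop
        (𝓝 (F' t ⟨ξ, hmemr ξ (ball_subset_closedBall hξ)⟩)) :=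
      ((evalCLM r ⟨ξ, hmemr ξ (ball_subset_closedBall hξ)⟩).continuous.tendsto _).comp
        (hF'lim t ht)
    refine tendsto_nhds_unique l1 ?_
    simp only [fun k => rate_eval hr hμ (hgp k t ht) hξ1]
    have hcs : ∀ z ∈ sphere (0 : ℂ) 1, z ∈ ball (0 : ℂ) r := fun z hz =>
      hsub1 (sphere_subset_closedBall hz)
    refine (((hlocd t ht).tendsto_at hξr).const_mul ξ).mul
      (tendsto_poissonOp (fun k => ?_) ?_ hξ1)
    · simp only [deriv_polyFun]
      refine ContinuousOn.div continuousOn_const (by fun_prop) fun z hz => ?_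
      have := (hgp k t ht).ne_zero hμ (ball_subset_closedBall (hcs z hz) |> mem_closedBall_zero_iff.1)
      positivity
    · have hu : TendstoUniformlyOn (fun k => deriv (polyFun (g k) t)) (deriv (f t)) atTop
          (sphere 0 1) :=
        (tendstoLocallyUniformlyOn_iff_tendstoUniformlyOn_of_compact (isCompact_sphere 0 1)).1
          ((hlocd t ht).mono hcs)
      rw [Metric.tendstoUniformlyOn_iff] at hu ⊢
      intro ε hε
      set q := 2 * (M + A') / μ ^ 4 with hq
      have hq0 : 0 < q := by positivity
      filter_upwards [hu (ε / q) (by positivity)] with k hk z hz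
      have hz' : ‖z‖ ≤ r := mem_closedBall_zero_iff.1 (ball_subset_closedBall (hcs z hz))
      have h1 := hgp k t ht z hz'
      have h2 := hfp t ht z (hcs z hz)
      rw [← deriv_polyFun] at h1
      rw [Real.dist_eq]
      refine (abs_inv_sq_sub_le hμ h2.1 h1.1 h2.2 h1.2).trans_lt ?_
      have h3 := (abs_norm_sub_norm_le (deriv (f t) z) (deriv (polyFun (g k) t) z)).trans_lt
        (by simpa only [dist_eq_norm] using hk z hz)
      rw [lt_div_iff₀ hq0] at h3
      rw [← hq, mul_comm]
      exact h3
  -- estimates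
  have hmn : ∀ (j : ℕ) (e' : ℕ → ℝ), Summable e' → (∀ i, 0 ≤ e' i) →
      (∀ t ∈ Icc 0 T, ∀ i, wnorm r (derivative^[j] (g (i + 1) t) - derivative^[j] (g i t)) ≤ e' i) →
      ∀ k, ∀ t ∈ Icc 0 T, mNorm r (fun z => iteratedDeriv j (f t) z -
        iteratedDeriv j (polyFun (g k) t) z) ≤ ENNReal.ofReal (∑' i, e' (k + i)) := by
    intro j e' hs hn hle k t ht
    -- By Weierstrass, Taylor coefficients converge. Thus `f - g_k` inherits the bound on `g_n -
    -- g_k`, namely the tail of the increments; k = 0 compares with p, and k → ∞ gives convergence.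
    have hlj := tendstoLocallyUniformlyOn_iteratedDeriv isOpen_ball (hloc t ht)
      (fun k => hdiffp _ _) j
    refine mNorm_le_of_tendsto (φ := fun n z => iteratedDeriv j (polyFun (g n) t) z -
      iteratedDeriv j (polyFun (g k) t) z) (fun i => tendsto_coeffAt hr0 ?_ (fun n => ?_) i) ?_
    · rw [Metric.tendstoLocallyUniformlyOn_iff] at hlj ⊢
      simpa only [dist_sub_right] using hlj
    · simp only [iteratedDeriv_polyFun]
      fun_prop
    · filter_upwards [eventually_ge_atTop k] with n hn'
      simp only [iteratedDeriv_polyFun, ← eval_sub]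
      rw [mNorm_eval hr0.le]
      exact ENNReal.ofReal_le_ofReal
        (wnorm_sub_le_tsum (q := fun i => derivative^[j] (g i t)) hr0.le hs hn (hle t ht) hn')
  have hm1 := hmn 1 e hbs he0 hstep1
  simp only [iteratedDeriv_one] at hm1
  refine ⟨f, fun z hz => ?_, ⟨fun t ht => (hfo t ht).mono hsub1, fun ξ hξ => ?_,
    fun t ht ξ hξ => ?_⟩, ⟨hfan, F, fun t _ z => ?_, ?_⟩, hfo, fun t ht => ?_,
    ⟨g, fun k => (hg k).2.1, fun k => ?_, fun k => ?_, fun k t ht => ?_, ?_⟩, fun j hj t ht => ?_⟩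
  · refine tendsto_nhds_unique ((hunif 0 h0T).tendsto_at hz) ((hf₀ z hz).congr fun k => ?_)
    rw [polyFun, (hg k).2.1]
  · exact contDiffOn_one_of_hasDerivWithinAt hT (fun t ht => hfderiv t ht ξ hξ)
      ((evalCLM r ⟨ξ, hmemr ξ hξ⟩).continuous.comp_continuousOn hF'c)
  · rw [← heq t ht ξ hξ]
    exact hfderiv t ht ξ (ball_subset_closedBall hξ)
  · exact (extendZero_of_mem _ z.2).symm
  · exact contDiffOn_one_of_hasDerivWithinAt hT hF hF'c
  · have := hm1 0 t ht
    simp only [hg0, zero_add] at this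
    exact this.trans (ENNReal.ofReal_le_ofReal hbA)
  · exact (hgs k).isStrongStar hT hr hμ hM' (hKpos k) (hgp k) (hgim k) (hgre k)
  · exact (hgs k).isC1Closed hT hr hμ hM' (hKpos k) (hgp k)
  · exact (hgs k).isOmega hμ (hgp k) (hgim k) (hgre k) ht
  · have htail : Tendsto (fun k => ENNReal.ofReal (∑' i, e (k + i))) atTop (𝓝 0) := by
      have : Tendsto (fun k => ∑' i, e (k + i)) atTop (𝓝 0) := by
        simpa only [add_comm] using tendsto_sum_nat_add e
      simpa using ENNReal.tendsto_ofReal this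
    refine tendsto_of_tendsto_of_tendsto_of_le_of_le tendsto_const_nhds htail
      (fun _ => zero_le) fun k => iSup₂_le fun t ht => ?_
    refine le_trans (le_of_eq ?_) (hm1 k t ht)
    simp only [mNorm]
    refine tsum_congr fun i => ?_
    have : coeffAt (fun z => deriv (polyFun (g k) t) z - deriv (f t) z) i =
        -coeffAt (fun z => deriv (f t) z - deriv (polyFun (g k) t) z) i := by
      rw [coeffAt, coeffAt, ← neg_div, ← iteratedDeriv_fun_neg]
      simp only [neg_sub]
    rw [this, norm_neg]
  · have := hmn j (fun i => stepBound k₀ ρ j (i + 1) (b (i + 1))) hj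
      (fun i => stepBound_nonneg hρ0.le _ _ _)
      (fun t ht i => by rw [← iterate_derivative_sub]; exact (hstep i t ht).2.2 j) 0 t ht
    simpa only [hg0, zero_add] using this

end

end HeleShaw

end

/-! ### The theorem: choice of constants and translation of the norms. -/

theorem mainTheorem2 :
    ∃ c : ℕ → ℕ → ℝ, (∀ j k, 0 < c j k) ∧
    ∀ (k₀ : ℕ) (r t₁ l : ℝ) (p : ℝ → ℂ[X]),
      1 < r → 0 < t₁ → l < 1 →
      (∀ t ∈ Icc 0 t₁, (p t).natDegree = k₀) →
      HeleShaw.IsC1Closed r t₁ (HeleShaw.polyFun p) →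
      (∀ t ∈ Icc 0 t₁, HeleShaw.IsOmega (closedBall 0 r) (HeleShaw.polyFun p t)) →
      HeleShaw.IsStrongStar t₁ (HeleShaw.polyFun p) →
    ∃ C : ℝ, 0 < C ∧
    ∀ (ρ : ℝ) (f₀ : ℂ → ℂ),
      r < ρ →
      AnalyticOnNhd ℂ f₀ (ball 0 ρ) →
      f₀ 0 = 0 →
      (deriv f₀ 0).im = 0 →
      HeleShaw.rhoNorm ρ 1 (fun z => f₀ z - HeleShaw.polyFun p 0 z) ≤
        ENNReal.ofReal (l / √(k₀ : ℝ) * HeleShaw.minDeriv r t₁ (HeleShaw.polyFun p)) →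
    ∀ t₀ : ℝ, t₀ = min (1 / (C * k₀) * Real.log (ρ / r)) t₁ →
    ∃ f : ℝ → ℂ → ℂ,
      -- the perturbed solution
      (∀ z ∈ closedBall (0 : ℂ) r, f 0 z = f₀ z) ∧
      HeleShaw.IsStrongStar t₀ f ∧
      HeleShaw.IsC1Open r t₀ f ∧
      (∀ t ∈ Icc 0 t₀, HeleShaw.IsOmega (ball 0 r) (f t)) ∧
      (∀ t ∈ Icc 0 t₀,
        HeleShaw.mNorm r (fun z => deriv (f t) z - deriv (HeleShaw.polyFun p t) z) ≤
          ENNReal.ofReal (l * HeleShaw.minDeriv r t₁ (HeleShaw.polyFun p))) ∧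
      -- it is the limit of the polynomial solutions that start from the truncated data
      (∃ g : ℕ → ℝ → ℂ[X],
        (∀ k, g k 0 = p 0 + ∑ i ∈ Finset.Icc 1 k,
            Polynomial.C (HeleShaw.coeffAt (fun z => f₀ z - HeleShaw.polyFun p 0 z) i) * X ^ i) ∧
        (∀ k, HeleShaw.IsStrongStar t₀ (HeleShaw.polyFun (g k))) ∧
        (∀ k, HeleShaw.IsC1Closed r t₀ (HeleShaw.polyFun (g k))) ∧
        (∀ k, ∀ t ∈ Icc 0 t₀, HeleShaw.IsOmega (closedBall 0 r) (HeleShaw.polyFun (g k) t)) ∧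
        Tendsto (fun k => ⨆ t ∈ Icc 0 t₀,
            HeleShaw.mNorm r (fun z => deriv (HeleShaw.polyFun (g k) t) z - deriv (f t) z))
          atTop (𝓝 0)) ∧
      -- the estimates of the derivatives of order `j`
      (∀ (j : ℕ) (δ : ℝ), 0 < δ →
        HeleShaw.rhoNorm ρ j (fun z => f₀ z - HeleShaw.polyFun p 0 z) ≤ ENNReal.ofReal δ →
        ∀ t ∈ Icc 0 t₀,
          HeleShaw.mNorm r (fun z => iteratedDeriv j (f t) z -
              iteratedDeriv j (HeleShaw.polyFun p t) z) ≤
            ENNReal.ofReal (c j k₀ * δ)) := by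
  -- The factor `√k₀ k₀^j` comes from `stepBound`; the summand 1 only secures positivity at k = 0.
  refine ⟨fun j k => √k * (k : ℝ) ^ j + 1, fun j k => by positivity, ?_⟩
  intro k₀ r t₁ l p hr ht₁ hl hdeg _ ho hp
  have hr0 : 0 < r := by linarith
  have h01 : (0 : ℝ) ∈ Icc 0 t₁ := left_mem_Icc.2 ht₁.le
  have hpd : ∀ t, deriv (HeleShaw.polyFun p t) 0 = (p t).coeff 1 := fun t => by
    rw [HeleShaw.deriv_polyFun, ← coeff_zero_eq_eval_zero, HeleShaw.coeff_zero_derivative]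
  have hk₀ : 0 < k₀ := by
    rw [Nat.pos_iff_ne_zero]
    intro h
    have h1 := (ho 0 h01).deriv_re
    rw [hpd, coeff_eq_zero_of_natDegree_lt (by rw [hdeg 0 h01, h]; exact one_pos)] at h1
    simp at h1
  have hk₀' : (0 : ℝ) < k₀ := by exact_mod_cast hk₀
  have hps := HeleShaw.polySol_of_isStrongStar hk₀ (fun t ht => (hdeg t ht).le) hp
  obtain ⟨hm, M, hM, hpin⟩ := hps.exists_pinched_minDeriv ht₁.le hr0.le hk₀ ho
  set m := HeleShaw.minDeriv r t₁ (HeleShaw.polyFun p) with hmdef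
  -- A negative l acts as 0, because `ENNReal.ofReal` truncates.
  set l' := max l 0 with hl'
  have hl'1 : l' < 1 := max_lt hl one_pos
  have hl'0 : 0 ≤ l' := le_max_right _ _
  set A := l' * m with hA
  -- The midpoint between `l' m` and m leaves room both for the bootstrap and for a positive lower
  -- bound `m - A'`.
  set A' := (1 + l') / 2 * m with hA'
  have hAA' : A < A' := mul_lt_mul_of_pos_right (by linarith) hm
  have hA'm : A' < m := by
    have : (1 + l') / 2 * m < 1 * m := mul_lt_mul_of_pos_right (by linarith) hm
    linarith
  have hA'0 : 0 ≤ A' := by positivity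
  have hAof : ENNReal.ofReal A = ENNReal.ofReal (l * m) := by
    rcases le_total 0 l with h | h
    · rw [hA, hl', max_eq_left h]
    · rw [hA, hl', max_eq_right h, zero_mul, ENNReal.ofReal_zero,
        ENNReal.ofReal_of_nonpos (mul_nonpos_of_nonpos_of_nonneg h hm.le)]
  -- The constant C is the Lipschitz constant of the velocity for derivatives between `m - A'` and
  -- `M + A'`; it depends on the reference solution, r and l only.
  have hC := HeleShaw.lipConst_pos (r := r) (M := M + A') hr (sub_pos.2 hA'm) (by linarith)
  refine ⟨_, hC, ?_⟩
  intro ρ f₀ hρ hf₀ hf₀0 hf₀1 hnorm t₀ ht₀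
  have hρ0 : 0 < ρ := by linarith
  set v : ℂ → ℂ := fun z => f₀ z - HeleShaw.polyFun p 0 z with hv
  set b : ℕ → ℂ := fun i => HeleShaw.coeffAt v i with hb
  have hlog : 0 < Real.log (ρ / r) := Real.log_pos ((one_lt_div hr0).2 hρ)
  have ht₀0 : 0 < t₀ := by
    rw [ht₀]
    exact lt_min (by positivity) ht₁
  have ht₀1 : t₀ ≤ t₁ := by rw [ht₀]; exact min_le_right _ _
  have hsub : ∀ t ∈ Icc 0 t₀, t ∈ Icc 0 t₁ := fun t ht => ⟨ht.1, ht.2.trans ht₀1⟩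
  have hvan : AnalyticOnNhd ℂ v (ball 0 ρ) :=
    hf₀.sub (HeleShaw.analyticOnNhd_polyFun p 0 _)
  have hpow : ∀ (j i : ℕ), ((i : ℝ) + 1) ^ ((1 : ℝ) / 2 + (j : ℝ)) =
      √((i + 1 : ℕ) : ℝ) * ((i + 1 : ℕ) : ℝ) ^ j := by
    intro j i
    have hi : (0 : ℝ) < (i : ℝ) + 1 := by positivity
    rw [Real.rpow_add hi, Real.rpow_natCast, Real.sqrt_eq_rpow]
    push_cast
    rfl
  have hconv : ∀ (j : ℕ) (B : ℝ), HeleShaw.rhoNorm ρ j v ≤ ENNReal.ofReal B →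
      Summable (fun i => ‖b (i + 1)‖ * ρ ^ (i + 1) *
        (√((i + 1 : ℕ) : ℝ) * ((i + 1 : ℕ) : ℝ) ^ j)) ∧
      ∑' i, ‖b (i + 1)‖ * ρ ^ (i + 1) * (√((i + 1 : ℕ) : ℝ) * ((i + 1 : ℕ) : ℝ) ^ j) ≤
        max B 0 := by
    intro j B hB
    refine HeleShaw.summable_of_tsum_ofReal_le (fun i => by positivity) ?_
    simpa only [HeleShaw.rhoNorm, hpow] using hB
  obtain ⟨hs1, hs1le⟩ := hconv 1 _ hnorm
  simp only [pow_one] at hs1 hs1le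
  have hsk : 0 < √(k₀ : ℝ) := Real.sqrt_pos.2 hk₀'
  -- The factor `√k₀` of the costs cancels the `√k₀` in the smallness hypothesis.
  have hbA : ∑' i, HeleShaw.stepBound' k₀ ρ (i + 1) (b (i + 1)) ≤ A := by
    simp only [HeleShaw.stepBound']
    rw [tsum_mul_left]
    calc _ ≤ √(k₀ : ℝ) * max (l / √(k₀ : ℝ) * m) 0 := by gcongr
      _ = max (√(k₀ : ℝ) * (l / √(k₀ : ℝ) * m)) (√(k₀ : ℝ) * 0) :=
          mul_max_of_nonneg _ _ hsk.le
      _ = max (l * m) (0 * m) := by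
          congr 1
          · field_simp
          · simp
      _ = A := by rw [hA, hl', max_mul_of_nonneg _ _ hm.le]
  have hb1 : (b 1).im = 0 := by
    have h1 : b 1 = deriv f₀ 0 - deriv (HeleShaw.polyFun p 0) 0 := by
      simp only [hb, HeleShaw.coeffAt, iteratedDeriv_one, Nat.factorial_one, Nat.cast_one, div_one]
      exact deriv_sub (hf₀ 0 (mem_ball_self hρ0)).differentiableAt
        (HeleShaw.analyticOnNhd_polyFun p 0 univ 0 (mem_univ _)).differentiableAt
    rw [h1, Complex.sub_im, hf₀1, (ho 0 h01).deriv_im, sub_zero]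
  have hv0 : v 0 = 0 := by
    simp only [hv]
    rw [hf₀0, (ho 0 h01).map_zero, sub_zero]
  have hlim : ∀ z ∈ closedBall (0 : ℂ) r, Tendsto
      (fun k => (p 0 + ∑ i ∈ Finset.Icc 1 k, C (b i) * X ^ i).eval z) atTop (𝓝 (f₀ z)) := by
    intro z hz
    have hzρ : z ∈ ball (0 : ℂ) ρ := closedBall_subset_ball hρ hz
    have h1 := (Complex.hasSum_taylorSeries_on_ball hvan.differentiableOn hzρ).tendsto_sum_nat
    have h2 := ((tendsto_add_atTop_iff_nat 1).2 h1).const_add ((p 0).eval z)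
    have h3 : (p 0).eval z + v z = f₀ z := by simp [hv, HeleShaw.polyFun]
    rw [h3] at h2
    refine h2.congr fun k => ?_
    rw [eval_add, eval_finsetSum, Finset.sum_range_succ']
    congr 1
    simp only [pow_zero, iteratedDeriv_zero, hv0, smul_zero, add_zero]
    rw [Finset.range_eq_Ico, Finset.sum_Ico_add' (fun i => ((i.factorial : ℂ)⁻¹ •
      (z - 0) ^ i • iteratedDeriv i v 0)) 0 k 1]
    refine Finset.sum_congr rfl fun i _ => ?_
    simp only [hb, HeleShaw.coeffAt, eval_mul, eval_C, eval_pow, eval_X, smul_eq_mul, sub_zero]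
    ring
  obtain ⟨f, h1, h2, h3, h4, h5, h6, h7⟩ := HeleShaw.exists_perturbed_solution (f₀ := f₀) hr hρ
    hA'm hAA' hM hk₀ ht₀0 (by rw [ht₀]; exact min_le_left _ _) (hps.mono ht₀1 le_rfl)
    (fun t ht => hpin t (hsub t ht))
    (fun t ht => by rw [← hpd]; exact (ho t (hsub t ht)).deriv_im)
    (fun t ht => by rw [← hpd]; exact (ho t (hsub t ht)).deriv_re)
    (hs1.mul_left _) hbA hb1 hlim
  refine ⟨f, h1, h2, h3, h4, fun t ht => ?_, h6, fun j δ hδ hjδ t ht => ?_⟩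
  · rw [← hAof]; exact h5 t ht
  · obtain ⟨hs, hsle⟩ := hconv j δ hjδ
    refine (h7 j (hs.mul_left _) t ht).trans (ENNReal.ofReal_le_ofReal ?_)
    simp only [HeleShaw.stepBound]
    rw [tsum_mul_left]
    rw [max_eq_left hδ.le] at hsle
    calc _ ≤ √(k₀ : ℝ) * (k₀ : ℝ) ^ j * δ := by gcongr
      _ ≤ (√(k₀ : ℝ) * (k₀ : ℝ) ^ j + 1) * δ := by gcongr; linarith
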